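/- **Conventions.** Coordinates on $\mathbb K^{2n}$ ($\mathbb K=\mathbb R,\mathbb C$) are $(\vec z,\vec x)$, with $\vec z$ the momenta and $\vec x$ the positions, and $\omega_n((\vec z,\vec x),(\vec z',\vec x'))=\sum_j (z_jx'_j-x_jz'_j)$. On $\mathbb C^{2n}\oplus\mathbb C^{2m}$ put $\omega_{n,m}=\omega_m-\omega_n$. A *prop* is a strict symmetric monoidal category whose monoid of objects is $(\mathbb N,+)$; an *embedding of props* is a faithful strict symmetric monoidal functor that is the identity on objects. **$\mathsf{ALR}[\mathbb C]^+$.** A morphism $n\to m$ is a positive affine Lagrangian relation: either $\varnothing\subseteq \mathbb C^{2n}\oplus\mathbb C^{2m}$, or a translate $L+a$ of a complex linear subspace $L$ by a real vector $a$, where $L$ is Lagrangian ($\omega_{n,m}|_L=0$ and $\dim L=n+m$) and $i\,\omega_{n,m}(\bar v,v)\ge 0$ for all $v\in L$. Composition is relational composition, identities are the diagonals, the tensor product is the direct sum of relations, and the symmetry exchanges the two groups of modes. **$\mathsf{QGauss}$.** An $n$-mode *Gaussian state* with phase matrix $\Phi$ and displacement $(\vec s,\vec t)\in\mathbb R^{2n}$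 is a function in $L^2(\mathbb R^n)$ of the form $$\varphi(\vec x)=e^{i\alpha}e^{i\vec s^{T}\vec x}\Big(\frac{\det \operatorname{Im}\Phi}{\pi^n}\Big)^{1/4} e^{\,i(\vec x-\vec t)^T\Phi(\vec x-\vec t)/2},\qquad \alpha\in\mathbb R,$$ where $\Phi$ is complex symmetric with $\operatorname{Im}\Phi\succ0$. A *Gaussian unitary* is a unitary on $L^2(\mathbb R^n)$ that maps Gaussian states to Gaussian states. The morphisms $n\to m$ of $\mathsf{QGauss}$ are the bounded operators $L^2(\mathbb R^n)\to L^2(\mathbb R^m)$ generated, under composition, tensor product and the symmetries (with identities), by the Gaussian states $|\varphi\rangle:0\to n$, the Gaussian unitaries $n\to n$ and the projections $\langle\psi|:n\to 0$ onto Gaussian states, two operators being identified when they differ by a nonzero scalar factor (for states and unitaries: by a global phase). The *Wigner transform* of $\varphi\in L^2(\mathbb R^n)$ is $$W_\varphi(\vec q,\vec p)=\pi^{-n}\int_{\mathbb R^n}\overline{\varphi(\vec q+\vec\xi)}\,\varphi(\vec q-\vec\xi)\,e^{2i\vec\xi^T\vec p}\,d\vec\xi ;$$ $\varphi$ *has Wigner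 data* $(\Sigma,\mu)$ if $\Sigma\succ 0$ and $W_\varphi$ is the density of the Gaussian distribution $\mathcal N(\Sigma,\mu)$ in the coordinates $(\vec z,\vec x)=(\vec p,\vec q)$. **Proposition.** $\mathsf{QGauss}$ is a prop, and $\mathsf{ALR}[\mathbb C]^+$ is a sub-prop of the prop of relations between the spaces $\mathbb C^{2n}$. Moreover: 1. A Gaussian state with phase matrix $\Phi=U+iV$ and displacement $(\vec s,\vec t)$ has Wigner data $\Sigma_\Phi=\frac12\begin{bmatrix}V+UV^{-1}U & UV^{-1}\\ V^{-1}U & V^{-1}\end{bmatrix}$ and $\mu=(\vec s,\vec t)$. 2. For every Gaussian unitary $\mathcal U$ on $L^2(\mathbb R^n)$ there is a unique affine symplectomorphism $v\mapsto Sv+d$ of $(\mathbb R^{2n},\omega_n)$ that represents $\mathcal U$, in the sense that whenever a Gaussian state $\varphi$ has Wigner data $(\Sigma,\mu)$, $\mathcal U\varphi$ has Wigner data $(S\Sigma S^T,S\mu+d)$. 3. If $\varphi$ is a Gaussian state on $m+n$ modes and $\psi$ one on $n$ modes, then in $\mathsf{QGauss}$ the composite $(1_m\oplus\langle\psi|)\circ|\varphi\rangle$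 is a Gaussian state; if $\varphi$ has Wigner data $(\Sigma,\mu)$, with blocks $\Sigma_{mm},\Sigma_{mn},\Sigma_{nm},\Sigma_{nn}$ and $\mu_m,\mu_n$, and $\psi$ has Wigner data $(\Delta,\nu)$, then the composite has Wigner data $$\big(\Sigma_{mm}-\Sigma_{mn}(\Sigma_{nn}+\Delta)^{-1}\Sigma_{nm},\ \ \mu_m-\Sigma_{mn}(\Sigma_{nn}+\Delta)^{-1}(\mu_n-\nu)\big).$$ 4. There is an embedding of props $F:\mathsf{QGauss}\to\mathsf{ALR}[\mathbb C]^+$ such that, for a Gaussian state $\varphi$ with phase matrix $\Phi$ and displacement $(\vec s,\vec t)$, $F(|\varphi\rangle)=\{(\vec z,\vec x)\in\mathbb C^{2n}: \vec z-\vec s=\Phi(\vec x-\vec t)\}$ and $F(\langle\varphi|)$ is the complex conjugate of this subspace, regarded as a relation $n\to0$; and, for a Gaussian unitary $\mathcal U$ represented by $(S,d)$, $F(\mathcal U)=\{(v,Sv+d):v\in\mathbb C^{2n}\}$. -/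

import Mathlib

open MeasureTheory Matrix Complex

noncomputable section

namespace GaussianProp

/-! ### Square integrable functions on `ℝⁿ` and their tensor products -/

/-- The Hilbert space `L²(ℝⁿ)` of an `n`-qumode system. -/
abbrev L2 (n : ℕ) : Type := Lp ℂ 2 (volume : Measure (Fin n → ℝ))

/-- The splitting `ℝⁿ⁺ᵐ → ℝⁿ × ℝᵐ`. -/
def split (n m : ℕ) (x : Fin (n + m) → ℝ) : (Fin n → ℝ) × (Fin m → ℝ) :=
  (fun i => x (Fin.castAdd m i), fun j => x (Fin.natAdd n j))

theorem measurePreserving_split (n m : ℕ) : MeasurePreserving (split n m) volume volume := by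
  have h1 := volume_measurePreserving_sumPiEquivProdPi (fun _ : Fin n ⊕ Fin m => ℝ)
  have h2 := (volume_measurePreserving_piCongrLeft (fun _ : Fin (n + m) => ℝ)
    (finSumFinEquiv (m := n) (n := m))).symm
  exact h1.comp h2

/-- The function `(x, y) ↦ f x * g y` on `ℝⁿ⁺ᵐ`. -/
def tensorFun {n m : ℕ} (f : (Fin n → ℝ) → ℂ) (g : (Fin m → ℝ) → ℂ) :
    (Fin (n + m) → ℝ) → ℂ :=
  fun x => f (split n m x).1 * g (split n m x).2

theorem memLp_tensorFun {n m : ℕ} (f : L2 n) (g : L2 m) : MemLp (tensorFun f g) 2 volume := by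
  have hf := Lp.memLp f
  have hg := Lp.memLp g
  have hm : AEStronglyMeasurable (fun z : (Fin n → ℝ) × (Fin m → ℝ) => f z.1 * g z.2) volume :=
    hf.1.comp_fst.mul hg.1.comp_snd
  have h : MemLp (fun z : (Fin n → ℝ) × (Fin m → ℝ) => f z.1 * g z.2) 2 volume := by
    rw [memLp_two_iff_integrable_sq_norm hm]
    have := ((memLp_two_iff_integrable_sq_norm hf.1).1 hf).mul_prod
      ((memLp_two_iff_integrable_sq_norm hg.1).1 hg)
    rw [Measure.volume_eq_prod]
    simpa only [norm_mul, mul_pow] using this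
  exact h.comp_measurePreserving (measurePreserving_split n m)

/-- The simple tensor `f ⊗ g ∈ L²(ℝⁿ⁺ᵐ)`. -/
def tensorVec {n m : ℕ} (f : L2 n) (g : L2 m) : L2 (n + m) := (memLp_tensorFun f g).toLp _

/-- `R = T ⊗ S` as bounded operators: `R (f ⊗ g) = T f ⊗ S g` for all `f`, `g`. -/
def IsTensorOp {n m n' m' : ℕ} (R : L2 (n + n') →L[ℂ] L2 (m + m'))
    (T : L2 n →L[ℂ] L2 m) (S : L2 n' →L[ℂ] L2 m') : Prop :=
  ∀ f g, R (tensorVec f g) = tensorVec (T f) (S g)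

/-- Exchange of the two groups of coordinates, `ℝᵐ⁺ⁿ → ℝⁿ⁺ᵐ`. -/
def flipCoord (n m : ℕ) (y : Fin (m + n) → ℝ) : Fin (n + m) → ℝ := fun i => y (finAddFlip i)

theorem measurePreserving_flipCoord (n m : ℕ) :
    MeasurePreserving (flipCoord n m) volume volume :=
  (volume_measurePreserving_piCongrLeft (fun _ : Fin (m + n) => ℝ)
    (finAddFlip (m := n) (n := m))).symm

/-- The symmetry `L²(ℝⁿ⁺ᵐ) → L²(ℝᵐ⁺ⁿ)`, which sends `f ⊗ g` to `g ⊗ f`. -/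
def swapOp (n m : ℕ) : L2 (n + m) →L[ℂ] L2 (m + n) :=
  (Lp.compMeasurePreservingₗᵢ ℂ (flipCoord n m)
    (measurePreserving_flipCoord n m)).toContinuousLinearMap

/-- The constant function `1`, the unit vector of `L²(ℝ⁰) ≅ ℂ`. -/
def unitVec : L2 0 :=
  indicatorConstLp 2 MeasurableSet.univ
    (by simp [volume_pi, Measure.pi_of_empty (x := fun i : Fin 0 => i.elim0)]) 1

/-- A vector `φ ∈ L²(ℝⁿ)` as the operator `|φ⟩ : L²(ℝ⁰) → L²(ℝⁿ)`, `1 ↦ φ`. -/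
def ket {n : ℕ} (φ : L2 n) : L2 0 →L[ℂ] L2 n := (innerSL ℂ unitVec).smulRight φ

/-- The projection onto `ψ`, as the operator `⟨ψ| : L²(ℝⁿ) → L²(ℝ⁰)`, `f ↦ ⟨ψ, f⟩`. -/
def bra {n : ℕ} (ψ : L2 n) : L2 n →L[ℂ] L2 0 := (innerSL ℂ ψ).smulRight unitVec

/-! ### Gaussian states, Gaussian unitaries and the Wigner transform -/

/-- The wave function of the Gaussian state with global phase `α`, phase matrix `Φ` and
displacement `(s, t)`. -/
def gaussianWave {n : ℕ} (α : ℝ) (Φ : Matrix (Fin n) (Fin n) ℂ) (s t : Fin n → ℝ)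
    (x : Fin n → ℝ) : ℂ :=
  let y : Fin n → ℂ := fun i => ((x i - t i : ℝ) : ℂ)
  exp (I * α) * exp (I * ((s ⬝ᵥ x : ℝ) : ℂ)) *
    ((((Φ.map Complex.im).det / Real.pi ^ n) ^ (1 / 4 : ℝ) : ℝ) : ℂ) *
    exp (I * (y ⬝ᵥ Φ *ᵥ y) / 2)

/-- A phase matrix: complex symmetric with positive definite imaginary part. -/
def IsPhaseMatrix {n : ℕ} (Φ : Matrix (Fin n) (Fin n) ℂ) : Prop :=
  Φ.IsSymm ∧ (Φ.map Complex.im).PosDef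

/-- `φ` is a Gaussian state with phase matrix `Φ` and displacement `(s, t)`. -/
def IsGaussianWith {n : ℕ} (φ : L2 n) (Φ : Matrix (Fin n) (Fin n) ℂ) (s t : Fin n → ℝ) : Prop :=
  IsPhaseMatrix Φ ∧ ∃ α : ℝ, φ =ᵐ[volume] gaussianWave α Φ s t

/-- `φ` is a Gaussian state. -/
def IsGaussianState {n : ℕ} (φ : L2 n) : Prop := ∃ Φ s t, IsGaussianWith φ Φ s t

/-- A unitary on `L²(ℝⁿ)` is Gaussian if it sends Gaussian states to Gaussian states. -/
def IsGaussianUnitary {n : ℕ} (U : L2 n ≃ₗᵢ[ℂ] L2 n) : Prop :=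
  ∀ φ, IsGaussianState φ → IsGaussianState (U φ)

/-- A unitary as a bounded operator. -/
def unitaryOp {n : ℕ} (U : L2 n ≃ₗᵢ[ℂ] L2 n) : L2 n →L[ℂ] L2 n :=
  U.toContinuousLinearEquiv.toContinuousLinearMap

/-- The Wigner transform at position `q` and momentum `p`. -/
def wigner {n : ℕ} (φ : L2 n) (q p : Fin n → ℝ) : ℂ :=
  (1 / (Real.pi : ℂ) ^ n) * ∫ ξ : Fin n → ℝ,
    star (φ (q + ξ)) * φ (q - ξ) * exp (2 * I * ((ξ ⬝ᵥ p : ℝ) : ℂ))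

/-- The density of the Gaussian distribution with covariance matrix `C` and mean `μ`. -/
def gaussianDensity {ι : Type} [Fintype ι] [DecidableEq ι] (C : Matrix ι ι ℝ) (μ u : ι → ℝ) : ℝ :=
  Real.exp (-(1 / 2) * ((u - μ) ⬝ᵥ C⁻¹ *ᵥ (u - μ))) /
    Real.sqrt ((2 * Real.pi) ^ Fintype.card ι * C.det)

/-- The index set of the phase space of `n` modes: `Sum.inl j` is the `z`-coordinate (momentum)
and `Sum.inr j` the `x`-coordinate (position) of the mode `j`. -/
abbrev Ix (n : ℕ) : Type := Fin n ⊕ Fin n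

/-- The Wigner transform of `φ` is the density of the Gaussian distribution `𝒩(C, μ)` on the
phase space `ℝ²ⁿ`. -/
def HasWignerData {n : ℕ} (φ : L2 n) (C : Matrix (Ix n) (Ix n) ℝ) (μ : Ix n → ℝ) : Prop :=
  C.PosDef ∧ ∀ q p : Fin n → ℝ, wigner φ q p = (gaussianDensity C μ (Sum.elim p q) : ℂ)

/-- The covariance matrix on phase space that belongs to the phase matrix `Φ = U + iV`. -/
def phaseCov {n : ℕ} (Φ : Matrix (Fin n) (Fin n) ℂ) : Matrix (Ix n) (Ix n) ℝ :=
  let U := Φ.map Complex.re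
  let V := Φ.map Complex.im
  (1 / 2 : ℝ) • fromBlocks (V + U * V⁻¹ * U) (U * V⁻¹) (V⁻¹ * U) V⁻¹

/-- The affine symplectomorphism `v ↦ S v + d` of `ℝ²ⁿ` represents `U`: it describes the action of
`U` on the Wigner data of Gaussian states. -/
def RepresentsUnitary {n : ℕ} (S : Matrix (Ix n) (Ix n) ℝ) (d : Ix n → ℝ)
    (U : L2 n ≃ₗᵢ[ℂ] L2 n) : Prop :=
  S ∈ symplecticGroup (Fin n) ℝ ∧
    ∀ φ C μ, IsGaussianState φ → HasWignerData φ C μ →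
      HasWignerData (U φ) (S * C * Sᵀ) (S *ᵥ μ + d)

/-- The phase-space coordinates of the first `n` of `n + m` modes. -/
def fstIx (n m : ℕ) : Ix n → Ix (n + m) := Sum.map (Fin.castAdd m) (Fin.castAdd m)

/-- The phase-space coordinates of the last `m` of `n + m` modes. -/
def sndIx (n m : ℕ) : Ix m → Ix (n + m) := Sum.map (Fin.natAdd n) (Fin.natAdd n)

/-- Covariance matrix after projecting the last `n` of `m + n` modes onto a Gaussian state with
covariance matrix `D`. -/
def schurCov {m n : ℕ} (C : Matrix (Ix (m + n)) (Ix (m + n)) ℝ) (D : Matrix (Ix n) (Ix n) ℝ) :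
    Matrix (Ix m) (Ix m) ℝ :=
  C.submatrix (fstIx m n) (fstIx m n) -
    C.submatrix (fstIx m n) (sndIx m n) * (C.submatrix (sndIx m n) (sndIx m n) + D)⁻¹ *
      C.submatrix (sndIx m n) (fstIx m n)

/-- Mean after projecting the last `n` of `m + n` modes onto a Gaussian state with covariance
matrix `D` and mean `ν`. -/
def schurMean {m n : ℕ} (C : Matrix (Ix (m + n)) (Ix (m + n)) ℝ) (μ : Ix (m + n) → ℝ)
    (D : Matrix (Ix n) (Ix n) ℝ) (ν : Ix n → ℝ) : Ix m → ℝ :=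
  μ ∘ fstIx m n -
    (C.submatrix (fstIx m n) (sndIx m n) * (C.submatrix (sndIx m n) (sndIx m n) + D)⁻¹) *ᵥ
      (μ ∘ sndIx m n - ν)

/-! ### The prop of quantum Gaussian transformations -/

/-- The operators generated by Gaussian states, Gaussian unitaries and projections onto Gaussian
states under composition, tensor product and symmetries. -/
inductive IsQGauss : ∀ {n m : ℕ}, (L2 n →L[ℂ] L2 m) → Prop
  | state {n : ℕ} (φ : L2 n) (h : IsGaussianState φ) : IsQGauss (ket φ)
  | unitary {n : ℕ} (U : L2 n ≃ₗᵢ[ℂ] L2 n) (h : IsGaussianUnitary U) : IsQGauss (unitaryOp U)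
  | effect {n : ℕ} (ψ : L2 n) (h : IsGaussianState ψ) : IsQGauss (bra ψ)
  | id (n : ℕ) : IsQGauss (ContinuousLinearMap.id ℂ (L2 n))
  | swap (n m : ℕ) : IsQGauss (swapOp n m)
  | comp {n m k : ℕ} (S : L2 m →L[ℂ] L2 k) (T : L2 n →L[ℂ] L2 m) (hS : IsQGauss S)
      (hT : IsQGauss T) : IsQGauss (S.comp T)
  | tensor {n m n' m' : ℕ} (R : L2 (n + n') →L[ℂ] L2 (m + m')) (T : L2 n →L[ℂ] L2 m)
      (S : L2 n' →L[ℂ] L2 m') (hT : IsQGauss T) (hS : IsQGauss S) (h : IsTensorOp R T S) :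
      IsQGauss R

/-- Equality of operators up to a nonzero scalar. On states and on unitaries, which are normalised,
this is equality up to a global phase. -/
def scalarSetoid (n m : ℕ) : Setoid {T : L2 n →L[ℂ] L2 m // IsQGauss T} where
  r T T' := ∃ c : ℂ, c ≠ 0 ∧ T'.1 = c • T.1
  iseqv :=
    { refl := fun T => ⟨1, one_ne_zero, (one_smul ℂ _).symm⟩
      symm := by
        rintro T T' ⟨c, hc, h⟩
        exact ⟨c⁻¹, inv_ne_zero hc, by rw [h, smul_smul, inv_mul_cancel₀ hc, one_smul]⟩
      trans := by
        rintro T T' T'' ⟨c, hc, h⟩ ⟨d, hd, h'⟩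
        exact ⟨d * c, mul_ne_zero hd hc, by rw [h', h, smul_smul]⟩ }

/-- The morphisms `n → m` of the prop `QGauss`. -/
def QGauss (n m : ℕ) : Type := Quotient (scalarSetoid n m)

namespace QGauss

/-- The morphism given by an operator. -/
def mk {n m : ℕ} (T : L2 n →L[ℂ] L2 m) (h : IsQGauss T) : QGauss n m :=
  Quotient.mk (scalarSetoid n m) ⟨T, h⟩

/-- Gaussian states as morphisms `0 → n`. -/
def state {n : ℕ} (φ : L2 n) (h : IsGaussianState φ) : QGauss 0 n := mk (ket φ) (.state φ h)

/-- Gaussian unitaries as morphisms `n → n`. -/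
def unitary {n : ℕ} (U : L2 n ≃ₗᵢ[ℂ] L2 n) (h : IsGaussianUnitary U) : QGauss n n :=
  mk (unitaryOp U) (.unitary U h)

/-- Projections onto Gaussian states as morphisms `n → 0`. -/
def effect {n : ℕ} (ψ : L2 n) (h : IsGaussianState ψ) : QGauss n 0 := mk (bra ψ) (.effect ψ h)

/-- Identities. -/
def id (n : ℕ) : QGauss n n := mk _ (.id n)

/-- Symmetries. -/
def swap (n m : ℕ) : QGauss (n + m) (m + n) := mk _ (.swap n m)

/-- Composition. -/
def comp {n m k : ℕ} (S : QGauss m k) (T : QGauss n m) : QGauss n k :=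
  Quotient.map₂ (sa := scalarSetoid m k) (sb := scalarSetoid n m) (sc := scalarSetoid n k)
    (fun S T => ⟨S.1.comp T.1, .comp S.1 T.1 S.2 T.2⟩)
    (by
      rintro S S' ⟨c, hc, h⟩ T T' ⟨d, hd, h'⟩
      refine ⟨c * d, mul_ne_zero hc hd, ?_⟩
      change S'.1.comp T'.1 = (c * d) • S.1.comp T.1
      rw [h, h', ContinuousLinearMap.smul_comp, ContinuousLinearMap.comp_smul, smul_smul]) S T

/-- `R` is the tensor product of `T` and `S`. -/
def IsTensor {n m n' m' : ℕ} (R : QGauss (n + n') (m + m')) (T : QGauss n m)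
    (S : QGauss n' m') : Prop :=
  ∃ r t s, ∃ (hr : IsQGauss r) (ht : IsQGauss t) (hs : IsQGauss s),
    R = mk r hr ∧ T = mk t ht ∧ S = mk s hs ∧ IsTensorOp r t s

end QGauss

/-! ### The prop of positive affine Lagrangian relations -/

/-- The complex phase space `ℂ²ⁿ`. -/
abbrev Phase (n : ℕ) : Type := Ix n → ℂ

/-- The symplectic form `ω_n`. -/
def omega {n : ℕ} (v w : Phase n) : ℂ :=
  ∑ j : Fin n, (v (.inl j) * w (.inr j) - v (.inr j) * w (.inl j))

/-- The twisted symplectic form `ω_{n,m}` on `ℂ²ⁿ ⊕ ℂ²ᵐ`. -/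
def omega₂ {n m : ℕ} (v w : Phase n × Phase m) : ℂ := omega v.2 w.2 - omega v.1 w.1

/-- Linear Lagrangian relations `n → m`. -/
def IsLagrangian {n m : ℕ} (L : Submodule ℂ (Phase n × Phase m)) : Prop :=
  2 * Module.finrank ℂ L = Module.finrank ℂ (Phase n × Phase m) ∧
    ∀ v ∈ L, ∀ w ∈ L, omega₂ v w = 0

/-- Positivity: `i ω(v̄, v) ≥ 0` on `L`. (This number is real for every `v`.) -/
def IsPositive {n m : ℕ} (L : Submodule ℂ (Phase n × Phase m)) : Prop :=
  ∀ v ∈ L, 0 ≤ (I * omega₂ (star v) v).re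

/-- Inclusion of the real phase space. -/
def ofRealVec {n : ℕ} (a : Ix n → ℝ) : Phase n := fun i => (a i : ℂ)

/-- Positive affine Lagrangian relations: the empty relation, and the translates of positive
Lagrangian relations by real vectors. -/
def IsPosAffLag {n m : ℕ} (R : Set (Phase n × Phase m)) : Prop :=
  R = ∅ ∨ ∃ (L : Submodule ℂ (Phase n × Phase m)) (a : Ix n → ℝ) (b : Ix m → ℝ),
    IsLagrangian L ∧ IsPositive L ∧ R = {v | v - (ofRealVec a, ofRealVec b) ∈ L}

/-- The morphisms `n → m` of the prop of positive affine Lagrangian relations. -/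
def ALRPlus (n m : ℕ) : Type := {R : Set (Phase n × Phase m) // IsPosAffLag R}

/-- The identity relation. -/
def relId (n : ℕ) : Set (Phase n × Phase n) := {v | v.1 = v.2}

/-- The composite `S ∘ R` of relations. -/
def relComp {n m k : ℕ} (S : Set (Phase m × Phase k)) (R : Set (Phase n × Phase m)) :
    Set (Phase n × Phase k) :=
  {v | ∃ b, (v.1, b) ∈ R ∧ (b, v.2) ∈ S}

/-- The direct sum of relations. -/
def relSum {n m n' m' : ℕ} (R : Set (Phase n × Phase m)) (S : Set (Phase n' × Phase m')) :
    Set (Phase (n + n') × Phase (m + m')) :=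
  {v | (v.1 ∘ fstIx n n', v.2 ∘ fstIx m m') ∈ R ∧ (v.1 ∘ sndIx n n', v.2 ∘ sndIx m m') ∈ S}

/-- The symmetry relation. -/
def relSwap (n m : ℕ) : Set (Phase (n + m) × Phase (m + n)) :=
  {v | v.2 ∘ fstIx m n = v.1 ∘ sndIx n m ∧ v.2 ∘ sndIx m n = v.1 ∘ fstIx n m}

/-- Positive affine Lagrangian relations form a sub-prop of the prop of relations. -/
structure ALRPlusIsSubprop : Prop where
  id : ∀ n, IsPosAffLag (relId n)
  swap : ∀ n m, IsPosAffLag (relSwap n m)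
  comp : ∀ {n m k : ℕ} (S : ALRPlus m k) (R : ALRPlus n m), IsPosAffLag (relComp S.1 R.1)
  sum : ∀ {n m n' m' : ℕ} (R : ALRPlus n m) (S : ALRPlus n' m'), IsPosAffLag (relSum R.1 S.1)

/-- The affine Lagrangian subspace `{(z, x) | z - s = Φ (x - t)}` of a Gaussian state, as a
relation `0 → n`. -/
def stateRel {n : ℕ} (Φ : Matrix (Fin n) (Fin n) ℂ) (s t : Fin n → ℝ) :
    Set (Phase 0 × Phase n) :=
  {v | (fun j => v.2 (.inl j) - (s j : ℂ)) = Φ *ᵥ (fun j => v.2 (.inr j) - (t j : ℂ))}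

/-- The relation `n → 0` of the projection onto a Gaussian state: the complex conjugate of the
subspace of the state, which is positive for `-ω_n`. -/
def effectRel {n : ℕ} (Φ : Matrix (Fin n) (Fin n) ℂ) (s t : Fin n → ℝ) :
    Set (Phase n × Phase 0) :=
  {v | (star v.2, star v.1) ∈ stateRel Φ s t}

/-- The complex graph of the real affine map `v ↦ S v + d`. -/
def graphRel {n : ℕ} (S : Matrix (Ix n) (Ix n) ℝ) (d : Ix n → ℝ) : Set (Phase n × Phase n) :=
  {v | v.2 = S.map (fun a : ℝ => (a : ℂ)) *ᵥ v.1 + ofRealVec d}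

/-! ### Props and embeddings -/

/-- The laws of a prop, that is of a strict symmetric monoidal category with objects `ℕ` and tensor
product `+` on objects. The tensor product of morphisms is given by its graph
(`IsTensor R T S` means `R = T ⊕ S`); heterogeneous equality identifies, for instance, morphisms
out of `(n + m) + k` and out of `n + (m + k)`. -/
structure IsProp (Hom : ℕ → ℕ → Type) (id : ∀ n, Hom n n)
    (comp : ∀ {n m k : ℕ}, Hom m k → Hom n m → Hom n k)
    (IsTensor : ∀ {n m n' m' : ℕ}, Hom (n + n') (m + m') → Hom n m → Hom n' m' → Prop)
    (swap : ∀ n m, Hom (n + m) (m + n)) : Prop where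
  id_comp : ∀ {n m : ℕ} (T : Hom n m), comp (id m) T = T
  comp_id : ∀ {n m : ℕ} (T : Hom n m), comp T (id n) = T
  assoc : ∀ {n m k l : ℕ} (R : Hom k l) (S : Hom m k) (T : Hom n m),
    comp (comp R S) T = comp R (comp S T)
  exists_tensor : ∀ {n m n' m' : ℕ} (T : Hom n m) (S : Hom n' m'), ∃! R, IsTensor R T S
  tensor_id : ∀ n m, IsTensor (id (n + m)) (id n) (id m)
  tensor_comp : ∀ {n m k n' m' k' : ℕ} {R : Hom (n + n') (m + m')} {R' : Hom (m + m') (k + k')}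
    {T : Hom n m} {S : Hom n' m'} {T' : Hom m k} {S' : Hom m' k'},
    IsTensor R T S → IsTensor R' T' S' → IsTensor (comp R' R) (comp T' T) (comp S' S)
  tensor_assoc : ∀ {n m n' m' n'' m'' : ℕ} {T : Hom n m} {T' : Hom n' m'} {T'' : Hom n'' m''}
    {A : Hom (n + n') (m + m')} {B : Hom (n + n' + n'') (m + m' + m'')}
    {C : Hom (n' + n'') (m' + m'')} {D : Hom (n + (n' + n'')) (m + (m' + m''))},
    IsTensor A T T' → IsTensor B A T'' → IsTensor C T' T'' → IsTensor D T C → HEq B D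
  tensor_unit : ∀ {n m : ℕ} {T : Hom n m} {R : Hom (n + 0) (m + 0)},
    IsTensor R T (id 0) → HEq R T
  unit_tensor : ∀ {n m : ℕ} {T : Hom n m} {R : Hom (0 + n) (0 + m)},
    IsTensor R (id 0) T → HEq R T
  swap_natural : ∀ {n m n' m' : ℕ} {T : Hom n m} {S : Hom n' m'} {R : Hom (n + n') (m + m')}
    {R' : Hom (n' + n) (m' + m)},
    IsTensor R T S → IsTensor R' S T → comp (swap m m') R = comp R' (swap n n')
  swap_swap : ∀ n m, comp (swap m n) (swap n m) = id (n + m)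
  swap_add : ∀ {n m k : ℕ} {A : Hom (n + m + k) (m + n + k)} {B : Hom (m + (n + k)) (m + (k + n))}
    {A' : Hom (n + (m + k)) (m + (n + k))} {B' : Hom (m + (n + k)) (m + k + n)},
    IsTensor A (swap n m) (id k) → IsTensor B (id m) (swap n k) → HEq A' A → HEq B' B →
    swap n (m + k) = comp B' A'

/-- `QGauss` is a prop. -/
def QGaussIsProp : Prop := IsProp QGauss QGauss.id QGauss.comp QGauss.IsTensor QGauss.swap

/-- Relations between complex phase spaces form a prop. -/
def RelIsProp : Prop :=
  IsProp (fun n m => Set (Phase n × Phase m)) relId relComp (fun R T S => R = relSum T S) relSwap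

/-- An embedding of props `QGauss → ALR[ℂ]⁺`: a faithful, identity-on-objects functor that
preserves tensor products and symmetries. -/
structure PropEmbedding where
  map : ∀ {n m : ℕ}, QGauss n m → ALRPlus n m
  map_id : ∀ n, (map (QGauss.id n)).1 = relId n
  map_comp : ∀ {n m k : ℕ} (S : QGauss m k) (T : QGauss n m),
    (map (S.comp T)).1 = relComp (map S).1 (map T).1
  map_tensor : ∀ {n m n' m' : ℕ} (R : QGauss (n + n') (m + m')) (T : QGauss n m)
    (S : QGauss n' m'), QGauss.IsTensor R T S → (map R).1 = relSum (map T).1 (map S).1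
  map_swap : ∀ n m, (map (QGauss.swap n m)).1 = relSwap n m
  faithful : ∀ {n m : ℕ}, Function.Injective (map : QGauss n m → ALRPlus n m)

end GaussianProp

end

open GaussianProp

/-! Up to a nonzero scalar, a Gaussian state is the vector `gv Φ b` with wave function exp(i xᵀΦx/2
+ b·x). The operators -i∂ - Φx + ib annihilate it, and the common zeros of their symbols form the
affine Lagrangian `lag Φ b`, z = Φx - ib, which determines Φ and b. Positivity of Im Φ is strict
positivity of the Hermitian form i ω(v̄, v) on its directions, and the displacement is its only real
point.

The embedding rests on the predicate `Rep T R`: the operator T sends each `gv Φ b` to a nonzero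
multiple of the Gaussian vector whose Lagrangian is the image of `lag Φ b` under R, and the adjoint
of T does the same for the conjugate transpose `dag R`. Generators have such relations, and the
predicate passes to composites and tensor products (`Rep.comp`, `Rep.tensor`). The tensor case
contracts one factor with a coherent vector at a time: a partial inner product of Gaussian vectors
is Gaussian, and its Lagrangian is the corresponding contraction of Lagrangians. The operator
determines the relation (`Rep.unique`, by applying T ⊗ 1 to a two-mode squeezed state), so the
assignment is well defined and functorial. The relation determines the operator up to a scalar
(`Rep.exists_eq_smul`, since coherent vectors are total and have nonzero overlaps with Gaussian
vectors), so it is faithful.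

A Gaussian unitary U is only assumed to preserve Gaussian states, so its affine symplectomorphism
has to be found. For fixed Φ, the phase matrix of U(`gv Φ a`) does not depend on a: suitable
quotients of matrix elements are entire and bounded in a, so Liouville applies. Cross ratios of
overlaps then show that a changes by a complex affine map whose linear part preserves a Hermitian
form. The imaginary part of that form is a multiple of ω, so the map is symplectic on real
displacements. It is the same for all Φ, because the modulus of the overlap of two Gaussian states
of fixed phase matrices is largest exactly when their displacements agree (`ActsOn.unique`).

Covariances enter through one linear criterion: Σ belongs to Φ exactly when 2Σξ + i(ξ_x, -ξ_z) lies
in z = Φx for all ξ (`inL_phaseCov`, `eq_phaseCov`). The laws Σ ↦ SΣSᵀ and the Schur complement both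
follow by checking it.

On the side of relations the delicate point is composition: a nonempty composite must contain a real
point. A coset p + L meets the real points as soon as p - p̄ lies in L + L̄, that is, annihilates L
∩ L̄. Vectors of L ∩ L̄ for the composite lift to null vectors of the positive forms of the factors,
and null vectors are closed under conjugation, so the condition can be checked in each factor. -/

noncomputable section

namespace GaussianProp

set_option linter.unusedSectionVars false

section

/-! ### Complex Gaussian integrals -/

/-- A real vector as a complex vector. -/
def cvec {ι : Type} (x : ι → ℝ) : ι → ℂ := fun i => (x i : ℂ)

/-- A real matrix as a complex matrix. -/
def cmat {ι κ : Type} (M : Matrix ι κ ℝ) : Matrix ι κ ℂ := M.map Complex.ofReal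

section
variable {ι κ τ : Type} [Fintype ι] [Fintype κ]

theorem cmat_mul (M : Matrix τ ι ℝ) (N : Matrix ι κ ℝ) : cmat (M * N) = cmat M * cmat N :=
  Matrix.map_mul (f := Complex.ofRealHom)

theorem cmat_transpose (M : Matrix ι κ ℝ) : cmat Mᵀ = (cmat M)ᵀ := rfl

theorem cmat_mulVec (M : Matrix κ ι ℝ) (x : ι → ℝ) : cmat M *ᵥ cvec x = cvec (M *ᵥ x) := by
  ext i
  simp [cmat, cvec, Matrix.mulVec, dotProduct]

theorem cvec_dotProduct (x y : ι → ℝ) : cvec x ⬝ᵥ cvec y = ((x ⬝ᵥ y : ℝ) : ℂ) := by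
  simp [cvec, dotProduct]

theorem cmat_one [DecidableEq ι] : cmat (1 : Matrix ι ι ℝ) = 1 :=
  Matrix.map_one _ (by simp) (by simp)

theorem cmat_inv [DecidableEq ι] (M : Matrix ι ι ℝ) (h : IsUnit M.det) :
    cmat M⁻¹ = (cmat M)⁻¹ := by
  symm
  apply Matrix.inv_eq_left_inv
  rw [← cmat_mul, Matrix.nonsing_inv_mul _ h, cmat_one]

theorem cmat_re_add_im (A : Matrix ι κ ℂ) :
    A = cmat (A.map Complex.re) + I • cmat (A.map Complex.im) := by
  ext i j
  simp [cmat, mul_comm I, Complex.re_add_im]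

end

section
variable {ι : Type} [Fintype ι] [DecidableEq ι]

open scoped MatrixOrder in
/-- Simultaneous diagonalisation of the real and imaginary part of a complex symmetric matrix with
positive definite real part. -/
theorem exists_congr_diagonal (A : Matrix ι ι ℂ) (hs : A.IsSymm)
    (hp : (A.map Complex.re).PosDef) :
    ∃ (N : Matrix ι ι ℝ) (d : ι → ℝ), IsUnit N.det ∧ A.map Complex.re = Nᵀ * N ∧
      A.map Complex.im = Nᵀ * diagonal d * N := by
  obtain ⟨B, hB⟩ : ∃ B : Matrix ι ι ℝ, A.map Complex.re = Bᵀ * B := by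
    obtain ⟨B, hB⟩ := CStarAlgebra.nonneg_iff_eq_star_mul_self.mp hp.posSemidef.nonneg
    exact ⟨B, hB⟩
  have hBu : IsUnit B.det := by
    have h := hp.det_pos
    rw [hB, det_mul, det_transpose] at h
    exact isUnit_iff_ne_zero.2 (fun h0 => by simp [h0] at h)
  -- With BᵀB = Re A, congruence by B⁻¹ turns Re A into 1 and Im A into W. An orthogonal
  -- diagonalisation of W leaves 1 unchanged, so N = QᵀB serves both parts.
  set W : Matrix ι ι ℝ := (B⁻¹)ᵀ * A.map Complex.im * B⁻¹ with hW
  have hWs : W.IsHermitian := by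
    have : (A.map Complex.im)ᵀ = A.map Complex.im := by
      rw [← Matrix.transpose_map, hs.eq]
    rw [Matrix.IsHermitian, conjTranspose_eq_transpose_of_trivial, hW]
    simp only [transpose_mul, transpose_transpose, this, Matrix.mul_assoc]
  obtain ⟨Q, d, hQ, hQW⟩ : ∃ (Q : Matrix ι ι ℝ) (d : ι → ℝ), Q * Qᵀ = 1 ∧
      W = Q * diagonal d * Qᵀ := by
    refine ⟨hWs.eigenvectorUnitary, hWs.eigenvalues, ?_, ?_⟩
    · exact Matrix.mem_unitaryGroup_iff.1 hWs.eigenvectorUnitary.2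
    · exact hWs.spectral_theorem
  have hB1 : B⁻¹ * B = 1 := nonsing_inv_mul _ hBu
  have hB2 : Bᵀ * (B⁻¹)ᵀ = 1 := by rw [← transpose_mul, hB1, transpose_one]
  refine ⟨Qᵀ * B, d, ?_, ?_, ?_⟩
  · rw [det_mul]
    refine IsUnit.mul ?_ hBu
    exact Matrix.isUnit_det_of_left_inverse hQ
  · rw [transpose_mul, transpose_transpose, Matrix.mul_assoc, ← Matrix.mul_assoc Q, hQ,
      Matrix.one_mul, hB]
  · calc A.map Complex.im = Bᵀ * W * B := by
          rw [hW]
          simp only [Matrix.mul_assoc, hB1, Matrix.mul_one]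
          rw [← Matrix.mul_assoc, hB2, Matrix.one_mul]
      _ = _ := by
          rw [hQW, transpose_mul, transpose_transpose]
          simp only [Matrix.mul_assoc]

theorem integral_comp_mulVec (N : Matrix ι ι ℝ) (hN : IsUnit N.det) (f : (ι → ℝ) → ℂ)
    (hf : Continuous f) : ∫ x, f (N *ᵥ x) = ((|N.det|⁻¹ : ℝ) : ℂ) * ∫ x, f x := by
  have h := Real.map_matrix_volume_pi_eq_smul_volume_pi hN.ne_zero
  have h2 : ∫ x, f x ∂(Measure.map (toLin' N) volume) = ∫ x, f (N *ᵥ x) := by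
    rw [integral_map]
    · simp
    · exact (LinearMap.continuous_of_finiteDimensional _).aemeasurable
    · exact hf.aestronglyMeasurable
  rw [← h2, h, integral_smul_measure, ENNReal.toReal_ofReal (abs_nonneg _), abs_inv,
    Complex.real_smul]

theorem integrable_comp_mulVec (N : Matrix ι ι ℝ) (hN : IsUnit N.det) (f : (ι → ℝ) → ℂ)
    (hf : Integrable f) : Integrable (fun x => f (N *ᵥ x)) := by
  have h := Real.map_matrix_volume_pi_eq_smul_volume_pi hN.ne_zero
  have h2 : Integrable f (Measure.map (toLin' N) volume) := by
    rw [h]; exact hf.smul_measure (by simp)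
  have := h2.comp_aemeasurable
    (LinearMap.continuous_of_finiteDimensional (toLin' N)).aemeasurable
  simpa [Function.comp_def] using this

/-- The Gaussian integrand `exp (-xᵀ A x / 2 + b ⬝ x)`. -/
def gaussFun (A : Matrix ι ι ℂ) (b : ι → ℂ) (x : ι → ℝ) : ℂ :=
  exp (-(1 / 2) * (cvec x ⬝ᵥ A *ᵥ cvec x) + b ⬝ᵥ cvec x)

theorem continuous_gaussFun (A : Matrix ι ι ℂ) (b : ι → ℂ) : Continuous (gaussFun A b) := by
  unfold gaussFun cvec dotProduct Matrix.mulVec dotProduct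
  fun_prop

theorem mulVec_dotProduct_eq {κ : Type} [Fintype κ] (M : Matrix κ ι ℂ) (v : ι → ℂ) (w : κ → ℂ) :
    (M *ᵥ v) ⬝ᵥ w = v ⬝ᵥ Mᵀ *ᵥ w := by
  rw [dotProduct_comm, Matrix.dotProduct_mulVec, ← Matrix.mulVec_transpose, dotProduct_comm]

theorem gaussFun_comp (N : Matrix ι ι ℝ) (A : Matrix ι ι ℂ) (b : ι → ℂ) (x : ι → ℝ) :
    gaussFun A b (N *ᵥ x) = gaussFun ((cmat N)ᵀ * A * cmat N) ((cmat N)ᵀ *ᵥ b) x := by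
  unfold gaussFun
  rw [← cmat_mulVec, mulVec_dotProduct_eq, dotProduct_comm b, mulVec_dotProduct_eq,
    dotProduct_comm (cvec x) ((cmat N)ᵀ *ᵥ b)]
  simp only [Matrix.mulVec_mulVec, Matrix.mul_assoc]

theorem gaussFun_diagonal (l : ι → ℂ) (b : ι → ℂ) (x : ι → ℝ) :
    gaussFun (diagonal l) b x = exp (-∑ i, (l i / 2) * (x i : ℂ) ^ 2 + ∑ i, b i * (x i : ℂ)) := by
  unfold gaussFun
  congr 2
  simp only [dotProduct, mulVec_diagonal, cvec, Finset.mul_sum, ← Finset.sum_neg_distrib]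
  refine Finset.sum_congr rfl fun i _ => ?_
  ring

/-- The value at `b = 0` of the Gaussian integral. -/
def gaussConst (A : Matrix ι ι ℂ) : ℂ := ∫ x, gaussFun A 0 x

variable {A : Matrix ι ι ℂ}

theorem eq_congr_diagonal {N : Matrix ι ι ℝ} {d : ι → ℝ}
    (h1 : A.map Complex.re = Nᵀ * N) (h2 : A.map Complex.im = Nᵀ * diagonal d * N) :
    A = (cmat N)ᵀ * diagonal (fun i => 1 + I * d i) * cmat N := by
  have hd : diagonal (fun i => 1 + I * (d i : ℂ)) = 1 + I • cmat (diagonal d) := by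
    ext i j
    by_cases h : i = j <;> simp [h, cmat]
  rw [cmat_re_add_im A, h1, h2, cmat_mul, cmat_mul, cmat_mul, cmat_transpose, hd, Matrix.mul_add,
    Matrix.mul_one, Matrix.add_mul, Matrix.mul_smul, Matrix.smul_mul]

/-- Substituting y = Nx turns A into diag(1 + i d), and the integral splits into one-dimensional
ones. N and d are kept in the conclusion so that the constant can be evaluated when A is real. -/
theorem gauss_integral_aux (hs : A.IsSymm) (hp : (A.map Complex.re).PosDef) :
    ∃ (N : Matrix ι ι ℝ) (d : ι → ℝ), IsUnit N.det ∧ A.map Complex.re = Nᵀ * N ∧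
      A.map Complex.im = Nᵀ * diagonal d * N ∧ IsUnit A.det ∧ ∀ b : ι → ℂ,
      Integrable (gaussFun A b) ∧
      ∫ x, gaussFun A b x = ((|N.det|⁻¹ : ℝ) : ℂ) *
        (∏ i, ((Real.pi : ℂ) / ((1 + I * d i) / 2)) ^ (1 / 2 : ℂ)) *
          exp (1 / 2 * (b ⬝ᵥ A⁻¹ *ᵥ b)) := by
  obtain ⟨N, d, hN, h1, h2⟩ := exists_congr_diagonal A hs hp
  have hA := eq_congr_diagonal h1 h2
  set l : ι → ℂ := fun i => 1 + I * d i with hl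
  have hlre : ∀ i, (l i).re = 1 := fun i => by simp [hl]
  have hl0 : ∀ i, l i ≠ 0 := fun i h => by simpa [h] using hlre i
  have hl2 : ∀ i, 0 < (l i / 2).re := fun i => by
    have : (l i / 2).re = (l i).re / 2 := by simp
    rw [this, hlre]; norm_num
  have hcN : IsUnit (cmat N).det := by
    have : (cmat N).det = (N.det : ℂ) := (RingHom.map_det Complex.ofRealHom N).symm
    rw [this]
    exact hN.map Complex.ofRealHom
  have hdl : IsUnit (diagonal l).det := by
    rw [det_diagonal, isUnit_iff_ne_zero, Finset.prod_ne_zero_iff]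
    exact fun i _ => hl0 i
  have hdet : IsUnit A.det := by
    rw [hA, det_mul, det_mul, det_transpose]
    exact (hcN.mul hdl).mul hcN
  refine ⟨N, d, hN, h1, h2, hdet, fun b => ?_⟩
  set b' := ((cmat N)⁻¹)ᵀ *ᵥ b with hb'
  have hbb : (cmat N)ᵀ *ᵥ b' = b := by
    rw [hb', Matrix.mulVec_mulVec, ← transpose_mul, nonsing_inv_mul _ hcN, transpose_one,
      one_mulVec]
  have hcomp : gaussFun A b = fun x => gaussFun (diagonal l) b' (N *ᵥ x) := by
    funext x
    rw [gaussFun_comp, hbb, ← hA]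
  have hq : ∑ i, b' i ^ 2 / (4 * (l i / 2)) = 1 / 2 * (b ⬝ᵥ A⁻¹ *ᵥ b) := by
    have hinv : A⁻¹ = (cmat N)⁻¹ * diagonal (fun i => (l i)⁻¹) * ((cmat N)⁻¹)ᵀ := by
      apply Matrix.inv_eq_left_inv
      have e : (cmat N)⁻¹ᵀ * (cmat N)ᵀ = 1 := by
        rw [← transpose_mul, mul_nonsing_inv _ hcN, transpose_one]
      conv_lhs => rw [hA]
      calc (cmat N)⁻¹ * diagonal (fun i => (l i)⁻¹) * ((cmat N)⁻¹)ᵀ *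
            ((cmat N)ᵀ * diagonal l * cmat N)
          = (cmat N)⁻¹ * (diagonal (fun i => (l i)⁻¹) * ((((cmat N)⁻¹)ᵀ *
            (cmat N)ᵀ) * diagonal l)) * cmat N := by simp only [Matrix.mul_assoc]
        _ = 1 := by
          rw [e, Matrix.one_mul, diagonal_mul_diagonal]
          simp only [inv_mul_cancel₀ (hl0 _), diagonal_one, Matrix.mul_one]
          exact nonsing_inv_mul _ hcN
    rw [hinv, ← Matrix.mulVec_mulVec, ← hb', ← Matrix.mulVec_mulVec, dotProduct_comm,
      mulVec_dotProduct_eq, ← hb', dotProduct_comm]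
    simp only [dotProduct, mulVec_diagonal, Finset.mul_sum]
    refine Finset.sum_congr rfl fun i _ => ?_
    have := hl0 i
    field_simp
    norm_num
  constructor
  · rw [hcomp]
    apply integrable_comp_mulVec N hN
    have := GaussianFourier.integrable_cexp_neg_sum_mul_add hl2 b'
    refine this.congr (ae_of_all _ fun x => (gaussFun_diagonal _ _ _).symm)
  · rw [hcomp, integral_comp_mulVec N hN _ (continuous_gaussFun _ _)]
    simp only [gaussFun_diagonal]
    rw [GaussianFourier.integral_cexp_neg_sum_mul_add hl2 b', Finset.prod_mul_distrib,
      ← Complex.exp_sum, hq, mul_assoc]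

theorem integrable_gaussFun (hs : A.IsSymm) (hp : (A.map Complex.re).PosDef) (b : ι → ℂ) :
    Integrable (gaussFun A b) := by
  obtain ⟨N, d, -, -, -, -, h⟩ := gauss_integral_aux hs hp
  exact (h b).1

theorem isUnit_det_of_re_posDef (hs : A.IsSymm) (hp : (A.map Complex.re).PosDef) :
    IsUnit A.det := by
  obtain ⟨N, d, -, -, -, h, -⟩ := gauss_integral_aux hs hp
  exact h

theorem integral_gaussFun (hs : A.IsSymm) (hp : (A.map Complex.re).PosDef) (b : ι → ℂ) :
    ∫ x, gaussFun A b x = gaussConst A * exp (1 / 2 * (b ⬝ᵥ A⁻¹ *ᵥ b)) := by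
  obtain ⟨N, d, -, -, -, -, h⟩ := gauss_integral_aux hs hp
  rw [gaussConst, (h b).2, (h 0).2]
  simp

theorem gaussConst_ne_zero (hs : A.IsSymm) (hp : (A.map Complex.re).PosDef) :
    gaussConst A ≠ 0 := by
  obtain ⟨N, d, hN, -, -, -, h⟩ := gauss_integral_aux hs hp
  rw [gaussConst, (h 0).2]
  refine mul_ne_zero (mul_ne_zero ?_ ?_) (Complex.exp_ne_zero _)
  · simpa using hN.ne_zero
  · rw [Finset.prod_ne_zero_iff]
    intro i _
    have h0 : (1 + I * (d i : ℂ)) ≠ 0 := fun h => by simpa using congrArg Complex.re h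
    rw [Ne, Complex.cpow_eq_zero_iff]
    simp [h0, Real.pi_ne_zero]

/-- Elsewhere it is enough that the constant is nonzero; the normalisation of the Wigner transform
needs its value for real matrices. A vanishing imaginary part forces d = 0, so every factor is
√(2π). -/
theorem gaussConst_cmat {V : Matrix ι ι ℝ} (hV : V.PosDef) :
    gaussConst (cmat V) = ((Real.sqrt ((2 * Real.pi) ^ Fintype.card ι / V.det) : ℝ) : ℂ) := by
  have hre : (cmat V).map Complex.re = V := by ext; simp [cmat]
  have him : (cmat V).map Complex.im = 0 := by ext; simp [cmat]
  have hs : (cmat V).IsSymm := by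
    have := hV.isHermitian.eq
    rw [conjTranspose_eq_transpose_of_trivial] at this
    rw [Matrix.IsSymm, ← cmat_transpose, this]
  obtain ⟨N, d, hN, h1, h2, -, h⟩ := gauss_integral_aux hs (by rwa [hre])
  rw [hre] at h1
  rw [him] at h2
  have hd : diagonal d = 0 := by
    have e1 : N * N⁻¹ = 1 := mul_nonsing_inv _ hN
    have e2 : (N⁻¹)ᵀ * Nᵀ = 1 := by rw [← transpose_mul, e1, transpose_one]
    have : diagonal d = (N⁻¹)ᵀ * (Nᵀ * diagonal d * N) * N⁻¹ := by
      simp only [Matrix.mul_assoc, e1, Matrix.mul_one]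
      rw [← Matrix.mul_assoc, e2, Matrix.one_mul]
    rw [this, ← h2]; simp
  have hd0 : ∀ i, d i = 0 := fun i => by simpa using congrFun (congrFun hd i) i
  have hdetV : V.det = |N.det| ^ 2 := by rw [h1, det_mul, det_transpose, sq_abs, sq]
  rw [gaussConst, (h 0).2]
  simp only [hd0]
  have e : ((Real.pi : ℂ) / ((1 + I * ((0 : ℝ) : ℂ)) / 2)) ^ (1 / 2 : ℂ)
      = ((Real.sqrt (2 * Real.pi) : ℝ) : ℂ) := by
    rw [Real.sqrt_eq_rpow, Complex.ofReal_cpow (by positivity)]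
    push_cast
    congr 1
    ring_nf
  rw [e, Finset.prod_const, Finset.card_univ, hdetV, Real.sqrt_div' _ (by positivity),
    Real.sqrt_sq (abs_nonneg _)]
  simp only [zero_dotProduct, mul_zero, Complex.exp_zero, mul_one]
  rw [show Real.sqrt ((2 * Real.pi) ^ Fintype.card ι) = (Real.sqrt (2 * Real.pi)) ^ Fintype.card ι
    from by
      rw [Real.sqrt_eq_iff_mul_self_eq (by positivity) (by positivity), ← mul_pow,
        Real.mul_self_sqrt (by positivity)]]
  push_cast
  field_simp

end

end

section

/-! ### Injectivity of the Fourier transform -/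

/-- The positive and negative parts of g are densities of two finite measures with equal
characteristic functions, hence of equal measures. -/
theorem ae_eq_zero_of_fourier_real {n : ℕ} {g : (Fin n → ℝ) → ℝ} (hg : Integrable g)
    (h : ∀ s : Fin n → ℝ, ∫ x, exp (I * ((s ⬝ᵥ x : ℝ) : ℂ)) * (g x : ℂ) = 0) :
    g =ᵐ[volume] 0 := by
  set p : (Fin n → ℝ) → ENNReal := fun x => ENNReal.ofReal (g x) with hp
  set q : (Fin n → ℝ) → ENNReal := fun x => ENNReal.ofReal (-g x) with hq
  have hpm : AEMeasurable p := hg.aemeasurable.ennreal_ofReal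
  have hqm : AEMeasurable q := hg.aemeasurable.neg.ennreal_ofReal
  have hpi : ∫⁻ x, p x ≠ ⊤ := hg.lintegral_lt_top.ne
  have hqi : ∫⁻ x, q x ≠ ⊤ := by
    simpa [hq] using hg.neg.lintegral_lt_top.ne
  have : IsFiniteMeasure (volume.withDensity p) := isFiniteMeasure_withDensity hpi
  have : IsFiniteMeasure (volume.withDensity q) := isFiniteMeasure_withDensity hqi
  have key : volume.withDensity p = volume.withDensity q := by
    apply Measure.ext_of_charFunDual
    funext L
    rw [charFunDual_apply, charFunDual_apply,
      integral_withDensity_eq_integral_toReal_smul₀ hpm (by simp [hp]),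
      integral_withDensity_eq_integral_toReal_smul₀ hqm (by simp [hq]), ← sub_eq_zero]
    set s : Fin n → ℝ := fun i => L (Pi.single i 1) with hs
    have hL : ∀ x, L x = s ⬝ᵥ x := fun x => by
      conv_lhs => rw [← Finset.univ_sum_single x, map_sum]
      refine Finset.sum_congr rfl fun i _ => ?_
      rw [hs, mul_comm, ← smul_eq_mul, ← map_smul, ← Pi.single_smul, smul_eq_mul, mul_one]
    have hexp : ∀ {r : (Fin n → ℝ) → ℝ}, Integrable r → Integrable fun x =>
        (ENNReal.ofReal (r x)).toReal • exp ((L x : ℂ) * I) := by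
      intro r hr
      have h1 : Integrable fun x => (ENNReal.ofReal (r x)).toReal := by
        refine hr.pos_part.congr (ae_of_all _ fun x => ?_)
        simp [ENNReal.toReal_ofReal', max_def]
      refine (h1.ofReal (𝕜 := ℂ)).mul_bdd (c := 1) ?_ ?_
      · exact Continuous.aestronglyMeasurable (by fun_prop)
      · exact ae_of_all _ fun x => by rw [Complex.norm_exp_ofReal_mul_I]
    have h' := hexp hg
    have h'' := hexp hg.neg
    simp only [Pi.neg_apply] at h''
    rw [← integral_sub h' h'', ← h s]
    refine integral_congr_ae (ae_of_all _ fun x => ?_)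
    simp only [hL, ENNReal.toReal_ofReal', Complex.real_smul]
    rw [mul_comm I, ← sub_mul, mul_comm, ← Complex.ofReal_sub]
    congr 2
    rcases le_total 0 (g x) with h0 | h0
    · rw [max_eq_left h0, max_eq_right (by linarith), sub_zero]
    · rw [max_eq_right h0, max_eq_left (by linarith)]; ring
  rw [withDensity_eq_iff hpm hqm hpi] at key
  filter_upwards [key] with x hx
  simp only [hp, hq] at hx
  have := congrArg ENNReal.toReal hx
  rw [ENNReal.toReal_ofReal', ENNReal.toReal_ofReal'] at this
  rcases le_total 0 (g x) with h0 | h0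
  · rw [max_eq_left h0, max_eq_right (by linarith)] at this; simpa using this
  · rw [max_eq_right h0, max_eq_left (by linarith)] at this
    simp only [Pi.zero_apply]; linarith

/-- The transform of ḡ at s is the conjugate of that of g at -s, so it vanishes too, and the real
and imaginary parts can be treated separately. -/
theorem ae_eq_zero_of_fourier {n : ℕ} {g : (Fin n → ℝ) → ℂ} (hg : Integrable g)
    (h : ∀ s : Fin n → ℝ, ∫ x, exp (I * ((s ⬝ᵥ x : ℝ) : ℂ)) * g x = 0) : g =ᵐ[volume] 0 := by
  have hexp : ∀ (s : Fin n → ℝ) {r : (Fin n → ℝ) → ℂ}, Integrable r →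
      Integrable fun x => exp (I * ((s ⬝ᵥ x : ℝ) : ℂ)) * r x := by
    intro s r hr
    refine hr.bdd_mul (c := 1) ?_ ?_
    · exact Continuous.aestronglyMeasurable (by unfold dotProduct; fun_prop)
    · exact ae_of_all _ fun x => by rw [mul_comm, Complex.norm_exp_ofReal_mul_I]
  have hconj : ∀ s : Fin n → ℝ,
      ∫ x, exp (I * ((s ⬝ᵥ x : ℝ) : ℂ)) * (starRingEnd ℂ) (g x) = 0 := by
    intro s
    have := congrArg (starRingEnd ℂ) (h (-s))
    rw [← integral_conj, map_zero] at this
    rw [← this]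
    refine integral_congr_ae (ae_of_all _ fun x => ?_)
    simp only [map_mul, ← Complex.exp_conj, Complex.conj_I, Complex.conj_ofReal]
    congr 2
    simp
  have hgc : Integrable fun x => (starRingEnd ℂ) (g x) := by
    refine (integrable_norm_iff ?_).1 (hg.norm.congr (ae_of_all _ fun x => ?_))
    · exact Complex.continuous_conj.comp_aestronglyMeasurable hg.1
    · simp
  have h1 := ae_eq_zero_of_fourier_real hg.re (fun s => by
    have e : ∀ x, exp (I * ((s ⬝ᵥ x : ℝ) : ℂ)) * ((RCLike.re (g x) : ℝ) : ℂ) =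
        (1 / 2) * (exp (I * ((s ⬝ᵥ x : ℝ) : ℂ)) * g x +
          exp (I * ((s ⬝ᵥ x : ℝ) : ℂ)) * (starRingEnd ℂ) (g x)) := fun x => by
      rw [← mul_add, Complex.add_conj]; simp; ring
    simp only [e]
    rw [integral_const_mul, integral_add (hexp s hg) (hexp s hgc), h, hconj]; simp)
  have h2 := ae_eq_zero_of_fourier_real hg.im (fun s => by
    have e : ∀ x, exp (I * ((s ⬝ᵥ x : ℝ) : ℂ)) * ((RCLike.im (g x) : ℝ) : ℂ) =
        (1 / (2 * I)) * (exp (I * ((s ⬝ᵥ x : ℝ) : ℂ)) * g x -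
          exp (I * ((s ⬝ᵥ x : ℝ) : ℂ)) * (starRingEnd ℂ) (g x)) := fun x => by
      rw [← mul_sub, Complex.sub_conj]; simp; field_simp; rw [I_sq]; ring
    simp only [e]
    rw [integral_const_mul, integral_sub (hexp s hg) (hexp s hgc), h, hconj]; simp)
  filter_upwards [h1, h2] with x hx hy
  exact Complex.ext hx hy

/-! ### Gaussian wave functions -/

section
variable {ι : Type} [Fintype ι] [DecidableEq ι]

theorem star_cvec (x : ι → ℝ) : star (cvec x) = cvec x := by
  ext i; simp [cvec]

theorem star_mulVec_eq {κ : Type} [Fintype κ] (A : Matrix κ ι ℂ) (x : ι → ℂ) :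
    star (A *ᵥ x) = A.map star *ᵥ star x := by
  ext i; simp [mulVec, dotProduct]

theorem star_dotProduct_eq (v w : ι → ℂ) :
    (starRingEnd ℂ) (v ⬝ᵥ w) = star v ⬝ᵥ star w := by
  simp [dotProduct]

theorem conj_gaussFun (A : Matrix ι ι ℂ) (a : ι → ℂ) (x : ι → ℝ) :
    (starRingEnd ℂ) (gaussFun A a x) = gaussFun (A.map star) (star a) x := by
  unfold gaussFun
  rw [← Complex.exp_conj, map_add, map_mul, star_dotProduct_eq, star_dotProduct_eq,
    star_mulVec_eq, star_cvec]
  simp [Complex.conj_ofNat]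

theorem gaussFun_mul (A B : Matrix ι ι ℂ) (a b : ι → ℂ) (x : ι → ℝ) :
    gaussFun A a x * gaussFun B b x = gaussFun (A + B) (a + b) x := by
  unfold gaussFun
  rw [← Complex.exp_add, Matrix.add_mulVec, dotProduct_add, add_dotProduct]
  congr 1; ring

end

variable {n m : ℕ}

theorem IsPhaseMatrix.sum_isSymm {Φ Ψ : Matrix (Fin n) (Fin n) ℂ} (hΦ : IsPhaseMatrix Φ)
    (hΨ : IsPhaseMatrix Ψ) : ((-(I • Φ)).map star + -(I • Ψ)).IsSymm := by
  have h1 := hΦ.1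
  have h2 := hΨ.1
  rw [Matrix.IsSymm, transpose_add, transpose_neg, transpose_smul, h2.eq, ← transpose_map,
    transpose_neg, transpose_smul, h1.eq]

/-- The matrix is that of the Gaussian integrand in the overlap of two Gaussian vectors; its real
part is Im Φ + Im Ψ, so all overlap integrals converge. -/
theorem IsPhaseMatrix.sum_posDef {Φ Ψ : Matrix (Fin n) (Fin n) ℂ} (hΦ : IsPhaseMatrix Φ)
    (hΨ : IsPhaseMatrix Ψ) : (((-(I • Φ)).map star + -(I • Ψ)).map Complex.re).PosDef := by
  have := hΦ.2.add hΨ.2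
  convert this using 1
  ext i j
  simp

/-- The unnormalised wave function `exp (i xᵀ Φ x / 2 + b ⬝ x)`. -/
def wave (Φ : Matrix (Fin n) (Fin n) ℂ) (b : Fin n → ℂ) (x : Fin n → ℝ) : ℂ :=
  gaussFun (-(I • Φ)) b x

theorem continuous_wave (Φ : Matrix (Fin n) (Fin n) ℂ) (b : Fin n → ℂ) :
    Continuous (wave Φ b) := continuous_gaussFun _ _

theorem conj_wave_mul_wave (Φ Ψ : Matrix (Fin n) (Fin n) ℂ) (a b : Fin n → ℂ) (x : Fin n → ℝ) :
    (starRingEnd ℂ) (wave Φ a x) * wave Ψ b x =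
      gaussFun ((-(I • Φ)).map star + -(I • Ψ)) (star a + b) x := by
  rw [wave, wave, conj_gaussFun, gaussFun_mul]

theorem memLp_wave {Φ : Matrix (Fin n) (Fin n) ℂ} (hΦ : IsPhaseMatrix Φ) (b : Fin n → ℂ) :
    MemLp (wave Φ b) 2 volume := by
  rw [memLp_two_iff_integrable_sq_norm (continuous_wave Φ b).aestronglyMeasurable]
  have h := (integrable_gaussFun (hΦ.sum_isSymm hΦ) (hΦ.sum_posDef hΦ) (star b + b)).re
  refine h.congr (ae_of_all _ fun x => ?_)
  simp only [← conj_wave_mul_wave, Complex.conj_mul']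
  norm_cast

open Classical in
/-- The unnormalised Gaussian vector with wave function `wave Φ b`. -/
def gv (Φ : Matrix (Fin n) (Fin n) ℂ) (b : Fin n → ℂ) : L2 n :=
  if h : IsPhaseMatrix Φ then (memLp_wave h b).toLp _ else 0

theorem coe_gv {Φ : Matrix (Fin n) (Fin n) ℂ} (hΦ : IsPhaseMatrix Φ) (b : Fin n → ℂ) :
    gv Φ b =ᵐ[volume] wave Φ b := by
  rw [gv, dif_pos hΦ]
  exact MemLp.coeFn_toLp _

theorem inner_eq_integral (f g : L2 n) :
    inner ℂ f g = ∫ x, (starRingEnd ℂ) (f x) * g x := by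
  rw [L2.inner_def]
  refine integral_congr_ae (ae_of_all _ fun x => ?_)
  simp [RCLike.inner_apply, mul_comm]

theorem inner_gv_eq_integral {Φ : Matrix (Fin n) (Fin n) ℂ} (hΦ : IsPhaseMatrix Φ)
    (b : Fin n → ℂ) (f : L2 n) :
    inner ℂ (gv Φ b) f = ∫ x, (starRingEnd ℂ) (wave Φ b x) * f x := by
  rw [inner_eq_integral]
  refine integral_congr_ae ?_
  filter_upwards [coe_gv hΦ b] with x hx
  rw [hx]

/-- The matrix of the quadratic form in the overlap of two Gaussian vectors. -/
def ovMat (Φ Ψ : Matrix (Fin n) (Fin n) ℂ) : Matrix (Fin n) (Fin n) ℂ :=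
  (-(I • Φ)).map star + -(I • Ψ)

theorem inner_gv {Φ Ψ : Matrix (Fin n) (Fin n) ℂ} (hΦ : IsPhaseMatrix Φ) (hΨ : IsPhaseMatrix Ψ)
    (a b : Fin n → ℂ) : inner ℂ (gv Φ a) (gv Ψ b) = gaussConst (ovMat Φ Ψ) *
      exp (1 / 2 * ((star a + b) ⬝ᵥ (ovMat Φ Ψ)⁻¹ *ᵥ (star a + b))) := by
  rw [inner_gv_eq_integral hΦ, ovMat, ← integral_gaussFun (hΦ.sum_isSymm hΨ) (hΦ.sum_posDef hΨ)]
  refine integral_congr_ae ?_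
  filter_upwards [coe_gv hΨ b] with x hx
  rw [hx, conj_wave_mul_wave]

theorem ovConst_ne_zero {Φ Ψ : Matrix (Fin n) (Fin n) ℂ} (hΦ : IsPhaseMatrix Φ)
    (hΨ : IsPhaseMatrix Ψ) : gaussConst (ovMat Φ Ψ) ≠ 0 :=
  gaussConst_ne_zero (hΦ.sum_isSymm hΨ) (hΦ.sum_posDef hΨ)

theorem inner_gv_ne_zero {Φ Ψ : Matrix (Fin n) (Fin n) ℂ} (hΦ : IsPhaseMatrix Φ)
    (hΨ : IsPhaseMatrix Ψ) (a b : Fin n → ℂ) : inner ℂ (gv Φ a) (gv Ψ b) ≠ 0 := by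
  rw [inner_gv hΦ hΨ]
  exact mul_ne_zero (ovConst_ne_zero hΦ hΨ) (Complex.exp_ne_zero _)

/-! ### Coherent vectors -/

theorem isPhaseMatrix_I : IsPhaseMatrix (I • (1 : Matrix (Fin n) (Fin n) ℂ)) := by
  constructor
  · rw [Matrix.IsSymm, transpose_smul, transpose_one]
  · convert (PosDef.one : (1 : Matrix (Fin n) (Fin n) ℝ).PosDef) using 1
    ext i j
    by_cases h : i = j <;> simp [h, Matrix.one_apply]

/-- Unnormalised coherent vectors. -/
def coh (w : Fin n → ℂ) : L2 n := gv (I • 1) w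

/-- For purely imaginary parameters the overlaps are the Fourier transform of f times a Gaussian, an
integrable function. Equalities of vectors and operators are tested on coherent vectors from here
on. -/
theorem eq_zero_of_inner_coh {f : L2 n} (h : ∀ w, inner ℂ (coh w) f = 0) : f = 0 := by
  have hi : Integrable fun x => wave (I • 1) 0 x * f x := by
    have := L2.integrable_inner (𝕜 := ℂ) (gv (I • 1) 0) f
    have := this.congr (f := _) (g := fun x => (starRingEnd ℂ) (wave (I • 1) 0 x) * f x) (by
      filter_upwards [coe_gv isPhaseMatrix_I (0 : Fin n → ℂ)] with x hx
      rw [hx]; simp [RCLike.inner_apply, mul_comm])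
    refine this.congr (ae_of_all _ fun x => ?_)
    simp only
    congr 1
    rw [wave, conj_gaussFun]
    congr 1
    · ext i j; by_cases h : i = j <;> simp [h, smul_smul]
    · simp
  have h0 := ae_eq_zero_of_fourier hi (fun s => by
    rw [← h (-(I • cvec s)), coh, inner_gv_eq_integral isPhaseMatrix_I]
    refine integral_congr_ae (ae_of_all _ fun x => ?_)
    simp only
    rw [← mul_assoc]
    congr 1
    rw [wave, wave, conj_gaussFun, gaussFun, gaussFun, ← Complex.exp_add, ← cvec_dotProduct]
    congr 1
    have e : (-(I • I • (1 : Matrix (Fin n) (Fin n) ℂ))).map star = -(I • I • 1) := by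
      ext i j; by_cases h : i = j <;> simp [h, smul_smul]
    rw [e, star_neg, star_smul, star_cvec]
    simp [smul_dotProduct]
    ring)
  rw [Lp.eq_zero_iff_ae_eq_zero]
  filter_upwards [h0] with x hx
  simpa [wave, gaussFun, Complex.exp_ne_zero] using hx

theorem ext_inner_coh {f g : L2 n} (h : ∀ w, inner ℂ (coh w) f = inner ℂ (coh w) g) : f = g := by
  rw [← sub_eq_zero]
  refine eq_zero_of_inner_coh fun w => ?_
  rw [inner_sub_right, h w, sub_self]

/-- Bounded operators that agree on coherent vectors are equal. -/
theorem ext_coh {T S : L2 n →L[ℂ] L2 m} (h : ∀ w, T (coh w) = S (coh w)) : T = S := by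
  have : T.adjoint = S.adjoint := by
    ext1 g
    refine ext_inner_coh fun w => ?_
    rw [ContinuousLinearMap.adjoint_inner_right, ContinuousLinearMap.adjoint_inner_right, h w]
  rw [← T.adjoint_adjoint, this, S.adjoint_adjoint]

/-! ### Gaussian states as multiples of Gaussian vectors -/

/-- The linear coefficient of the Gaussian state with displacement `(s, t)`. -/
def lin (Φ : Matrix (Fin n) (Fin n) ℂ) (s t : Fin n → ℝ) : Fin n → ℂ :=
  I • (cvec s - Φ *ᵥ cvec t)

theorem gaussianWave_eq {Φ : Matrix (Fin n) (Fin n) ℂ} (hΦ : IsPhaseMatrix Φ) (α : ℝ)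
    (s t x : Fin n → ℝ) : gaussianWave α Φ s t x =
      (exp (I * α) * ((((Φ.map Complex.im).det / Real.pi ^ n) ^ (1 / 4 : ℝ) : ℝ) : ℂ) *
        exp (I / 2 * (cvec t ⬝ᵥ Φ *ᵥ cvec t))) * wave Φ (lin Φ s t) x := by
  have hy : (fun i => ((x i - t i : ℝ) : ℂ)) = cvec x - cvec t := by
    ext i; simp [cvec]
  have hsymm : cvec t ⬝ᵥ Φ *ᵥ cvec x = cvec x ⬝ᵥ Φ *ᵥ cvec t := by
    rw [dotProduct_comm, mulVec_dotProduct_eq, hΦ.1.eq]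
  unfold gaussianWave wave gaussFun lin
  simp only [hy]
  rw [show ∀ a b c d e f : ℂ, a * b * c * exp d = (a * c * exp e) * exp f ↔
    (a * c) * (b * exp d) = (a * c) * (exp e * exp f) from fun a b c d e f => by
      constructor <;> intro h <;> linear_combination h]
  congr 1
  rw [← Complex.exp_add, ← Complex.exp_add, ← cvec_dotProduct]
  congr 1
  simp only [mulVec_sub, dotProduct_sub, sub_dotProduct, neg_mulVec, smul_mulVec, dotProduct_neg,
    dotProduct_smul, smul_dotProduct, smul_eq_mul, hsymm, dotProduct_comm (Φ *ᵥ cvec t)]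
  ring

theorem gaussianWave_const_ne_zero {Φ : Matrix (Fin n) (Fin n) ℂ} (hΦ : IsPhaseMatrix Φ) (α : ℝ)
    (t : Fin n → ℝ) :
    (exp (I * α) * ((((Φ.map Complex.im).det / Real.pi ^ n) ^ (1 / 4 : ℝ) : ℝ) : ℂ) *
        exp (I / 2 * (cvec t ⬝ᵥ Φ *ᵥ cvec t))) ≠ 0 := by
  refine mul_ne_zero (mul_ne_zero (Complex.exp_ne_zero _) ?_) (Complex.exp_ne_zero _)
  have := hΦ.2.det_pos
  rw [Ne, Complex.ofReal_eq_zero]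
  positivity

theorem IsGaussianWith.eq_smul {φ : L2 n} {Φ : Matrix (Fin n) (Fin n) ℂ} {s t : Fin n → ℝ}
    (h : IsGaussianWith φ Φ s t) : ∃ c : ℂ, c ≠ 0 ∧ φ = c • gv Φ (lin Φ s t) := by
  obtain ⟨hΦ, α, hα⟩ := h
  refine ⟨_, gaussianWave_const_ne_zero hΦ α t, ?_⟩
  apply Lp.ext
  filter_upwards [hα, coe_gv hΦ (lin Φ s t), Lp.coeFn_smul (exp (I * α) *
    ((((Φ.map Complex.im).det / Real.pi ^ n) ^ (1 / 4 : ℝ) : ℝ) : ℂ) *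
        exp (I / 2 * (cvec t ⬝ᵥ Φ *ᵥ cvec t))) (gv Φ (lin Φ s t))] with x h1 h2 h3
  rw [h1, h3, Pi.smul_apply, h2, smul_eq_mul, gaussianWave_eq hΦ]

theorem exists_isGaussianWith {Φ : Matrix (Fin n) (Fin n) ℂ} (hΦ : IsPhaseMatrix Φ)
    (s t : Fin n → ℝ) : ∃ c : ℂ, c ≠ 0 ∧ IsGaussianWith (c • gv Φ (lin Φ s t)) Φ s t := by
  refine ⟨_, gaussianWave_const_ne_zero hΦ 0 t, hΦ, 0, ?_⟩
  filter_upwards [coe_gv hΦ (lin Φ s t), Lp.coeFn_smul (exp (I * (0 : ℝ)) *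
    ((((Φ.map Complex.im).det / Real.pi ^ n) ^ (1 / 4 : ℝ) : ℝ) : ℂ) *
        exp (I / 2 * (cvec t ⬝ᵥ Φ *ᵥ cvec t))) (gv Φ (lin Φ s t))] with x h2 h3
  rw [h3, Pi.smul_apply, h2, smul_eq_mul, gaussianWave_eq hΦ]

/-- Every linear coefficient comes from a displacement. -/
theorem exists_lin_eq {Φ : Matrix (Fin n) (Fin n) ℂ} (hΦ : IsPhaseMatrix Φ) (b : Fin n → ℂ) :
    ∃ s t : Fin n → ℝ, lin Φ s t = b := by
  set V := Φ.map Complex.im with hV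
  -- With Φ = U + iV the linear coefficient is Vt + i(s - Ut): the real part of b fixes t, and then
  -- the imaginary part fixes s.
  have hVu : IsUnit V.det := hΦ.2.det_pos.ne'.isUnit
  set t := V⁻¹ *ᵥ (fun i => (b i).re) with ht
  have hVt : V *ᵥ t = fun i => (b i).re := by
    rw [ht, mulVec_mulVec, mul_nonsing_inv _ hVu, one_mulVec]
  refine ⟨fun i => (b i).im + (Φ.map Complex.re *ᵥ t) i, t, ?_⟩
  rw [lin, show Φ *ᵥ cvec t = cvec (Φ.map Complex.re *ᵥ t) + I • cvec (V *ᵥ t) by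
    conv_lhs => rw [cmat_re_add_im Φ, add_mulVec, smul_mulVec, cmat_mulVec, cmat_mulVec], hVt]
  ext i
  apply Complex.ext <;> simp [cvec]

theorem lin_injective {Φ : Matrix (Fin n) (Fin n) ℂ} (hΦ : IsPhaseMatrix Φ) {s t s' t' : Fin n → ℝ}
    (h : lin Φ s t = lin Φ s' t') : s = s' ∧ t = t' := by
  have hVu : IsUnit (Φ.map Complex.im).det := hΦ.2.det_pos.ne'.isUnit
  rw [lin, lin] at h
  have h := smul_right_injective _ I_ne_zero h
  rw [cmat_re_add_im Φ, add_mulVec, smul_mulVec, cmat_mulVec, cmat_mulVec, add_mulVec, smul_mulVec,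
    cmat_mulVec, cmat_mulVec] at h
  have hi : Φ.map Complex.im *ᵥ t = Φ.map Complex.im *ᵥ t' := by
    ext i
    have := congrArg Complex.im (congrFun h i)
    simpa [cvec] using this
  have ht : t = t' := by
    have := congrArg ((Φ.map Complex.im)⁻¹ *ᵥ ·) hi
    simpa [mulVec_mulVec, nonsing_inv_mul _ hVu] using this
  refine ⟨?_, ht⟩
  subst ht
  ext i
  have := congrArg Complex.re (congrFun h i)
  simpa [cvec] using this

theorem exists_state_of_gv {Φ : Matrix (Fin n) (Fin n) ℂ} (hΦ : IsPhaseMatrix Φ) (b : Fin n → ℂ) :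
    ∃ (c : ℂ) (s t : Fin n → ℝ), c ≠ 0 ∧ lin Φ s t = b ∧ IsGaussianWith (c • gv Φ b) Φ s t := by
  obtain ⟨s, t, rfl⟩ := exists_lin_eq hΦ b
  obtain ⟨c, hc, h⟩ := exists_isGaussianWith hΦ s t
  exact ⟨c, s, t, hc, rfl, h⟩

end

section

variable {n m k : ℕ}

/-! ### Simple tensors -/

theorem coe_tensorVec (f : L2 n) (g : L2 m) : tensorVec f g =ᵐ[volume] tensorFun f g :=
  MemLp.coeFn_toLp _

theorem tensorVec_congr (f : L2 n) (g : L2 m) {f' : (Fin n → ℝ) → ℂ} {g' : (Fin m → ℝ) → ℂ}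
    (hf : f =ᵐ[volume] f') (hg : g =ᵐ[volume] g') :
    tensorVec f g =ᵐ[volume] tensorFun f' g' := by
  have hs := (measurePreserving_split n m).quasiMeasurePreserving
  have h1 := (Measure.quasiMeasurePreserving_fst.comp hs).ae_eq_comp hf
  have h2 := (Measure.quasiMeasurePreserving_snd.comp hs).ae_eq_comp hg
  filter_upwards [coe_tensorVec f g, h1, h2] with x hx h1 h2
  rw [hx]
  simp only [Function.comp] at h1 h2
  simp only [tensorFun, h1, h2]

theorem inner_tensorVec (f f' : L2 n) (g g' : L2 m) :
    inner ℂ (tensorVec f g) (tensorVec f' g') = inner ℂ f f' * inner ℂ g g' := by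
  have hs := measurePreserving_split n m
  rw [inner_eq_integral, inner_eq_integral, inner_eq_integral]
  have h1 : ∫ x, (starRingEnd ℂ) (tensorVec f g x) * tensorVec f' g' x =
      ∫ x, (fun z : (Fin n → ℝ) × (Fin m → ℝ) => ((starRingEnd ℂ) (f z.1) * f' z.1) *
        ((starRingEnd ℂ) (g z.2) * g' z.2)) (split n m x) := by
    refine integral_congr_ae ?_
    filter_upwards [coe_tensorVec f g, coe_tensorVec f' g'] with x h1 h2
    rw [h1, h2]
    simp only [tensorFun, map_mul]
    ring
  rw [h1, ← integral_prod_mul, ← Measure.volume_eq_prod, ← hs.map_eq, integral_map]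
  · exact hs.measurable.aemeasurable
  · rw [hs.map_eq]
    have hc : ∀ {k : ℕ} (f f' : L2 k), AEStronglyMeasurable
        (fun x => (starRingEnd ℂ) (f x) * f' x) volume := fun f f' =>
      (Complex.continuous_conj.comp_aestronglyMeasurable (Lp.aestronglyMeasurable f)).mul
        (Lp.aestronglyMeasurable f')
    exact (hc f f').comp_fst.mul (hc g g').comp_snd

theorem Lp_ext_of_ae {f g : L2 n} {f' g' : (Fin n → ℝ) → ℂ} (hf : f =ᵐ[volume] f')
    (hg : g =ᵐ[volume] g') (h : ∀ x, f' x = g' x) : f = g :=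
  by
  apply Lp.ext
  filter_upwards [hf, hg] with x h1 h2
  rw [h1, h2, h]

theorem tensorVec_add_left (f f' : L2 n) (g : L2 m) :
    tensorVec (f + f') g = tensorVec f g + tensorVec f' g :=
  Lp_ext_of_ae (tensorVec_congr _ _ (Lp.coeFn_add f f') (ae_eq_refl _))
    ((Lp.coeFn_add _ _).trans ((coe_tensorVec f g).add (coe_tensorVec f' g)))
    fun x => by simp [tensorFun, add_mul]

theorem tensorVec_add_right (f : L2 n) (g g' : L2 m) :
    tensorVec f (g + g') = tensorVec f g + tensorVec f g' :=
  Lp_ext_of_ae (tensorVec_congr _ _ (ae_eq_refl _) (Lp.coeFn_add g g'))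
    ((Lp.coeFn_add _ _).trans ((coe_tensorVec f g).add (coe_tensorVec f g')))
    fun x => by simp [tensorFun, mul_add]

theorem tensorVec_smul_left (c : ℂ) (f : L2 n) (g : L2 m) :
    tensorVec (c • f) g = c • tensorVec f g :=
  Lp_ext_of_ae (tensorVec_congr _ _ (Lp.coeFn_smul c f) (ae_eq_refl _))
    ((Lp.coeFn_smul _ _).trans ((coe_tensorVec f g).const_smul c))
    fun x => by simp [tensorFun, mul_assoc]

theorem tensorVec_smul_right (c : ℂ) (f : L2 n) (g : L2 m) :
    tensorVec f (c • g) = c • tensorVec f g :=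
  Lp_ext_of_ae (tensorVec_congr _ _ (ae_eq_refl _) (Lp.coeFn_smul c g))
    ((Lp.coeFn_smul _ _).trans ((coe_tensorVec f g).const_smul c))
    fun x => by simp [tensorFun, mul_left_comm]

/-- Simple tensors as a bilinear map. -/
def tensorBilin (n m : ℕ) : L2 n →ₗ[ℂ] L2 m →ₗ[ℂ] L2 (n + m) :=
  LinearMap.mk₂ ℂ tensorVec tensorVec_add_left tensorVec_smul_left tensorVec_add_right
    tensorVec_smul_right

open scoped TensorProduct

/-- The isometric embedding of the algebraic tensor product. -/
def tensorIso (n m : ℕ) : L2 n ⊗[ℂ] L2 m →ₗ[ℂ] L2 (n + m) := TensorProduct.lift (tensorBilin n m)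

theorem tensorIso_tmul (f : L2 n) (g : L2 m) : tensorIso n m (f ⊗ₜ g) = tensorVec f g := rfl

theorem inner_tensorIso (x y : L2 n ⊗[ℂ] L2 m) :
    inner ℂ (tensorIso n m x) (tensorIso n m y) = inner ℂ x y := by
  induction x with
  | zero => simp
  | add x x' hx hx' => rw [map_add, inner_add_left, inner_add_left, hx, hx']
  | tmul f g =>
    induction y with
    | zero => simp
    | add x x' hx hx' => rw [map_add, inner_add_right, inner_add_right, hx, hx']
    | tmul f' g' => rw [tensorIso_tmul, tensorIso_tmul, inner_tensorVec, TensorProduct.inner_tmul]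

theorem norm_tensorIso (x : L2 n ⊗[ℂ] L2 m) : ‖tensorIso n m x‖ = ‖x‖ := by
  rw [norm_eq_sqrt_re_inner (𝕜 := ℂ), norm_eq_sqrt_re_inner (𝕜 := ℂ), inner_tensorIso]

/-! ### Direct sums of phase matrices -/

/-- The direct sum of two matrices. -/
def dsum (Φ : Matrix (Fin n) (Fin n) ℂ) (Ψ : Matrix (Fin m) (Fin m) ℂ) :
    Matrix (Fin (n + m)) (Fin (n + m)) ℂ :=
  (fromBlocks Φ 0 0 Ψ).submatrix finSumFinEquiv.symm finSumFinEquiv.symm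

section
variable (Φ : Matrix (Fin n) (Fin n) ℂ) (Ψ : Matrix (Fin m) (Fin m) ℂ)

@[simp] theorem dsum_castAdd_castAdd (i j : Fin n) :
    dsum Φ Ψ (Fin.castAdd m i) (Fin.castAdd m j) = Φ i j := by simp [dsum]

@[simp] theorem dsum_natAdd_natAdd (i j : Fin m) :
    dsum Φ Ψ (Fin.natAdd n i) (Fin.natAdd n j) = Ψ i j := by simp [dsum]

@[simp] theorem dsum_castAdd_natAdd (i : Fin n) (j : Fin m) :
    dsum Φ Ψ (Fin.castAdd m i) (Fin.natAdd n j) = 0 := by simp [dsum]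

@[simp] theorem dsum_natAdd_castAdd (i : Fin m) (j : Fin n) :
    dsum Φ Ψ (Fin.natAdd n i) (Fin.castAdd m j) = 0 := by simp [dsum]

end

theorem isPhaseMatrix_dsum {Φ : Matrix (Fin n) (Fin n) ℂ} {Ψ : Matrix (Fin m) (Fin m) ℂ}
    (hΦ : IsPhaseMatrix Φ) (hΨ : IsPhaseMatrix Ψ) : IsPhaseMatrix (dsum Φ Ψ) := by
  have hs : (dsum Φ Ψ).IsSymm := by
    rw [dsum, Matrix.IsSymm, transpose_submatrix, fromBlocks_transpose, hΦ.1.eq, hΨ.1.eq]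
    simp
  refine ⟨hs, ?_⟩
  refine PosDef.of_dotProduct_mulVec_pos ?_ fun x hx => ?_
  · rw [Matrix.IsHermitian, conjTranspose_eq_transpose_of_trivial, ← transpose_map, hs.eq]
  · have h1 := hΦ.2.posSemidef.dotProduct_mulVec_nonneg (fun i => x (Fin.castAdd m i))
    have h2 := hΨ.2.posSemidef.dotProduct_mulVec_nonneg (fun i => x (Fin.natAdd n i))
    have e : star x ⬝ᵥ ((dsum Φ Ψ).map Complex.im) *ᵥ x =
        star (fun i => x (Fin.castAdd m i)) ⬝ᵥ (Φ.map Complex.im) *ᵥ (fun i => x (Fin.castAdd m i))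
        + star (fun i => x (Fin.natAdd n i)) ⬝ᵥ (Ψ.map Complex.im) *ᵥ
          (fun i => x (Fin.natAdd n i)) := by
      simp [dotProduct, mulVec, Fin.sum_univ_add]
    rw [e]
    by_cases h : (fun i => x (Fin.castAdd m i)) = 0
    · have h' : (fun i => x (Fin.natAdd n i)) ≠ 0 := by
        intro h'
        apply hx
        ext i
        refine Fin.addCases (fun i => ?_) (fun i => ?_) i
        · exact congrFun h i
        · exact congrFun h' i
      exact add_pos_of_nonneg_of_pos h1 (hΨ.2.dotProduct_mulVec_pos h')
    · exact add_pos_of_pos_of_nonneg (hΦ.2.dotProduct_mulVec_pos h) h2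

theorem wave_dsum (Φ : Matrix (Fin n) (Fin n) ℂ) (Ψ : Matrix (Fin m) (Fin m) ℂ)
    (a : Fin n → ℂ) (b : Fin m → ℂ) (x : Fin (n + m) → ℝ) :
    tensorFun (wave Φ a) (wave Ψ b) x = wave (dsum Φ Ψ) (Fin.append a b) x := by
  unfold tensorFun wave gaussFun
  rw [← Complex.exp_add]
  congr 1
  simp [dotProduct, mulVec, Fin.sum_univ_add, split, cvec]
  ring

theorem tensorVec_gv {Φ : Matrix (Fin n) (Fin n) ℂ} {Ψ : Matrix (Fin m) (Fin m) ℂ}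
    (hΦ : IsPhaseMatrix Φ) (hΨ : IsPhaseMatrix Ψ) (a : Fin n → ℂ) (b : Fin m → ℂ) :
    tensorVec (gv Φ a) (gv Ψ b) = gv (dsum Φ Ψ) (Fin.append a b) :=
  Lp_ext_of_ae (tensorVec_congr _ _ (coe_gv hΦ a) (coe_gv hΨ b))
    (coe_gv (isPhaseMatrix_dsum hΦ hΨ) _) (wave_dsum Φ Ψ a b)

theorem dsum_I : dsum (I • (1 : Matrix (Fin n) (Fin n) ℂ)) (I • (1 : Matrix (Fin m) (Fin m) ℂ)) =
    I • 1 := by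
  have : (fromBlocks (I • (1 : Matrix (Fin n) (Fin n) ℂ)) 0 0
      (I • (1 : Matrix (Fin m) (Fin m) ℂ))) = I • 1 := by
    rw [← fromBlocks_one, fromBlocks_smul]; simp
  rw [dsum, this, submatrix_smul]
  simp

theorem tensorVec_coh (a : Fin n → ℂ) (b : Fin m → ℂ) :
    tensorVec (coh a) (coh b) = coh (Fin.append a b) := by
  rw [coh, coh, coh, tensorVec_gv isPhaseMatrix_I isPhaseMatrix_I, dsum_I]

theorem coh_eq_tensorVec (w : Fin (n + m) → ℂ) : coh w =
    tensorVec (coh fun i => w (Fin.castAdd m i)) (coh fun j => w (Fin.natAdd n j)) := by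
  rw [tensorVec_coh, Fin.append_castAdd_natAdd]

theorem ext_tensorVec {T S : L2 (n + m) →L[ℂ] L2 k}
    (h : ∀ f g, T (tensorVec f g) = S (tensorVec f g)) : T = S :=
  ext_coh fun w => by rw [coh_eq_tensorVec, h]

theorem ext_inner_tensorVec {f g : L2 (n + m)}
    (h : ∀ a b, inner ℂ (tensorVec (coh a) (coh b)) f = inner ℂ (tensorVec (coh a) (coh b)) g) :
    f = g :=
  ext_inner_coh fun w => by rw [coh_eq_tensorVec, h]

/-- Coherent vectors are simple tensors, so a vector orthogonal to the range is orthogonal to all of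
them. -/
theorem denseRange_tensorIso (n m : ℕ) : DenseRange (tensorIso n m) := by
  have : (LinearMap.range (tensorIso n m)).topologicalClosure = ⊤ := by
    rw [Submodule.topologicalClosure_eq_top_iff, Submodule.eq_bot_iff]
    intro f hf
    refine eq_zero_of_inner_coh fun w => ?_
    rw [coh_eq_tensorVec, ← tensorIso_tmul]
    exact (Submodule.mem_orthogonal _ _).1 hf _ ⟨_, rfl⟩
  rw [DenseRange, ← LinearMap.coe_range]
  exact Submodule.dense_iff_topologicalClosure_eq_top.2 this

/-! ### Tensor products of bounded operators -/

section
variable {E F G : Type} [NormedAddCommGroup E] [InnerProductSpace ℂ E] [CompleteSpace E]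
  [NormedAddCommGroup F] [InnerProductSpace ℂ F]
  [NormedAddCommGroup G] [InnerProductSpace ℂ G] [CompleteSpace G]

theorem inner_map_id (T : E →L[ℂ] G) (x y : E ⊗[ℂ] F) :
    inner ℂ (TensorProduct.map T.toLinearMap LinearMap.id x)
      (TensorProduct.map T.toLinearMap LinearMap.id y) =
    inner ℂ x (TensorProduct.map (T.adjoint.comp T).toLinearMap LinearMap.id y) := by
  induction x with
  | zero => simp
  | add x x' hx hx' => rw [map_add, inner_add_left, inner_add_left, hx, hx']
  | tmul f g =>
    induction y with
    | zero => simp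
    | add x x' hx hx' => rw [map_add, map_add, inner_add_right, inner_add_right, hx, hx']
    | tmul f' g' => simp [ContinuousLinearMap.adjoint_inner_right]

/-- The positive operator ‖T‖² - T*T has the form S*S, so ‖T‖²‖x‖² - ‖(T ⊗ 1)x‖² = ‖(S ⊗ 1)x‖² ≥ 0.
-/
theorem norm_map_id_le (T : E →L[ℂ] G) (x : E ⊗[ℂ] F) :
    ‖TensorProduct.map T.toLinearMap LinearMap.id x‖ ≤ ‖T‖ * ‖x‖ := by
  obtain ⟨S, hS⟩ : ∃ S : E →L[ℂ] E,
      ((‖T‖ ^ 2 : ℝ) : ℂ) • ContinuousLinearMap.id ℂ E - T.adjoint.comp T = S.adjoint.comp S := by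
    refine CStarAlgebra.nonneg_iff_eq_star_mul_self.mp ?_
    rw [ContinuousLinearMap.nonneg_iff_isPositive, ContinuousLinearMap.isPositive_iff_complex]
    intro x
    have e : inner ℂ ((((‖T‖ ^ 2 : ℝ) : ℂ) • ContinuousLinearMap.id ℂ E - T.adjoint.comp T) x) x =
        ((‖T‖ ^ 2 * ‖x‖ ^ 2 - ‖T x‖ ^ 2 : ℝ) : ℂ) := by
      simp only [_root_.sub_apply, _root_.smul_apply,
        ContinuousLinearMap.id_apply, ContinuousLinearMap.comp_apply, inner_sub_left,
        inner_smul_left, Complex.conj_ofReal, ContinuousLinearMap.adjoint_inner_left,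
        inner_self_eq_norm_sq_to_K]
      push_cast
      simp
    rw [e]
    refine ⟨by rw [RCLike.re_eq_complex_re, Complex.ofReal_re], ?_⟩
    rw [RCLike.re_eq_complex_re, Complex.ofReal_re]
    have := T.le_opNorm x
    have h2 : ‖T x‖ ^ 2 ≤ (‖T‖ * ‖x‖) ^ 2 := pow_le_pow_left₀ (norm_nonneg _) this 2
    rw [mul_pow] at h2
    linarith
  have h1 := inner_map_id T x x
  have h2 := inner_map_id S x x
  have h3 : ∀ x y : E ⊗[ℂ] F,
      inner ℂ x (TensorProduct.map (S.adjoint.comp S).toLinearMap LinearMap.id y) =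
      ((‖T‖ ^ 2 : ℝ) : ℂ) * inner ℂ x y -
        inner ℂ x (TensorProduct.map (T.adjoint.comp T).toLinearMap LinearMap.id y) := by
    intro x y
    induction x with
    | zero => simp
    | add x x' hx hx' => simp only [inner_add_left, hx, hx']; ring
    | tmul f g =>
      induction y with
      | zero => simp
      | add x x' hx hx' => simp only [map_add, inner_add_right, hx, hx']; ring
      | tmul f' g' =>
        have e : (S.adjoint.comp S) f' = ((‖T‖ ^ 2 : ℝ) : ℂ) • f' - (T.adjoint.comp T) f' := by
          rw [← hS]; simp
        simp only [TensorProduct.map_tmul, ContinuousLinearMap.coe_coe, e,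
          TensorProduct.inner_tmul, inner_sub_right, inner_smul_right, LinearMap.id_apply]
        ring
  have hE : ∀ z : E ⊗[ℂ] F, inner ℂ z z = ((‖z‖ : ℝ) : ℂ) ^ 2 := fun z =>
    inner_self_eq_norm_sq_to_K (𝕜 := ℂ) (E := E ⊗[ℂ] F) z
  have hG : ∀ z : G ⊗[ℂ] F, inner ℂ z z = ((‖z‖ : ℝ) : ℂ) ^ 2 := fun z =>
    inner_self_eq_norm_sq_to_K (𝕜 := ℂ) (E := G ⊗[ℂ] F) z
  rw [h3, ← h1, hE, hE, hG] at h2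
  have h4 : ‖TensorProduct.map S.toLinearMap (LinearMap.id (M := F)) x‖ ^ 2 =
      ‖T‖ ^ 2 * ‖x‖ ^ 2 - ‖TensorProduct.map T.toLinearMap (LinearMap.id (M := F)) x‖ ^ 2 := by
    exact_mod_cast h2
  refine le_of_sq_le_sq ?_ (by positivity)
  nlinarith [sq_nonneg ‖TensorProduct.map S.toLinearMap (LinearMap.id (M := F)) x‖]

end

theorem norm_map_le {n m n' m' : ℕ} (T : L2 n →L[ℂ] L2 m) (S : L2 n' →L[ℂ] L2 m')
    (x : L2 n ⊗[ℂ] L2 n') :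
    ‖TensorProduct.map T.toLinearMap S.toLinearMap x‖ ≤ ‖T‖ * ‖S‖ * ‖x‖ := by
  have h1 : TensorProduct.map T.toLinearMap S.toLinearMap x =
      TensorProduct.map T.toLinearMap LinearMap.id
        (TensorProduct.map LinearMap.id S.toLinearMap x) := by
    rw [← LinearMap.comp_apply, ← TensorProduct.map_comp]; simp
  have h2 : ‖TensorProduct.map (LinearMap.id (M := L2 n)) S.toLinearMap x‖ ≤ ‖S‖ * ‖x‖ := by
    rw [← TensorProduct.norm_comm, ← TensorProduct.norm_comm (𝕜 := ℂ) x,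
      ← TensorProduct.map_comm]
    exact norm_map_id_le S _
  rw [h1, mul_assoc]
  exact (norm_map_id_le T _).trans (mul_le_mul_of_nonneg_left h2 (norm_nonneg _))

/-- The algebraic T ⊗ S is bounded and the algebraic tensor product is isometrically dense in the
functions of all variables, so it extends by continuity. -/
theorem exists_isTensorOp {n m n' m' : ℕ} (T : L2 n →L[ℂ] L2 m) (S : L2 n' →L[ℂ] L2 m') :
    ∃ R, IsTensorOp R T S := by
  refine ⟨((tensorIso m m').comp
    (TensorProduct.map T.toLinearMap S.toLinearMap)).extendOfNorm (tensorIso n n'), fun f g => ?_⟩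
  have := LinearMap.extendOfNorm_eq (denseRange_tensorIso n n')
    (f := (tensorIso m m').comp (TensorProduct.map T.toLinearMap S.toLinearMap))
    ⟨‖T‖ * ‖S‖, fun x => by
      rw [LinearMap.comp_apply, norm_tensorIso, norm_tensorIso]
      exact norm_map_le T S x⟩ (f ⊗ₜ g)
  rw [tensorIso_tmul] at this
  rw [this, LinearMap.comp_apply, TensorProduct.map_tmul, tensorIso_tmul]
  rfl

theorem IsTensorOp.unique {n m n' m' : ℕ} {R R' : L2 (n + n') →L[ℂ] L2 (m + m')}
    {T : L2 n →L[ℂ] L2 m} {S : L2 n' →L[ℂ] L2 m'} (h : IsTensorOp R T S)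
    (h' : IsTensorOp R' T S) : R = R' :=
  ext_tensorVec fun f g => by rw [h, h']

theorem IsTensorOp.adjoint {n m n' m' : ℕ} {R : L2 (n + n') →L[ℂ] L2 (m + m')}
    {T : L2 n →L[ℂ] L2 m} {S : L2 n' →L[ℂ] L2 m'} (h : IsTensorOp R T S) :
    IsTensorOp R.adjoint T.adjoint S.adjoint := by
  intro f g
  refine ext_inner_tensorVec fun a b => ?_
  rw [ContinuousLinearMap.adjoint_inner_right, h, inner_tensorVec, inner_tensorVec,
    ContinuousLinearMap.adjoint_inner_right, ContinuousLinearMap.adjoint_inner_right]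

theorem IsTensorOp.smul {n m n' m' : ℕ} {R : L2 (n + n') →L[ℂ] L2 (m + m')}
    {T : L2 n →L[ℂ] L2 m} {S : L2 n' →L[ℂ] L2 m'} (h : IsTensorOp R T S) (c d : ℂ) :
    IsTensorOp ((c * d) • R) (c • T) (d • S) := by
  intro f g
  simp only [_root_.smul_apply, h f g, tensorVec_smul_left, tensorVec_smul_right,
    smul_smul, mul_comm c d]

/-! ### Symmetries and permutations of modes -/

theorem coe_swapOp (f : L2 (n + m)) :
    swapOp n m f =ᵐ[volume] fun y => f (flipCoord n m y) :=
  Lp.coeFn_compMeasurePreserving f (measurePreserving_flipCoord n m)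

theorem inner_swapOp (f g : L2 (n + m)) :
    inner ℂ (swapOp n m f) (swapOp n m g) = inner ℂ f g :=
  (Lp.compMeasurePreservingₗᵢ ℂ (flipCoord n m) (measurePreserving_flipCoord n m)).inner_map_map f g

/-- Reindexing a phase matrix by the exchange of two groups of modes. -/
def flipMat (Φ : Matrix (Fin (n + m)) (Fin (n + m)) ℂ) : Matrix (Fin (m + n)) (Fin (m + n)) ℂ :=
  Φ.submatrix finAddFlip finAddFlip

theorem isPhaseMatrix_flipMat {Φ : Matrix (Fin (n + m)) (Fin (n + m)) ℂ} (hΦ : IsPhaseMatrix Φ) :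
    IsPhaseMatrix (flipMat Φ) :=
  ⟨by rw [Matrix.IsSymm, flipMat, transpose_submatrix, hΦ.1.eq],
    hΦ.2.submatrix (finAddFlip (m := m) (n := n)).injective⟩

theorem wave_flipCoord (Φ : Matrix (Fin (n + m)) (Fin (n + m)) ℂ) (b : Fin (n + m) → ℂ)
    (y : Fin (m + n) → ℝ) :
    wave Φ b (flipCoord n m y) = wave (flipMat Φ) (fun i => b (finAddFlip i)) y := by
  have hf : ∀ i : Fin (m + n), (finAddFlip (finAddFlip i : Fin (n + m)) : Fin (m + n)) = i :=
    fun i => by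
      refine Fin.addCases (fun i => ?_) (fun i => ?_) i <;> simp
  unfold wave gaussFun
  congr 1
  simp only [dotProduct, mulVec, cvec, flipCoord]
  rw [← Equiv.sum_comp (finAddFlip (m := m) (n := n)),
    ← Equiv.sum_comp (finAddFlip (m := m) (n := n)) (fun i => b i * _)]
  simp only [hf]
  congr 2
  refine Finset.sum_congr rfl fun i _ => ?_
  rw [← Equiv.sum_comp (finAddFlip (m := m) (n := n))]
  simp only [hf, flipMat]
  rfl

theorem swapOp_gv {Φ : Matrix (Fin (n + m)) (Fin (n + m)) ℂ} (hΦ : IsPhaseMatrix Φ)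
    (b : Fin (n + m) → ℂ) :
    swapOp n m (gv Φ b) = gv (flipMat Φ) (fun i => b (finAddFlip i)) := by
  refine Lp_ext_of_ae ((coe_swapOp _).trans
    ((measurePreserving_flipCoord n m).quasiMeasurePreserving.ae_eq_comp (coe_gv hΦ b)))
    (coe_gv (isPhaseMatrix_flipMat hΦ) _) ?_
  exact wave_flipCoord Φ b

theorem swapOp_tensorVec (f : L2 n) (g : L2 m) :
    swapOp n m (tensorVec f g) = tensorVec g f := by
  refine ext_inner_tensorVec fun a b => ?_
  have h : tensorVec (coh a) (coh b) = swapOp n m (tensorVec (coh b) (coh a)) := by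
    rw [tensorVec_coh, tensorVec_coh, coh, coh, swapOp_gv isPhaseMatrix_I]
    congr 1
    · ext i j
      simp [flipMat, Matrix.one_apply]
    · ext i
      refine Fin.addCases (fun i => ?_) (fun i => ?_) i <;> simp
  conv_lhs => rw [h, inner_swapOp, inner_tensorVec]
  rw [inner_tensorVec, mul_comm]

theorem adjoint_swapOp (n m : ℕ) : (swapOp n m).adjoint = swapOp m n := by
  refine ext_tensorVec fun f g => ?_
  refine ext_inner_tensorVec fun a b => ?_
  rw [ContinuousLinearMap.adjoint_inner_right, swapOp_tensorVec, swapOp_tensorVec,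
    inner_tensorVec, inner_tensorVec, mul_comm]

end

section

variable {n m k : ℕ}

/-! ### Transport along equalities of numbers of modes -/

/-- Transport of vectors along an equality of numbers of modes. -/
def castL {N N' : ℕ} (e : N = N') : L2 N ≃ₗᵢ[ℂ] L2 N' := e ▸ LinearIsometryEquiv.refl ℂ (L2 N)

theorem inner_coh_castL {N N' : ℕ} (e : N = N') (w : Fin N' → ℂ) (f : L2 N) :
    inner ℂ (coh w) (castL e f) = inner ℂ (coh fun i => w (Fin.cast e i)) f := by
  subst e; rfl

/-- Against a coherent vector, transport only relabels the parameters, and both sides become the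
same product of three overlaps. -/
theorem castL_assoc (f : L2 n) (g : L2 m) (h : L2 k) (e : n + m + k = n + (m + k)) :
    castL e (tensorVec (tensorVec f g) h) = tensorVec f (tensorVec g h) := by
  refine ext_inner_coh fun w => ?_
  rw [inner_coh_castL, coh_eq_tensorVec, coh_eq_tensorVec (fun i => w (Fin.cast e _)),
    inner_tensorVec, inner_tensorVec, coh_eq_tensorVec w,
    coh_eq_tensorVec (fun j => w (Fin.natAdd n j)), inner_tensorVec, inner_tensorVec, mul_assoc]
  have e1 : ∀ i, Fin.cast e (Fin.castAdd k (Fin.castAdd m i)) = Fin.castAdd (m + k) i :=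
    fun i => Fin.ext (by simp)
  have e2 : ∀ i, Fin.cast e (Fin.castAdd k (Fin.natAdd n i)) = Fin.natAdd n (Fin.castAdd k i) :=
    fun i => Fin.ext (by simp)
  have e3 : ∀ i, Fin.cast e (Fin.natAdd (n + m) i) = Fin.natAdd n (Fin.natAdd m i) :=
    fun i => Fin.ext (by simp [add_assoc])
  simp only [e1, e2, e3]

theorem coe_unitVec : unitVec =ᵐ[volume] fun _ => (1 : ℂ) := by
  rw [unitVec]
  filter_upwards [indicatorConstLp_coeFn (p := 2) (hs := MeasurableSet.univ)
    (hμs := (by simp [volume_pi, Measure.pi_of_empty (x := fun i : Fin 0 => i.elim0)] :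
      (volume : Measure (Fin 0 → ℝ)) Set.univ ≠ ⊤)) (c := (1 : ℂ))] with x hx
  rw [hx]; simp

theorem isPhaseMatrix_fin_zero (Φ : Matrix (Fin 0) (Fin 0) ℂ) : IsPhaseMatrix Φ := by
  rw [Subsingleton.elim Φ (I • 1)]
  exact isPhaseMatrix_I

theorem gv_fin_zero (Φ : Matrix (Fin 0) (Fin 0) ℂ) (b : Fin 0 → ℂ) : gv Φ b = unitVec :=
  Lp_ext_of_ae (coe_gv (isPhaseMatrix_fin_zero Φ) b) coe_unitVec fun x => by
    simp [wave, gaussFun]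

theorem coh_fin_zero (w : Fin 0 → ℂ) : coh w = unitVec := gv_fin_zero _ _

theorem inner_unitVec : inner ℂ unitVec unitVec = (1 : ℂ) := by
  rw [inner_eq_integral]
  have : ∫ x, (starRingEnd ℂ) (unitVec x) * unitVec x = ∫ _x : Fin 0 → ℝ, (1 : ℂ) := by
    refine integral_congr_ae ?_
    filter_upwards [coe_unitVec] with x hx
    rw [hx]; simp
  rw [this]
  simp [volume_pi, Measure.pi_of_empty (x := fun i : Fin 0 => i.elim0)]

theorem castL_tensor_unit (f : L2 n) (e : n + 0 = n) : castL e (tensorVec f unitVec) = f := by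
  refine ext_inner_coh fun w => ?_
  rw [inner_coh_castL, coh_eq_tensorVec, inner_tensorVec, coh_fin_zero, inner_unitVec, mul_one]
  rfl

theorem castL_unit_tensor (f : L2 n) (e : 0 + n = n) : castL e (tensorVec unitVec f) = f := by
  refine ext_inner_coh fun w => ?_
  rw [inner_coh_castL, coh_eq_tensorVec, inner_tensorVec, coh_fin_zero, inner_unitVec, one_mul]
  have e1 : ∀ i, Fin.cast e (Fin.natAdd 0 i) = i := fun i => Fin.ext (by simp)
  simp only [e1]

/-- `n + 0` reduces to `n`, so no transport is needed on this side, in contrast to `0 + n`. -/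
theorem tensorVec_unitVec (f : L2 n) : tensorVec f unitVec = f := castL_tensor_unit f rfl

/-! ### `QGauss` is a prop -/

namespace QGauss

theorem mk_eq_mk {T T' : L2 n →L[ℂ] L2 m} {h : IsQGauss T} {h' : IsQGauss T'} {c : ℂ} (hc : c ≠ 0)
    (e : T' = c • T) : mk T h = mk T' h' :=
  Quotient.sound (s := scalarSetoid n m) ⟨c, hc, e⟩

theorem exists_smul_of_mk_eq {T T' : L2 n →L[ℂ] L2 m} {h : IsQGauss T} {h' : IsQGauss T'}
    (e : mk T h = mk T' h') : ∃ c : ℂ, c ≠ 0 ∧ T' = c • T :=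
  Quotient.exact (s := scalarSetoid n m) e

theorem mk_surj (q : QGauss n m) : ∃ T h, q = mk T h := by
  obtain ⟨⟨T, h⟩, rfl⟩ := Quotient.exists_rep q
  exact ⟨T, h, rfl⟩

theorem mk_comp_mk {S : L2 m →L[ℂ] L2 k} {T : L2 n →L[ℂ] L2 m} {hS : IsQGauss S}
    {hT : IsQGauss T} : comp (mk S hS) (mk T hT) = mk (S.comp T) (.comp S T hS hT) := rfl

/-- Representatives for a tensor product, with prescribed representatives of the factors. -/
theorem IsTensor.exists_op {n m n' m' : ℕ} {R : QGauss (n + n') (m + m')} {T : L2 n →L[ℂ] L2 m}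
    {S : L2 n' →L[ℂ] L2 m'} {hT : IsQGauss T} {hS : IsQGauss S}
    (h : IsTensor R (mk T hT) (mk S hS)) :
    ∃ r, ∃ hr : IsQGauss r, R = mk r hr ∧ IsTensorOp r T S := by
  obtain ⟨r, t, s, hr, ht, hs, rfl, h1, h2, h3⟩ := h
  obtain ⟨c, hc, rfl⟩ := exists_smul_of_mk_eq h1.symm
  obtain ⟨d, hd, rfl⟩ := exists_smul_of_mk_eq h2.symm
  have h4 := h3.smul c d
  -- The tensor relation holds for some representatives t = cT and s = dS; the factor cd is moved to
  -- the product.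
  have hr' : IsQGauss ((c * d) • r) := .tensor _ _ _ hT hS h4
  exact ⟨_, hr', mk_eq_mk (mul_ne_zero hc hd) rfl, h4⟩

theorem IsTensor.of_op {n m n' m' : ℕ} {r : L2 (n + n') →L[ℂ] L2 (m + m')} {T : L2 n →L[ℂ] L2 m}
    {S : L2 n' →L[ℂ] L2 m'} {hr : IsQGauss r} {hT : IsQGauss T} {hS : IsQGauss S}
    (h : IsTensorOp r T S) : IsTensor (mk r hr) (mk T hT) (mk S hS) :=
  ⟨r, T, S, hr, hT, hS, rfl, rfl, rfl, h⟩

theorem heq_mk {N N' M M' : ℕ} (e₁ : N = N') (e₂ : M = M') {b : L2 N →L[ℂ] L2 M}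
    {d : L2 N' →L[ℂ] L2 M'} (hb : IsQGauss b) (hd : IsQGauss d)
    (h : ∀ w, castL e₂ (b (coh w)) = d (castL e₁ (coh w))) : HEq (mk b hb) (mk d hd) := by
  subst e₁ e₂
  have : b = d := ext_coh h
  subst this
  rfl

theorem exists_mk_of_heq {N N' M M' : ℕ} (e₁ : N = N') (e₂ : M = M') {A : QGauss N M}
    {d : L2 N' →L[ℂ] L2 M'} {hd : IsQGauss d} (h : HEq A (mk d hd)) :
    ∃ b, ∃ hb : IsQGauss b, A = mk b hb ∧ ∀ x, castL e₂ (b x) = d (castL e₁ x) := by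
  subst e₁ e₂
  exact ⟨d, hd, eq_of_heq h, fun x => rfl⟩

end QGauss

-- Each law is checked for operators on simple tensors or coherent vectors; the scalar is 1 once
-- representatives are chosen compatibly.
open QGauss in
theorem qGaussIsProp : QGaussIsProp where
  id_comp T := by
    obtain ⟨T, h, rfl⟩ := mk_surj T
    exact mk_eq_mk one_ne_zero (by simp)
  comp_id T := by
    obtain ⟨T, h, rfl⟩ := mk_surj T
    exact mk_eq_mk one_ne_zero (by simp)
  assoc R S T := by
    obtain ⟨T, h, rfl⟩ := mk_surj T
    obtain ⟨S, h, rfl⟩ := mk_surj S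
    obtain ⟨R, h, rfl⟩ := mk_surj R
    rfl
  exists_tensor T S := by
    obtain ⟨T, hT, rfl⟩ := mk_surj T
    obtain ⟨S, hS, rfl⟩ := mk_surj S
    obtain ⟨R, hR⟩ := exists_isTensorOp T S
    refine ⟨mk R (.tensor R T S hT hS hR), .of_op hR, fun R' hR' => ?_⟩
    obtain ⟨r, hr, rfl, ho⟩ := hR'.exists_op
    exact mk_eq_mk one_ne_zero (by rw [one_smul, ho.unique hR])
  tensor_id n m := .of_op fun f g => rfl
  tensor_comp {n m k n' m' k' R R' T S T' S'} h h' := by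
    obtain ⟨T, hT, rfl⟩ := mk_surj T
    obtain ⟨S, hS, rfl⟩ := mk_surj S
    obtain ⟨T', hT', rfl⟩ := mk_surj T'
    obtain ⟨S', hS', rfl⟩ := mk_surj S'
    obtain ⟨r, hr, rfl, ho⟩ := h.exists_op
    obtain ⟨r', hr', rfl, ho'⟩ := h'.exists_op
    exact .of_op fun f g => by
      simp only [ContinuousLinearMap.comp_apply, ho f g, ho' _ _]
  tensor_assoc {n m n' m' n'' m'' T T' T'' A B C D} hA hB hC hD := by
    obtain ⟨T, hT, rfl⟩ := mk_surj T
    obtain ⟨T', hT', rfl⟩ := mk_surj T'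
    obtain ⟨T'', hT'', rfl⟩ := mk_surj T''
    obtain ⟨a, ha, rfl, hAo⟩ := hA.exists_op
    obtain ⟨b, hb, rfl, hBo⟩ := hB.exists_op
    obtain ⟨c, hc, rfl, hCo⟩ := hC.exists_op
    obtain ⟨d, hd, rfl, hDo⟩ := hD.exists_op
    refine heq_mk (add_assoc _ _ _) (add_assoc _ _ _) hb hd fun w => ?_
    rw [coh_eq_tensorVec, coh_eq_tensorVec (fun i => w (Fin.castAdd n'' i)), hBo, hAo, castL_assoc,
      castL_assoc, hDo, hCo]
  tensor_unit {n m T R} h := by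
    obtain ⟨T, hT, rfl⟩ := mk_surj T
    obtain ⟨r, hr, rfl, ho⟩ := IsTensor.exists_op h
    refine heq_mk rfl rfl hr hT fun w => ?_
    have := ho (coh w) unitVec
    rw [tensorVec_unitVec] at this
    exact this.trans (tensorVec_unitVec _)
  unit_tensor {n m T R} h := by
    obtain ⟨T, hT, rfl⟩ := mk_surj T
    obtain ⟨r, hr, rfl, ho⟩ := IsTensor.exists_op h
    refine heq_mk (zero_add _) (zero_add _) hr hT fun w => ?_
    rw [coh_eq_tensorVec, ho, coh_fin_zero, ContinuousLinearMap.id_apply, castL_unit_tensor,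
      castL_unit_tensor]
  swap_natural {n m n' m' T S R R'} h h' := by
    obtain ⟨T, hT, rfl⟩ := mk_surj T
    obtain ⟨S, hS, rfl⟩ := mk_surj S
    obtain ⟨r, hr, rfl, ho⟩ := h.exists_op
    obtain ⟨r', hr', rfl, ho'⟩ := h'.exists_op
    refine mk_eq_mk one_ne_zero (ext_tensorVec fun f g => ?_)
    simp only [one_smul, ContinuousLinearMap.comp_apply, swapOp_tensorVec, ho f g, ho' g f]
  swap_swap n m := by
    refine mk_eq_mk one_ne_zero (ext_tensorVec fun f g => ?_)
    simp only [one_smul, ContinuousLinearMap.comp_apply, swapOp_tensorVec,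
      ContinuousLinearMap.id_apply]
  swap_add {n m k A B A' B'} hA hB hA' hB' := by
    obtain ⟨a, ha, rfl, hAo⟩ := IsTensor.exists_op hA
    obtain ⟨b, hb, rfl, hBo⟩ := IsTensor.exists_op hB
    obtain ⟨a', ha', rfl, hAo'⟩ := exists_mk_of_heq (add_assoc _ _ _).symm (add_assoc _ _ _).symm hA'
    obtain ⟨b', hb', rfl, hBo'⟩ := exists_mk_of_heq rfl (add_assoc _ _ _) hB'
    refine mk_eq_mk one_ne_zero (ext_coh fun w => ?_)
    rw [coh_eq_tensorVec, coh_eq_tensorVec (fun i => w (Fin.natAdd n i))]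
    generalize coh (fun i => w (Fin.castAdd (m + k) i)) = f
    generalize coh _ = g
    generalize coh _ = h
    have e' : ∀ {N N' : ℕ} (e : N = N') (x : L2 N) (y : L2 N'),
        castL e x = y → x = castL e.symm y := by
      intro N N' e x y h; subst e; exact h
    have h1 : a' (tensorVec f (tensorVec g h)) = tensorVec g (tensorVec f h) := by
      have h2 := hAo' (tensorVec f (tensorVec g h))
      rw [← e' _ _ _ (castL_assoc f g h (add_assoc _ _ _)), hAo, swapOp_tensorVec,
        ContinuousLinearMap.id_apply] at h2
      rw [e' _ _ _ h2, castL_assoc]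
    have h3 : b' (tensorVec g (tensorVec f h)) = tensorVec (tensorVec g h) f := by
      have h2 := hBo' (tensorVec g (tensorVec f h))
      rw [e' _ _ _ h2]
      change castL _ (b (tensorVec g (tensorVec f h))) = _
      rw [hBo, swapOp_tensorVec, ContinuousLinearMap.id_apply]
      exact (e' _ _ _ (castL_assoc g h f (add_assoc _ _ _))).symm
    rw [one_smul, swapOp_tensorVec]
    change b' (a' _) = _
    rw [h1, h3]

/-! ### Relations form a prop -/

/-- The vector in phase space with given components. -/
def jn (a : Phase n) (b : Phase m) : Phase (n + m) :=
  Sum.elim (Fin.append (a ∘ Sum.inl) (b ∘ Sum.inl)) (Fin.append (a ∘ Sum.inr) (b ∘ Sum.inr))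

@[simp] theorem jn_fstIx (a : Phase n) (b : Phase m) : jn a b ∘ fstIx n m = a := by
  ext i; rcases i with i | i <;> simp [jn, fstIx]

@[simp] theorem jn_sndIx (a : Phase n) (b : Phase m) : jn a b ∘ sndIx n m = b := by
  ext i; rcases i with i | i <;> simp [jn, sndIx]

theorem phase_ext {u v : Phase (n + m)} (h₁ : u ∘ fstIx n m = v ∘ fstIx n m)
    (h₂ : u ∘ sndIx n m = v ∘ sndIx n m) : u = v := by
  ext i
  rcases i with i | i
  · refine Fin.addCases (fun i => ?_) (fun i => ?_) i
    · exact congrFun h₁ (Sum.inl i)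
    · exact congrFun h₂ (Sum.inl i)
  · refine Fin.addCases (fun i => ?_) (fun i => ?_) i
    · exact congrFun h₁ (Sum.inr i)
    · exact congrFun h₂ (Sum.inr i)

theorem jn_eta (u : Phase (n + m)) : jn (u ∘ fstIx n m) (u ∘ sndIx n m) = u :=
  phase_ext (by simp) (by simp)

/-- Transport of phase-space indices along an equality of numbers of modes. -/
def castIx {N N' : ℕ} (e : N = N') : Ix N → Ix N' := Sum.map (Fin.cast e) (Fin.cast e)

theorem heq_rel {N N' M M' : ℕ} (e₁ : N = N') (e₂ : M = M') {B : Set (Phase N × Phase M)}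
    {D : Set (Phase N' × Phase M')}
    (h : ∀ v, (v.1 ∘ castIx e₁, v.2 ∘ castIx e₂) ∈ B ↔ v ∈ D) : HEq B D := by
  subst e₁ e₂
  refine heq_of_eq (Set.ext fun v => ?_)
  rw [← h v]
  simp [castIx]

theorem mem_of_heq_rel {N N' M M' : ℕ} (e₁ : N = N') (e₂ : M = M') {B : Set (Phase N × Phase M)}
    {D : Set (Phase N' × Phase M')} (h : HEq B D) (v : Phase N × Phase M) :
    v ∈ B ↔ (v.1 ∘ castIx e₁.symm, v.2 ∘ castIx e₂.symm) ∈ D := by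
  subst e₁ e₂
  cases h
  simp [castIx]

section
variable (e : n + m + k = n + (m + k))

theorem castIx_fst_fst : castIx e ∘ fstIx (n + m) k ∘ fstIx n m = fstIx n (m + k) := by
  funext i; rcases i with i | i <;> simp [castIx, fstIx, Fin.ext_iff]

theorem castIx_fst_snd :
    castIx e ∘ fstIx (n + m) k ∘ sndIx n m = sndIx n (m + k) ∘ fstIx m k := by
  funext i; rcases i with i | i <;> simp [castIx, fstIx, sndIx, Fin.ext_iff]

theorem castIx_snd : castIx e ∘ sndIx (n + m) k = sndIx n (m + k) ∘ sndIx m k := by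
  funext i; rcases i with i | i <;> simp [castIx, sndIx, Fin.ext_iff, add_assoc]

end

section
variable (e : n + (m + k) = n + m + k)

theorem castIx_symm_fst : castIx e ∘ fstIx n (m + k) = fstIx (n + m) k ∘ fstIx n m := by
  funext i; rcases i with i | i <;> simp [castIx, fstIx, Fin.ext_iff]

theorem castIx_symm_snd_fst :
    castIx e ∘ sndIx n (m + k) ∘ fstIx m k = fstIx (n + m) k ∘ sndIx n m := by
  funext i; rcases i with i | i <;> simp [castIx, fstIx, sndIx, Fin.ext_iff]

theorem castIx_symm_snd_snd :
    castIx e ∘ sndIx n (m + k) ∘ sndIx m k = sndIx (n + m) k := by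
  funext i; rcases i with i | i <;> simp [castIx, sndIx, Fin.ext_iff, add_assoc]

end

theorem relComp_relSum {n m k n' m' k' : ℕ} (T' : Set (Phase m × Phase k))
    (S' : Set (Phase m' × Phase k')) (T : Set (Phase n × Phase m)) (S : Set (Phase n' × Phase m')) :
    relComp (relSum T' S') (relSum T S) = relSum (relComp T' T) (relComp S' S) := by
  ext v
  constructor
  · rintro ⟨b, ⟨h1, h2⟩, h3, h4⟩
    exact ⟨⟨_, h1, h3⟩, _, h2, h4⟩
  · rintro ⟨⟨b, h1, h3⟩, b', h2, h4⟩
    exact ⟨jn b b', ⟨by simpa using h1, by simpa using h2⟩, by simpa using h3, by simpa using h4⟩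

theorem relComp_assoc {n m k l : ℕ} (R : Set (Phase k × Phase l)) (S : Set (Phase m × Phase k))
    (T : Set (Phase n × Phase m)) : relComp (relComp R S) T = relComp R (relComp S T) := by
  ext v
  constructor
  · rintro ⟨b, h1, c, h2, h3⟩
    exact ⟨c, ⟨b, h1, h2⟩, h3⟩
  · rintro ⟨c, ⟨b, h1, h2⟩, h3⟩
    exact ⟨b, h1, c, h2, h3⟩

theorem relId_comp (T : Set (Phase n × Phase m)) : relComp (relId m) T = T := by
  ext ⟨u, v⟩
  simp [relComp, relId]

theorem relComp_id (T : Set (Phase n × Phase m)) : relComp T (relId n) = T := by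
  ext ⟨u, v⟩
  simp [relComp, relId]

theorem relSum_id (n m : ℕ) : relSum (relId n) (relId m) = relId (n + m) := by
  ext ⟨u, v⟩
  exact ⟨fun h => phase_ext h.1 h.2, fun h => by cases h; exact ⟨rfl, rfl⟩⟩

theorem relIsProp : RelIsProp where
  id_comp := relId_comp
  comp_id := relComp_id
  assoc := relComp_assoc
  exists_tensor T S := ⟨_, rfl, fun _ h => h⟩
  tensor_id n m := (relSum_id n m).symm
  tensor_comp := by
    rintro n m k n' m' k' R R' T S T' S' rfl rfl
    exact relComp_relSum _ _ _ _
  tensor_assoc := by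
    rintro n m n' m' n'' m'' T T' T'' A B C D rfl rfl rfl rfl
    refine heq_rel (add_assoc _ _ _) (add_assoc _ _ _) fun v => ?_
    simp only [relSum, Set.mem_ofPred_eq, Function.comp_assoc, castIx_fst_fst, castIx_fst_snd,
      castIx_snd, and_assoc]
  tensor_unit := by
    rintro n m T R rfl
    refine heq_rel (add_zero _) (add_zero _) fun v => ?_
    have h1 : ∀ {N : ℕ} (u : Phase N), (u ∘ castIx (add_zero N)) ∘ fstIx N 0 = u := by
      intro N u; ext i; rcases i with i | i <;> rfl
    simp only [relSum, Set.mem_ofPred_eq, h1, relId]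
    exact and_iff_left (Subsingleton.elim _ _)
  unit_tensor := by
    rintro n m T R rfl
    refine heq_rel (zero_add _) (zero_add _) fun v => ?_
    have h1 : ∀ {N : ℕ} (u : Phase N), (u ∘ castIx (zero_add N)) ∘ sndIx 0 N = u := by
      intro N u; ext i; rcases i with i | i <;> simp [castIx, sndIx]
    simp only [relSum, Set.mem_ofPred_eq, h1, relId]
    exact and_iff_right (Subsingleton.elim _ _)
  swap_natural := by
    rintro n m n' m' T S R R' rfl rfl
    ext ⟨u, v⟩
    constructor
    · rintro ⟨b, ⟨h1, h2⟩, h3, h4⟩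
      simp only at h1 h2 h3 h4
      refine ⟨jn (u ∘ sndIx n n') (u ∘ fstIx n n'), ⟨by simp, by simp⟩, ?_⟩
      simp only [relSum, Set.mem_ofPred_eq, jn_fstIx, jn_sndIx, h3, h4]
      exact ⟨h2, h1⟩
    · rintro ⟨b, ⟨h3, h4⟩, h1, h2⟩
      simp only at h1 h2 h3 h4
      refine ⟨jn (v ∘ sndIx m' m) (v ∘ fstIx m' m), ?_, ⟨by simp, by simp⟩⟩
      simp only [relSum, Set.mem_ofPred_eq, jn_fstIx, jn_sndIx, ← h3, ← h4]
      exact ⟨h2, h1⟩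
  swap_swap n m := by
    ext ⟨u, v⟩
    constructor
    · rintro ⟨b, ⟨h1, h2⟩, h3, h4⟩
      simp only at h1 h2 h3 h4
      exact phase_ext (by rw [h3, h2]) (by rw [h4, h1])
    · intro h
      cases (show u = v from h)
      exact ⟨jn (u ∘ sndIx n m) (u ∘ fstIx n m), ⟨by simp, by simp⟩, by simp, by simp⟩
  swap_add := by
    rintro n m k A B A' B' rfl rfl hA hB
    have hA' := mem_of_heq_rel (add_assoc _ _ _).symm (add_assoc _ _ _).symm hA
    have hB' := mem_of_heq_rel rfl (add_assoc _ _ _) hB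
    ext ⟨u, v⟩
    have key : ∀ b, (u, b) ∈ A' ↔ (b ∘ fstIx m (n + k) = u ∘ sndIx n (m + k) ∘ fstIx m k ∧
        b ∘ sndIx m (n + k) ∘ fstIx n k = u ∘ fstIx n (m + k)) ∧
        u ∘ sndIx n (m + k) ∘ sndIx m k = b ∘ sndIx m (n + k) ∘ sndIx n k := fun b => by
      rw [hA']
      simp only [relSum, relSwap, relId, Set.mem_ofPred_eq, Function.comp_assoc, castIx_fst_fst,
        castIx_fst_snd, castIx_snd]
    have key' : ∀ b, (b, v) ∈ B' ↔ b ∘ fstIx m (n + k) = v ∘ fstIx (m + k) n ∘ fstIx m k ∧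
        v ∘ fstIx (m + k) n ∘ sndIx m k = b ∘ sndIx m (n + k) ∘ sndIx n k ∧
        v ∘ sndIx (m + k) n = b ∘ sndIx m (n + k) ∘ fstIx n k := fun b => by
      rw [hB']
      have e1 : ∀ (b : Phase (m + (n + k))), b ∘ castIx rfl = b := fun b => by
        ext i; rcases i with i | i <;> rfl
      simp only [relSum, relSwap, relId, Set.mem_ofPred_eq, Function.comp_assoc, castIx_symm_fst,
        castIx_symm_snd_fst, castIx_symm_snd_snd, e1]
    constructor
    · rintro ⟨h1, h2⟩
      simp only at h1 h2
      refine ⟨jn (u ∘ sndIx n (m + k) ∘ fstIx m k)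
        (jn (u ∘ fstIx n (m + k)) (u ∘ sndIx n (m + k) ∘ sndIx m k)), (key _).2 ?_, (key' _).2 ?_⟩
      · simp only [← Function.comp_assoc, jn_fstIx, jn_sndIx, and_self]
      · simp only [← Function.comp_assoc, jn_fstIx, jn_sndIx, h1, h2, and_self]
    · rintro ⟨b, h1, h2⟩
      obtain ⟨⟨h3, h4⟩, h5⟩ := (key b).1 h1
      obtain ⟨h6, h7, h8⟩ := (key' b).1 h2
      refine ⟨phase_ext ?_ ?_, ?_⟩
      · exact h6.symm.trans h3
      · exact h7.trans h5.symm
      · exact h8.trans h4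

end

section

variable {n m k : ℕ}

/-! ### The symplectic form -/

/-- The symplectic form `ω_n` as a bilinear form. -/
def omegaB (n : ℕ) : LinearMap.BilinForm ℂ (Phase n) :=
  LinearMap.mk₂ ℂ omega
    (fun u v w => by simp only [omega, Pi.add_apply, ← Finset.sum_add_distrib]; congr; ext; ring)
    (fun c u v => by simp only [omega, Pi.smul_apply, smul_eq_mul, Finset.mul_sum]; congr; ext; ring)
    (fun u v w => by simp only [omega, Pi.add_apply, ← Finset.sum_add_distrib]; congr; ext; ring)
    (fun c u v => by simp only [omega, Pi.smul_apply, smul_eq_mul, Finset.mul_sum]; congr; ext; ring)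

section
variable (u v w : Phase n)

theorem omega_add_left : omega (u + v) w = omega u w + omega v w := (omegaB n).map_add₂ u v w
theorem omega_add_right : omega u (v + w) = omega u v + omega u w := (omegaB n u).map_add v w
theorem omega_sub_left : omega (u - v) w = omega u w - omega v w := (omegaB n).map_sub₂ u v w
theorem omega_sub_right : omega u (v - w) = omega u v - omega u w := (omegaB n u).map_sub v w
theorem omega_smul_left (c : ℂ) : omega (c • u) w = c * omega u w := (omegaB n).map_smul₂ c u w
theorem omega_smul_right (c : ℂ) : omega u (c • w) = c * omega u w := (omegaB n u).map_smul c w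
@[simp] theorem omega_zero_right : omega w (0 : Phase n) = 0 := (omegaB n w).map_zero

theorem omega_swap : omega u v = -omega v u := by
  simp only [omega, ← Finset.sum_neg_distrib]; congr; ext; ring

theorem omega_star : omega (star u) (star v) = (starRingEnd ℂ) (omega u v) := by
  simp [omega]

end

theorem eq_zero_of_omega {u : Phase n} (h : ∀ v, omega u v = 0) : u = 0 := by
  ext i
  rcases i with i | i
  · simpa [omega, Pi.single_apply] using h (Pi.single (Sum.inr i) 1)
  · simpa [omega, Pi.single_apply] using h (Pi.single (Sum.inl i) 1)

theorem omega_sum (u v : Phase (n + m)) : omega u v =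
    omega (u ∘ fstIx n m) (v ∘ fstIx n m) + omega (u ∘ sndIx n m) (v ∘ sndIx n m) := by
  simp [omega, Fin.sum_univ_add, fstIx, sndIx]
  ring

/-- The form `ω_{n,m}` as a bilinear form. -/
def omegaB₂ (n m : ℕ) : LinearMap.BilinForm ℂ (Phase n × Phase m) :=
  (omegaB m).compl₁₂ (LinearMap.snd ℂ _ _) (LinearMap.snd ℂ _ _) -
    (omegaB n).compl₁₂ (LinearMap.fst ℂ _ _) (LinearMap.fst ℂ _ _)

theorem omegaB₂_apply (u v : Phase n × Phase m) : omegaB₂ n m u v = omega₂ u v := rfl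

section
variable (u v w : Phase n × Phase m)

theorem omega₂_add_left : omega₂ (u + v) w = omega₂ u w + omega₂ v w := (omegaB₂ n m).map_add₂ u v w
theorem omega₂_add_right : omega₂ u (v + w) = omega₂ u v + omega₂ u w := (omegaB₂ n m u).map_add v w
theorem omega₂_smul_left (c : ℂ) : omega₂ (c • u) w = c * omega₂ u w :=
  (omegaB₂ n m).map_smul₂ c u w
theorem omega₂_smul_right (c : ℂ) : omega₂ u (c • w) = c * omega₂ u w := (omegaB₂ n m u).map_smul c w

theorem omega₂_swap : omega₂ u v = -omega₂ v u := by
  rw [omega₂, omega₂, omega_swap, omega_swap u.1]; ring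

theorem omega₂_star : omega₂ (star u) (star v) = (starRingEnd ℂ) (omega₂ u v) := by
  rw [omega₂, omega₂, map_sub, ← omega_star, ← omega_star]; rfl

end

theorem eq_zero_of_omega₂ {u : Phase n × Phase m} (h : ∀ v, omega₂ u v = 0) : u = 0 := by
  refine Prod.ext (eq_zero_of_omega fun v => ?_) (eq_zero_of_omega fun v => ?_)
  · simpa [omega₂] using h (v, 0)
  · simpa [omega₂] using h (0, v)

theorem isRefl_omegaB₂ (n m : ℕ) : (omegaB₂ n m).IsRefl := fun u v h => by
  rw [omegaB₂_apply] at h ⊢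
  rw [omega₂_swap, h, neg_zero]

theorem nondegenerate_omegaB₂ (n m : ℕ) : (omegaB₂ n m).Nondegenerate :=
  ⟨fun u h => eq_zero_of_omega₂ h,
    fun u h => eq_zero_of_omega₂ fun v => by rw [omega₂_swap]; exact neg_eq_zero.2 (h v)⟩

theorem nondegenerate_omegaB (n : ℕ) : (omegaB n).Nondegenerate :=
  ⟨fun u h => eq_zero_of_omega h,
    fun u h => eq_zero_of_omega fun v => by rw [omega_swap]; exact neg_eq_zero.2 (h v)⟩

/-- By nondegeneracy dim L + dim L^⊥ is the full dimension, so an isotropic subspace has half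
dimension exactly when L = L^⊥. -/
theorem isLagrangian_iff {L : Submodule ℂ (Phase n × Phase m)} :
    IsLagrangian L ↔ ∀ v, v ∈ L ↔ ∀ w ∈ L, omega₂ v w = 0 := by
  have hfr := LinearMap.BilinForm.finrank_orthogonal (nondegenerate_omegaB₂ n m) L
  have hle := Submodule.finrank_le L
  have hmem : ∀ v, v ∈ (omegaB₂ n m).orthogonal L ↔ ∀ w ∈ L, omega₂ v w = 0 := fun v => by
    rw [LinearMap.BilinForm.mem_orthogonal_iff]
    refine forall₂_congr fun w _ => ?_
    change omega₂ w v = 0 ↔ _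
    rw [omega₂_swap, neg_eq_zero]
  constructor
  · rintro ⟨h1, h2⟩ v
    have : L = (omegaB₂ n m).orthogonal L := by
      refine Submodule.eq_of_le_of_finrank_eq (fun v hv => (hmem v).2 (h2 v hv)) ?_
      omega
    rw [← hmem, ← this]
  · intro h
    have : L = (omegaB₂ n m).orthogonal L := Submodule.ext fun v => (h v).trans (hmem v).symm
    refine ⟨?_, fun v hv => (h v).1 hv⟩
    rw [← this] at hfr
    omega

theorem IsLagrangian.mem {L : Submodule ℂ (Phase n × Phase m)} (hL : IsLagrangian L)
    {v : Phase n × Phase m} (h : ∀ w ∈ L, omega₂ v w = 0) : v ∈ L := (isLagrangian_iff.1 hL v).2 h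

/-- The Hermitian form `i ω(v̄, v)`. -/
def herm (v : Phase n) : ℝ := (I * omega (star v) v).re

theorem herm_eq (v : Phase n) : herm v =
    2 * ((star fun j => v (.inr j)) ⬝ᵥ (fun j => v (.inl j))).im := by
  have : I * omega (star v) v = I * ((starRingEnd ℂ) ((star fun j => v (.inr j)) ⬝ᵥ
      (fun j => v (.inl j))) - (star fun j => v (.inr j)) ⬝ᵥ (fun j => v (.inl j))) := by
    rw [star_dotProduct_eq, star_star]
    simp only [omega, dotProduct, ← Finset.sum_sub_distrib]
    congr 2; ext j; simp; ring
  rw [herm, this]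
  simp
  ring

theorem herm_sub_eq (v : Phase n × Phase m) :
    (I * omega₂ (star v) v).re = herm v.2 - herm v.1 := by
  rw [omega₂, mul_sub, Complex.sub_re]; rfl

theorem herm_zero : herm (0 : Phase n) = 0 := by simp [herm]

theorem herm_star (v : Phase n) : herm (star v) = -herm v := by
  rw [herm, herm, star_star, omega_swap]; simp

theorem herm_sum (v : Phase (n + m)) : herm v = herm (v ∘ fstIx n m) + herm (v ∘ sndIx n m) := by
  rw [herm, omega_sum, mul_add, Complex.add_re]; rfl

theorem eq_zero_of_forall_quadratic {b c : ℝ} (h : ∀ t : ℝ, 0 ≤ t * b + t ^ 2 * c) : b = 0 := by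
  by_contra hb
  -- A small step against the sign of b. The denominator exceeds c, so the linear term dominates and
  -- the value is negative unless b = 0.
  have h1 := h (-b / (|c| + 1))
  have hc : 0 < |c| + 1 := by positivity
  have h2 : -b / (|c| + 1) * b + (-b / (|c| + 1)) ^ 2 * c =
      -(b ^ 2 / (|c| + 1) ^ 2) * (|c| + 1 - c) := by field_simp; ring
  rw [h2] at h1
  have h3 : 0 < b ^ 2 / (|c| + 1) ^ 2 := by positivity
  have h4 : 0 < |c| + 1 - c := by linarith [le_abs_self c]
  nlinarith [mul_pos h3 h4]

/-- Null vectors of the positive Hermitian form on a Lagrangian are closed under conjugation. -/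
theorem star_mem_of_null {L : Submodule ℂ (Phase n × Phase m)} (hL : IsLagrangian L)
    (hp : IsPositive L) {v : Phase n × Phase m} (hv : v ∈ L)
    (h0 : (I * omega₂ (star v) v).re = 0) : star v ∈ L := by
  have him : ∀ w ∈ L, (omega₂ (star v) w).im = 0 := by
    intro w hw
    -- Positivity on v + tw, with v null, leaves a linear and a quadratic term in t, so the linear
    -- coefficient vanishes. Replacing w by iw later gives the real part of ω(v̄, w), and L = L^⊥
    -- finishes the argument.
    have h1 : ∀ t : ℝ, 0 ≤ t * (-2 * (omega₂ (star v) w).im) +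
        t ^ 2 * (I * omega₂ (star w) w).re := by
      intro t
      have h2 := hp (v + (t : ℂ) • w) (L.add_mem hv (L.smul_mem _ hw))
      have h3 : omega₂ (star w) v = -(starRingEnd ℂ) (omega₂ (star v) w) := by
        rw [← omega₂_star, star_star, omega₂_swap]
      have hst : star ((t : ℂ) • w) = (t : ℂ) • star w := by
        rw [star_smul]; simp
      rw [star_add, hst, omega₂_add_left, omega₂_add_right, omega₂_add_right, omega₂_smul_left,
        omega₂_smul_left, omega₂_smul_right, omega₂_smul_right, h3] at h2
      have h4 : (I * (omega₂ (star v) v + (t : ℂ) * omega₂ (star v) w +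
          ((t : ℂ) * -(starRingEnd ℂ) (omega₂ (star v) w) +
            (t : ℂ) * ((t : ℂ) * omega₂ (star w) w)))).re =
          (I * omega₂ (star v) v).re + (t * (-2 * (omega₂ (star v) w).im) +
        t ^ 2 * (I * omega₂ (star w) w).re) := by
        simp; ring
      rw [h4, h0, zero_add] at h2
      exact h2
    have := eq_zero_of_forall_quadratic h1
    linarith
  refine hL.mem fun w hw => Complex.ext ?_ (him w hw)
  have := him (I • w) (L.smul_mem _ hw)
  rw [omega₂_smul_right] at this
  simpa using this

/-- The complex conjugate of a subspace. -/
def conjSub (L : Submodule ℂ (Phase n × Phase m)) : Submodule ℂ (Phase n × Phase m) where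
  carrier := {v | star v ∈ L}
  add_mem' {u v} hu hv := by
    change star (u + v) ∈ L
    rw [star_add]; exact L.add_mem hu hv
  zero_mem' := by
    change star (0 : Phase n × Phase m) ∈ L
    rw [star_zero]; exact L.zero_mem
  smul_mem' c u hu := by
    change star (c • u) ∈ L
    rw [star_smul]; exact L.smul_mem _ hu

/-- A difference p - p̄ in L + L̄ can be removed by moving p inside its coset. Since L = L^⊥, the
orthogonal complement of L + L̄ is L ∩ L̄, so the hypothesis is exactly the condition p - p̄ ∈ L +
L̄. -/
theorem exists_real_translate {L : Submodule ℂ (Phase n × Phase m)} (hL : IsLagrangian L)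
    {p : Phase n × Phase m}
    (h : ∀ κ ∈ L, star κ ∈ L → omega₂ (p - star p) κ = 0) :
    ∃ v ∈ L, star (p - v) = p - v := by
  have h1 : p - star p ∈ L ⊔ conjSub L := by
    rw [← LinearMap.BilinForm.orthogonal_orthogonal (nondegenerate_omegaB₂ n m)
      (isRefl_omegaB₂ n m) (L ⊔ conjSub L), LinearMap.BilinForm.mem_orthogonal_iff]
    intro κ hκ
    rw [LinearMap.BilinForm.mem_orthogonal_iff] at hκ
    have hκ1 : κ ∈ L := hL.mem fun w hw => by
      rw [omega₂_swap, neg_eq_zero]; exact hκ w (Submodule.mem_sup_left hw)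
    have hκ2 : star κ ∈ L := hL.mem fun w hw => by
      have h2 : omega₂ (star w) κ = 0 := hκ (star w) (Submodule.mem_sup_right
        (show star (star w) ∈ L by rwa [star_star]))
      rw [omega₂_swap, neg_eq_zero, ← star_star w, omega₂_star, h2, map_zero]
    change omega₂ κ (p - star p) = 0
    rw [omega₂_swap, h κ hκ1 hκ2, neg_zero]
  obtain ⟨k₁, hk₁, k₂, hk₂, hk⟩ := Submodule.mem_sup.1 h1
  have hk₂' : star k₂ ∈ L := hk₂
  have hp : star p = p - (k₁ + k₂) := by rw [hk]; abel
  have hs : star k₁ + star k₂ = -(k₁ + k₂) := by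
    rw [← star_add, hk, star_sub, star_star]; abel
  -- Write p - p̄ = k₁ + k₂ with k₁ and the conjugate of k₂ in L. This sum is anti-invariant under
  -- conjugation, so v = (k₁ - k̄₂)/2 satisfies v - v̄ = p - p̄.
  refine ⟨(1 / 2 : ℂ) • (k₁ - star k₂), L.smul_mem _ (L.sub_mem hk₁ hk₂'), ?_⟩
  have e : star ((1 / 2 : ℂ) • (k₁ - star k₂)) = (1 / 2 : ℂ) • (star k₁ - k₂) := by
    rw [star_smul, star_sub, star_star]; simp
  rw [star_sub, e, hp]
  have e2 : star k₁ = -(k₁ + k₂) - star k₂ := by rw [← hs]; abel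
  rw [e2]
  module

theorem exists_ofRealVec {p : Phase n × Phase m} (h : star p = p) :
    ∃ (a : Ix n → ℝ) (b : Ix m → ℝ), p = (ofRealVec a, ofRealVec b) := by
  refine ⟨fun i => (p.1 i).re, fun i => (p.2 i).re, Prod.ext ?_ ?_⟩
  · ext i
    have := congrFun (congrArg Prod.fst h) i
    exact (Complex.conj_eq_iff_re.1 this).symm
  · ext i
    have := congrFun (congrArg Prod.snd h) i
    exact (Complex.conj_eq_iff_re.1 this).symm

theorem star_ofRealVec (a : Ix n → ℝ) : star (ofRealVec a) = ofRealVec a := by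
  ext i; simp [ofRealVec]

/-! ### Positive affine Lagrangian relations form a sub-prop -/

/-- Composition of linear relations. -/
def linComp (L' : Submodule ℂ (Phase m × Phase k)) (L : Submodule ℂ (Phase n × Phase m)) :
    Submodule ℂ (Phase n × Phase k) where
  carrier := {v | ∃ b, (v.1, b) ∈ L ∧ (b, v.2) ∈ L'}
  add_mem' := by
    rintro u v ⟨b, h1, h2⟩ ⟨c, h3, h4⟩
    exact ⟨b + c, L.add_mem h1 h3, L'.add_mem h2 h4⟩
  zero_mem' := ⟨0, L.zero_mem, L'.zero_mem⟩
  smul_mem' := by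
    rintro c u ⟨b, h1, h2⟩
    exact ⟨c • b, L.smul_mem c h1, L'.smul_mem c h2⟩

theorem finrank_map_add_finrank_inf_ker {V W : Type} [AddCommGroup V] [Module ℂ V]
    [FiniteDimensional ℂ V] [AddCommGroup W] [Module ℂ W] (f : V →ₗ[ℂ] W) (M : Submodule ℂ V) :
    Module.finrank ℂ (M.map f) + Module.finrank ℂ (M ⊓ LinearMap.ker f : Submodule ℂ V) =
      Module.finrank ℂ M := by
  have h := LinearMap.finrank_range_add_finrank_ker (f.domRestrict M)
  rw [LinearMap.range_domRestrict] at h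
  rw [← h]
  congr 1
  have e : (M ⊓ LinearMap.ker f : Submodule ℂ V) =
      (LinearMap.ker (f.domRestrict M)).map M.subtype := by
    ext x
    simp [and_comm]
  rw [e]
  exact (Submodule.equivMapOfInjective _ M.injective_subtype _).finrank_eq.symm

/-- Isotropy telescopes over the middle vector and bounds the dimension from above. For the lower
bound let r be the rank of the difference δ of middle components on L × L'. Its kernel there has
dimension (n + m) + (m + k) - r, and the part of that kernel which vanishes in the outer components
has dimension at most 2m - r, because its middle vectors are orthogonal to the image of δ. At least
n + k dimensions remain. -/
theorem isLagrangian_linComp {L' : Submodule ℂ (Phase m × Phase k)}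
    {L : Submodule ℂ (Phase n × Phase m)} (hL' : IsLagrangian L') (hL : IsLagrangian L) :
    IsLagrangian (linComp L' L) := by
  have hiso : ∀ v ∈ linComp L' L, ∀ w ∈ linComp L' L, omega₂ v w = 0 := by
    rintro v ⟨b, h1, h2⟩ w ⟨c, h3, h4⟩
    have e1 := hL.2 _ h1 _ h3
    have e2 := hL'.2 _ h2 _ h4
    simp only [omega₂] at e1 e2 ⊢
    linear_combination e1 + e2
  refine ⟨le_antisymm ?_ ?_, hiso⟩
  · have h1 := LinearMap.BilinForm.finrank_orthogonal (nondegenerate_omegaB₂ n k) (linComp L' L)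
    have h2 : linComp L' L ≤ (omegaB₂ n k).orthogonal (linComp L' L) := fun v hv => by
      rw [LinearMap.BilinForm.mem_orthogonal_iff]
      exact fun w hw => hiso w hw v hv
    have h3 := Submodule.finrank_mono h2
    have := Submodule.finrank_le (linComp L' L)
    omega
  · let δ : (Phase n × Phase m) × (Phase m × Phase k) →ₗ[ℂ] Phase m :=
      (LinearMap.snd ℂ (Phase n) (Phase m)).comp (LinearMap.fst ℂ _ _) -
        (LinearMap.fst ℂ (Phase m) (Phase k)).comp (LinearMap.snd ℂ _ _)
    let π : (Phase n × Phase m) × (Phase m × Phase k) →ₗ[ℂ] Phase n × Phase k :=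
      ((LinearMap.fst ℂ (Phase n) (Phase m)).comp (LinearMap.fst ℂ _ _)).prod
        ((LinearMap.snd ℂ (Phase m) (Phase k)).comp (LinearMap.snd ℂ _ _))
    let τ : (Phase n × Phase m) × (Phase m × Phase k) →ₗ[ℂ] Phase m :=
      (LinearMap.snd ℂ (Phase n) (Phase m)).comp (LinearMap.fst ℂ _ _)
    have hδ : ∀ x, x ∈ LinearMap.ker δ ↔ x.1.2 = x.2.1 := fun x => by
      rw [LinearMap.mem_ker]; exact sub_eq_zero
    have hπ : ∀ x, x ∈ LinearMap.ker π ↔ x.1.1 = 0 ∧ x.2.2 = 0 := fun x => by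
      rw [LinearMap.mem_ker]; exact Prod.ext_iff
    have h1 : Submodule.map π (L.prod L' ⊓ LinearMap.ker δ) ≤ linComp L' L := by
      rintro _ ⟨x, ⟨hx, hx'⟩, rfl⟩
      refine ⟨x.1.2, hx.1, ?_⟩
      rw [(hδ x).1 hx']
      exact hx.2
    have h2 : Submodule.map τ (L.prod L' ⊓ LinearMap.ker δ ⊓ LinearMap.ker π) ≤
        (omegaB m).orthogonal (Submodule.map δ (L.prod L')) := by
      rintro _ ⟨x, ⟨⟨hx, hx'⟩, hx''⟩, rfl⟩
      rw [LinearMap.BilinForm.mem_orthogonal_iff]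
      rintro _ ⟨y, hy, rfl⟩
      have h1 := hL.2 _ hy.1 _ hx.1
      have h2 := hL'.2 _ hy.2 _ hx.2
      change omega (y.1.2 - y.2.1) x.1.2 = 0
      rw [omega_sub_left]
      simp only [omega₂, ((hπ x).1 hx'').1, ((hπ x).1 hx'').2, ← (hδ x).1 hx',
        omega_zero_right] at h1 h2
      linear_combination h1 + h2
    have h3 : L.prod L' ⊓ LinearMap.ker δ ⊓ LinearMap.ker π ⊓ LinearMap.ker τ = ⊥ := by
      rw [Submodule.eq_bot_iff]
      rintro x ⟨⟨⟨-, hx⟩, hx'⟩, hx''⟩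
      have hb : x.1.2 = 0 := hx''
      exact Prod.ext (Prod.ext ((hπ x).1 hx').1 hb)
        (Prod.ext (((hδ x).1 hx).symm.trans hb) ((hπ x).1 hx').2)
    have d1 := finrank_map_add_finrank_inf_ker δ (L.prod L')
    have d2 := finrank_map_add_finrank_inf_ker π (L.prod L' ⊓ LinearMap.ker δ)
    have d3 := finrank_map_add_finrank_inf_ker τ (L.prod L' ⊓ LinearMap.ker δ ⊓ LinearMap.ker π)
    rw [h3, finrank_bot] at d3
    have d4 := LinearMap.BilinForm.finrank_orthogonal (nondegenerate_omegaB m)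
      (Submodule.map δ (L.prod L'))
    have d5 := Submodule.finrank_mono h1
    have d6 := Submodule.finrank_mono h2
    have d7 := Submodule.finrank_le (Submodule.map δ (L.prod L'))
    have d8 : Module.finrank ℂ (L.prod L') = Module.finrank ℂ L + Module.finrank ℂ L' := by
      rw [← Module.finrank_prod]
      let e : L.prod L' ≃ₗ[ℂ] L × L' :=
        { toFun := fun x => (⟨x.1.1, x.2.1⟩, ⟨x.1.2, x.2.2⟩)
          invFun := fun y => ⟨(y.1.1, y.2.1), y.1.2, y.2.2⟩
          map_add' := fun _ _ => rfl
          map_smul' := fun _ _ => rfl }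
      exact e.finrank_eq
    have d9 := hL.1
    have d10 := hL'.1
    simp only [Module.finrank_prod, Module.finrank_fintype_fun_eq_card, Fintype.card_sum,
      Fintype.card_fin] at *
    omega

theorem isPositive_linComp {L' : Submodule ℂ (Phase m × Phase k)}
    {L : Submodule ℂ (Phase n × Phase m)} (hL' : IsPositive L') (hL : IsPositive L) :
    IsPositive (linComp L' L) := by
  rintro v ⟨b, h1, h2⟩
  have e1 := hL _ h1
  have e2 := hL' _ h2
  rw [herm_sub_eq] at *
  simp only at *
  linarith

/-- The linear part is the composite of the linear parts. What needs proof is a real point, obtained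
from `exists_real_translate` at an arbitrary point of the composite. -/
theorem isPosAffLag_relComp {S : Set (Phase m × Phase k)} {R : Set (Phase n × Phase m)}
    (hS : IsPosAffLag S) (hR : IsPosAffLag R) : IsPosAffLag (relComp S R) := by
  rcases Set.eq_empty_or_nonempty (relComp S R) with h | ⟨⟨u₀, w₀⟩, y₀, hu, hw⟩
  · exact Or.inl h
  rcases hS with rfl | ⟨L', b', c, hL', hp', rfl⟩
  · exact absurd hw (by simp)
  rcases hR with rfl | ⟨L, a, b, hL, hp, rfl⟩
  · exact absurd hu (by simp)
  have hu : (u₀ - ofRealVec a, y₀ - ofRealVec b) ∈ L := hu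
  have hw : (y₀ - ofRealVec b', w₀ - ofRealVec c) ∈ L' := hw
  -- If κ and its conjugate both lie in the linear part, then pairing a point of the affine relation
  -- and its conjugate with κ shows that ω(p - p̄, κ) has equal values at source and target. The two
  -- factors can then be chained.
  have hd : ∀ {N M : ℕ} {K : Submodule ℂ (Phase N × Phase M)} (_ : IsLagrangian K) {u : Phase N}
      {v : Phase M} (a : Ix N → ℝ) (b : Ix M → ℝ) {κ : Phase N × Phase M}
      (_ : (u - ofRealVec a, v - ofRealVec b) ∈ K) (_ : κ ∈ K) (_ : star κ ∈ K),
      omega (v - star v) κ.2 = omega (u - star u) κ.1 := by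
    intro N M K hK u v a b κ h1 h2 h3
    have e1 := hK.2 _ h1 _ h2
    have e2 := hK.2 _ h1 _ h3
    have e3 : omega₂ (star (u - ofRealVec a, v - ofRealVec b)) κ = 0 := by
      have := omega₂_star (u - ofRealVec a, v - ofRealVec b) (star κ)
      rw [star_star] at this
      rw [this, e2, map_zero]
    have e4 : star (u - ofRealVec a, v - ofRealVec b) =
        (star u - ofRealVec a, star v - ofRealVec b) := by
      ext1
      · change star (u - ofRealVec a) = _; rw [star_sub, star_ofRealVec]
      · change star (v - ofRealVec b) = _; rw [star_sub, star_ofRealVec]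
    rw [e4] at e3
    simp only [omega₂, omega_sub_left] at e1 e3 ⊢
    linear_combination e1 - e3
  obtain ⟨v, hv, hr⟩ := exists_real_translate (isLagrangian_linComp hL' hL) (p := (u₀, w₀)) (by
    rintro ⟨u, w⟩ ⟨y, h1, h2⟩ ⟨y', h3, h4⟩
    change (star u, y') ∈ L at h3
    change (y', star w) ∈ L' at h4
    simp only at h1 h2
    have e1 := hL.2 _ h3 _ h1
    have e2 := hL'.2 _ h4 _ h2
    have q1 := hp _ h1
    have q2 := hp' _ h2
    -- The vector (u, w) and its conjugate may be joined through unrelated middle vectors y and y'.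
    -- Isotropy applied to these pairs still equates the Hermitian forms of u and w. Hence both
    -- factor inequalities are equalities, and the two halves through y are null.
    have q3 : herm w = herm u := by
      simp only [omega₂] at e1 e2
      rw [herm, herm, show omega (star w) w = omega (star u) u by linear_combination e1 + e2]
    rw [herm_sub_eq] at q1 q2
    simp only at q1 q2
    have s1 := star_mem_of_null hL hp h1 (by rw [herm_sub_eq]; simp only; linarith)
    have s2 := star_mem_of_null hL' hp' h2 (by rw [herm_sub_eq]; simp only; linarith)
    have r1 := hd hL a b hu h1 s1
    have r2 := hd hL' b' c hw h2 s2
    change omega (w₀ - star w₀) w - omega (u₀ - star u₀) u = 0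
    simp only at r1 r2
    rw [r2, r1, sub_self])
  obtain ⟨a', c', hac⟩ := exists_ofRealVec hr
  refine Or.inr ⟨linComp L' L, a', c', isLagrangian_linComp hL' hL, isPositive_linComp hp' hp, ?_⟩
  ext ⟨x, z⟩
  rw [← hac]
  obtain ⟨vb, hv1, hv2⟩ := hv
  constructor
  · rintro ⟨y, h1, h2⟩
    -- The real base point is (u₀, w₀) - v, and v passes through the middle vector vb, so middle
    -- points are compared with y₀ - vb.
    refine ⟨y - y₀ + vb, ?_, ?_⟩
    · have := L.add_mem (L.sub_mem h1 hu) hv1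
      convert this using 1
      ext1
      · simp; abel
      · simp
    · have := L'.add_mem (L'.sub_mem h2 hw) hv2
      convert this using 1
      ext1
      · simp
      · simp; abel
  · rintro ⟨y, h1, h2⟩
    refine ⟨y + y₀ - vb, ?_, ?_⟩
    · have := L.sub_mem (L.add_mem h1 hu) hv1
      change (x - ofRealVec a, y + y₀ - vb - ofRealVec b) ∈ L
      convert this using 1
      ext1
      · simp; abel
      · simp; abel
    · have := L'.sub_mem (L'.add_mem h2 hw) hv2
      change (y + y₀ - vb - ofRealVec b', z - ofRealVec c) ∈ L'
      convert this using 1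
      ext1
      · simp; abel
      · simp; abel

/-- The graph of an affine real symplectomorphism is a positive affine Lagrangian relation. -/
theorem isPosAffLag_graph (f : Phase n →ₗ[ℂ] Phase m) (hf : Function.Surjective f)
    (hω : ∀ u v, omega (f u) (f v) = omega u v) (hr : ∀ u, f (star u) = star (f u))
    (d : Ix m → ℝ) : IsPosAffLag {v : Phase n × Phase m | v.2 = f v.1 + ofRealVec d} := by
  refine Or.inr ⟨f.graph, 0, d, isLagrangian_iff.2 fun v => ?_, fun v hv => ?_, ?_⟩
  · constructor
    · intro hv w hw
      rw [LinearMap.mem_graph_iff] at hv hw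
      rw [omega₂, hv, hw, hω, sub_self]
    · intro h
      rw [LinearMap.mem_graph_iff, ← sub_eq_zero]
      refine eq_zero_of_omega fun w => ?_
      obtain ⟨u, rfl⟩ := hf w
      have := h (u, f u) (by rw [LinearMap.mem_graph_iff])
      rw [omega_sub_left, hω]
      exact this
  · rw [LinearMap.mem_graph_iff] at hv
    rw [herm_sub_eq, hv, herm, herm, ← hr, hω, sub_self]
  · ext v
    have : ofRealVec (0 : Ix n → ℝ) = 0 := by ext; simp [ofRealVec]
    change _ ↔ v - _ ∈ f.graph
    rw [LinearMap.mem_graph_iff, this]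
    simp [sub_eq_iff_eq_add]

theorem isPosAffLag_relSum {n m n' m' : ℕ} {R : Set (Phase n × Phase m)}
    {S : Set (Phase n' × Phase m')} (hR : IsPosAffLag R) (hS : IsPosAffLag S) :
    IsPosAffLag (relSum R S) := by
  rcases hR with rfl | ⟨L, a, b, hL, hp, rfl⟩
  · exact Or.inl (by ext; simp [relSum])
  rcases hS with rfl | ⟨L', a', b', hL', hp', rfl⟩
  · exact Or.inl (by ext; simp [relSum])
  let K : Submodule ℂ (Phase (n + n') × Phase (m + m')) :=
    { carrier := {v | (v.1 ∘ fstIx n n', v.2 ∘ fstIx m m') ∈ L ∧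
        (v.1 ∘ sndIx n n', v.2 ∘ sndIx m m') ∈ L'}
      add_mem' := fun h h' => ⟨L.add_mem h.1 h'.1, L'.add_mem h.2 h'.2⟩
      zero_mem' := ⟨L.zero_mem, L'.zero_mem⟩
      smul_mem' := fun c _ h => ⟨L.smul_mem c h.1, L'.smul_mem c h.2⟩ }
  have hω : ∀ v w : Phase (n + n') × Phase (m + m'), omega₂ v w =
      omega₂ (v.1 ∘ fstIx n n', v.2 ∘ fstIx m m') (w.1 ∘ fstIx n n', w.2 ∘ fstIx m m') +
      omega₂ (v.1 ∘ sndIx n n', v.2 ∘ sndIx m m') (w.1 ∘ sndIx n n', w.2 ∘ sndIx m m') := by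
    intro v w
    simp only [omega₂, omega_sum v.1, omega_sum v.2]; ring
  refine Or.inr ⟨K, Sum.elim (Fin.append (a ∘ Sum.inl) (a' ∘ Sum.inl))
    (Fin.append (a ∘ Sum.inr) (a' ∘ Sum.inr)), Sum.elim (Fin.append (b ∘ Sum.inl) (b' ∘ Sum.inl))
    (Fin.append (b ∘ Sum.inr) (b' ∘ Sum.inr)), isLagrangian_iff.2 fun v => ⟨?_, ?_⟩, ?_, ?_⟩
  · rintro hv w hw
    rw [hω, hL.2 _ hv.1 _ hw.1, hL'.2 _ hv.2 _ hw.2, add_zero]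
  · intro h
    refine ⟨hL.mem fun w hw => ?_, hL'.mem fun w hw => ?_⟩
    · have := h (jn w.1 0, jn w.2 0) ⟨by simpa using hw, by simp only [jn_sndIx]; exact L'.zero_mem⟩
      rw [hω] at this
      simpa [omega₂] using this
    · have := h (jn 0 w.1, jn 0 w.2) ⟨by simp only [jn_fstIx]; exact L.zero_mem, by simpa using hw⟩
      rw [hω] at this
      simpa [omega₂] using this
  · intro v hv
    have h1 := hp _ hv.1
    have h2 := hp' _ hv.2
    rw [hω, mul_add, Complex.add_re]
    exact add_nonneg h1 h2
  · have e : ∀ {N M : ℕ} (a : Ix N → ℝ) (a' : Ix M → ℝ),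
        ofRealVec (Sum.elim (Fin.append (a ∘ Sum.inl) (a' ∘ Sum.inl))
          (Fin.append (a ∘ Sum.inr) (a' ∘ Sum.inr))) = jn (ofRealVec a) (ofRealVec a') := by
      intro N M a a'
      refine phase_ext ?_ ?_
      · rw [jn_fstIx]
        ext i; rcases i with i | i <;> simp [ofRealVec, fstIx]
      · rw [jn_sndIx]
        ext i; rcases i with i | i <;> simp [ofRealVec, sndIx]
    ext v
    rw [e, e]
    change _ ↔ (_ ∈ L ∧ _ ∈ L')
    have s1 : ∀ {N M : ℕ} (u : Phase (N + M)) (a : Phase N) (a' : Phase M),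
        (u - jn a a') ∘ fstIx N M = u ∘ fstIx N M - a := by
      intro N M u a a'
      conv_rhs => rw [← jn_fstIx a a']
      rfl
    have s2 : ∀ {N M : ℕ} (u : Phase (N + M)) (a : Phase N) (a' : Phase M),
        (u - jn a a') ∘ sndIx N M = u ∘ sndIx N M - a' := by
      intro N M u a a'
      conv_rhs => rw [← jn_sndIx a a']
      rfl
    simp only [Prod.fst_sub, Prod.snd_sub, s1, s2]
    rfl

theorem isPosAffLag_relId (n : ℕ) : IsPosAffLag (relId n) := by
  convert isPosAffLag_graph (LinearMap.id (R := ℂ) (M := Phase n)) Function.surjective_id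
    (fun _ _ => rfl) (fun _ => rfl) 0 using 1
  ext v
  have : ofRealVec (0 : Ix n → ℝ) = 0 := by ext; simp [ofRealVec]
  simp [relId, this, eq_comm]

theorem isPosAffLag_relSwap (n m : ℕ) : IsPosAffLag (relSwap n m) := by
  let f : Phase (n + m) →ₗ[ℂ] Phase (m + n) :=
    { toFun := fun u => jn (u ∘ sndIx n m) (u ∘ fstIx n m)
      map_add' := fun u v => phase_ext
        (by simp [funext_iff, jn, fstIx]) (by simp [funext_iff, jn, sndIx])
      map_smul' := fun c u => phase_ext
        (by simp [funext_iff, jn, fstIx]) (by simp [funext_iff, jn, sndIx]) }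
  have hf : ∀ u, f u = jn (u ∘ sndIx n m) (u ∘ fstIx n m) := fun u => rfl
  convert isPosAffLag_graph f (fun w => ⟨jn (w ∘ sndIx m n) (w ∘ fstIx m n), by
    rw [hf, jn_sndIx, jn_fstIx, jn_eta]⟩) (fun u v => ?_) (fun u => ?_) 0 using 1
  · ext v
    have : ofRealVec (0 : Ix (m + n) → ℝ) = 0 := by ext; simp [ofRealVec]
    rw [this]
    simp only [relSwap, Set.mem_ofPred_eq, add_zero, hf]
    constructor
    · rintro ⟨h1, h2⟩; exact phase_ext (by rw [h1, jn_fstIx]) (by rw [h2, jn_sndIx])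
    · intro h; rw [h]; simp
  · rw [hf, hf, omega_sum, jn_fstIx, jn_fstIx, jn_sndIx, jn_sndIx, omega_sum u v, add_comm]
  · rw [hf, hf]
    refine phase_ext ?_ ?_
    · rw [jn_fstIx]
      change star (u ∘ sndIx n m) = star (jn (u ∘ sndIx n m) (u ∘ fstIx n m) ∘ fstIx m n)
      rw [jn_fstIx]
    · rw [jn_sndIx]
      change star (u ∘ fstIx n m) = star (jn (u ∘ sndIx n m) (u ∘ fstIx n m) ∘ sndIx m n)
      rw [jn_sndIx]

theorem alrPlusIsSubprop : ALRPlusIsSubprop where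
  id := isPosAffLag_relId
  swap := isPosAffLag_relSwap
  comp S R := isPosAffLag_relComp S.2 R.2
  sum R S := isPosAffLag_relSum R.2 S.2

end

section

variable {n m k : ℕ}

/-! ### Affine Lagrangian subspaces of Gaussian vectors -/

/-- The momentum part of a vector in phase space. -/
def zc (v : Phase n) : Fin n → ℂ := fun j => v (.inl j)

/-- The position part of a vector in phase space. -/
def xc (v : Phase n) : Fin n → ℂ := fun j => v (.inr j)

@[simp] theorem zc_elim (z x : Fin n → ℂ) : zc (Sum.elim z x) = z := rfl
@[simp] theorem xc_elim (z x : Fin n → ℂ) : xc (Sum.elim z x) = x := rfl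

theorem zx_ext {u v : Phase n} (h₁ : zc u = zc v) (h₂ : xc u = xc v) : u = v := by
  ext i
  rcases i with i | i
  · exact congrFun h₁ i
  · exact congrFun h₂ i

theorem omega_eq (u v : Phase n) : omega u v = zc u ⬝ᵥ xc v - xc u ⬝ᵥ zc v := by
  simp [omega, zc, xc, dotProduct]

theorem herm_eq' (v : Phase n) : herm v = 2 * (star (xc v) ⬝ᵥ zc v).im := herm_eq v

/-- The affine Lagrangian subspace `z = Φ x - i b` of the Gaussian vector `gv Φ b`. -/
def lag (Φ : Matrix (Fin n) (Fin n) ℂ) (b : Fin n → ℂ) : Set (Phase n) :=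
  {v | zc v = Φ *ᵥ xc v - I • b}

theorem mem_lag {Φ : Matrix (Fin n) (Fin n) ℂ} {b : Fin n → ℂ} {v : Phase n} :
    v ∈ lag Φ b ↔ zc v = Φ *ᵥ xc v - I • b := Iff.rfl

theorem lag_injective {Φ Φ' : Matrix (Fin n) (Fin n) ℂ} {b b' : Fin n → ℂ}
    (h : lag Φ b = lag Φ' b') : Φ = Φ' ∧ b = b' := by
  have h1 : ∀ x, Φ *ᵥ x - I • b = Φ' *ᵥ x - I • b' := fun x => by
    have : Sum.elim (Φ *ᵥ x - I • b) x ∈ lag Φ b := rfl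
    rw [h] at this
    exact this
  have hb : b = b' := by
    have := h1 0
    simp only [mulVec_zero, zero_sub, neg_inj] at this
    exact smul_right_injective _ I_ne_zero this
  refine ⟨?_, hb⟩
  subst hb
  ext i j
  have := congrFun (sub_left_injective (h1 (Pi.single j 1))) i
  simpa using this

/-- Every vector in phase space lies in the affine Lagrangian of some Gaussian vector. -/
theorem mem_lag_self (Φ : Matrix (Fin n) (Fin n) ℂ) (v : Phase n) :
    v ∈ lag Φ (I • (zc v - Φ *ᵥ xc v)) := by
  rw [mem_lag, smul_smul, I_mul_I]; simp

theorem mem_lag_iff {Φ : Matrix (Fin n) (Fin n) ℂ} {b : Fin n → ℂ} {v : Phase n} :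
    v ∈ lag Φ b ↔ I • (zc v - Φ *ᵥ xc v) = b := by
  constructor
  · intro h
    rw [mem_lag.1 h, sub_sub_cancel_left, smul_neg, smul_smul, I_mul_I]; simp
  · rintro rfl; exact mem_lag_self Φ v

/-- For x = r + is the cross terms cancel by symmetry of Φ. This passes between positivity of Im Φ
on real vectors and positivity of the Hermitian form on complex ones. -/
theorem im_star_dotProduct {Φ : Matrix (Fin n) (Fin n) ℂ} (hs : Φ.IsSymm) (x : Fin n → ℂ) :
    (star x ⬝ᵥ Φ *ᵥ x).im = (fun i => (x i).re) ⬝ᵥ (Φ.map Complex.im) *ᵥ (fun i => (x i).re) +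
      (fun i => (x i).im) ⬝ᵥ (Φ.map Complex.im) *ᵥ (fun i => (x i).im) := by
  set r : Fin n → ℝ := fun i => (x i).re
  set s : Fin n → ℝ := fun i => (x i).im
  have hx : x = cvec r + I • cvec s := by
    ext i; simp [cvec, r, s, mul_comm I, Complex.re_add_im]
  have hsx : star x = cvec r - I • cvec s := by
    rw [hx, star_add, star_smul, star_cvec, star_cvec]; simp [sub_eq_add_neg]
  have hΦ : ∀ u w : Fin n → ℝ, cvec u ⬝ᵥ Φ *ᵥ cvec w =
      ((u ⬝ᵥ (Φ.map Complex.re) *ᵥ w : ℝ) : ℂ) + I * ((u ⬝ᵥ (Φ.map Complex.im) *ᵥ w : ℝ) : ℂ) := by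
    intro u w
    conv_lhs => rw [cmat_re_add_im Φ, add_mulVec, smul_mulVec, cmat_mulVec, cmat_mulVec,
      dotProduct_add, dotProduct_smul, cvec_dotProduct, cvec_dotProduct, smul_eq_mul]
  have hsymm : cvec r ⬝ᵥ Φ *ᵥ cvec s = cvec s ⬝ᵥ Φ *ᵥ cvec r := by
    rw [dotProduct_comm, mulVec_dotProduct_eq, hs.eq]
  rw [hsx, hx, mulVec_add, mulVec_smul, sub_dotProduct, dotProduct_add, dotProduct_add,
    smul_dotProduct, smul_dotProduct, dotProduct_smul, dotProduct_smul, hsymm, hΦ, hΦ, hΦ]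
  simp
  ring

theorem IsPhaseMatrix.im_nonneg {Φ : Matrix (Fin n) (Fin n) ℂ} (hΦ : IsPhaseMatrix Φ)
    (x : Fin n → ℂ) : 0 ≤ (star x ⬝ᵥ Φ *ᵥ x).im := by
  rw [im_star_dotProduct hΦ.1]
  have h := fun y : Fin n → ℝ => hΦ.2.posSemidef.dotProduct_mulVec_nonneg y
  simp only [star_trivial] at h
  exact add_nonneg (h _) (h _)

theorem IsPhaseMatrix.im_pos {Φ : Matrix (Fin n) (Fin n) ℂ} (hΦ : IsPhaseMatrix Φ)
    {x : Fin n → ℂ} (hx : x ≠ 0) : 0 < (star x ⬝ᵥ Φ *ᵥ x).im := by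
  rw [im_star_dotProduct hΦ.1]
  have h := fun y : Fin n → ℝ => hΦ.2.posSemidef.dotProduct_mulVec_nonneg y
  have h' := fun (y : Fin n → ℝ) (hy : y ≠ 0) => hΦ.2.dotProduct_mulVec_pos hy
  simp only [star_trivial] at h h'
  by_cases h0 : (fun i => (x i).re) = 0
  · refine add_pos_of_nonneg_of_pos (h _) (h' _ fun h1 => hx ?_)
    ext i
    exact Complex.ext (congrFun h0 i) (congrFun h1 i)
  · exact add_pos_of_pos_of_nonneg (h' _ h0) (h _)

theorem isPhaseMatrix_of_im_pos {Φ : Matrix (Fin n) (Fin n) ℂ} (hs : Φ.IsSymm)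
    (h : ∀ x : Fin n → ℂ, x ≠ 0 → 0 < (star x ⬝ᵥ Φ *ᵥ x).im) : IsPhaseMatrix Φ := by
  refine ⟨hs, PosDef.of_dotProduct_mulVec_pos ?_ fun x hx => ?_⟩
  · rw [Matrix.IsHermitian, conjTranspose_eq_transpose_of_trivial, ← transpose_map, hs.eq]
  · have := h (cvec x) (fun h0 => hx (by
      ext i; simpa [cvec] using congrFun h0 i))
    rw [im_star_dotProduct hs] at this
    simpa [cvec, dotProduct, mulVec] using this

theorem sub_zc (u v : Phase n) : zc (u - v) = zc u - zc v := rfl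
theorem sub_xc (u v : Phase n) : xc (u - v) = xc u - xc v := rfl

theorem zc_sub_of_mem_lag {Φ : Matrix (Fin n) (Fin n) ℂ} {b : Fin n → ℂ} {u v : Phase n}
    (hu : u ∈ lag Φ b) (hv : v ∈ lag Φ b) : zc (u - v) = Φ *ᵥ xc (u - v) := by
  rw [sub_zc, sub_xc, mem_lag.1 hu, mem_lag.1 hv, mulVec_sub]; abel

theorem herm_sub_nonneg {Φ : Matrix (Fin n) (Fin n) ℂ} (hΦ : IsPhaseMatrix Φ) {b : Fin n → ℂ}
    {u v : Phase n} (hu : u ∈ lag Φ b) (hv : v ∈ lag Φ b) : 0 ≤ herm (u - v) := by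
  rw [herm_eq', zc_sub_of_mem_lag hu hv]
  have := hΦ.im_nonneg (xc (u - v))
  linarith

/-- The form is strictly positive on directions z = Φx. This rigidity turns an inequality between
Hermitian forms into an equality of points wherever uniqueness is needed. -/
theorem eq_of_herm_sub {Φ : Matrix (Fin n) (Fin n) ℂ} (hΦ : IsPhaseMatrix Φ) {b : Fin n → ℂ}
    {u v : Phase n} (hu : u ∈ lag Φ b) (hv : v ∈ lag Φ b) (h : herm (u - v) ≤ 0) : u = v := by
  rw [herm_eq', zc_sub_of_mem_lag hu hv] at h
  have hx : xc (u - v) = 0 := by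
    by_contra hx
    have := hΦ.im_pos hx
    linarith
  have hz := zc_sub_of_mem_lag hu hv
  rw [hx, mulVec_zero] at hz
  exact sub_eq_zero.1 (zx_ext hz hx)

/-- Points of phase space as a relation `0 → n`. -/
def lagRel (A : Set (Phase n)) : Set (Phase 0 × Phase n) := {v | v.2 ∈ A}

theorem stateRel_eq (Φ : Matrix (Fin n) (Fin n) ℂ) (s t : Fin n → ℝ) :
    stateRel Φ s t = lagRel (lag Φ (lin Φ s t)) := by
  ext v
  change (zc v.2 - cvec s = Φ *ᵥ (xc v.2 - cvec t)) ↔ zc v.2 = _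
  rw [lin, smul_smul, I_mul_I, mulVec_sub]
  constructor
  · intro h; rw [sub_eq_iff_eq_add.1 h]; module
  · intro h; rw [h]; module

/-- The image of a set under a relation. -/
def relImage (R : Set (Phase n × Phase m)) (A : Set (Phase n)) : Set (Phase m) :=
  {v | ∃ u ∈ A, (u, v) ∈ R}

theorem relImage_relComp (S : Set (Phase m × Phase k)) (R : Set (Phase n × Phase m))
    (A : Set (Phase n)) : relImage (relComp S R) A = relImage S (relImage R A) := by
  ext w
  constructor
  · rintro ⟨u, hu, v, h1, h2⟩; exact ⟨v, ⟨u, hu, h1⟩, h2⟩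
  · rintro ⟨v, ⟨u, hu, h1⟩, h2⟩; exact ⟨u, hu, v, h1, h2⟩

theorem isPosAffLag_lagRel {Φ : Matrix (Fin n) (Fin n) ℂ} (hΦ : IsPhaseMatrix Φ) (b : Fin n → ℂ) :
    IsPosAffLag (lagRel (lag Φ b)) := by
  obtain ⟨s, t, rfl⟩ := exists_lin_eq hΦ b
  let L : Submodule ℂ (Phase 0 × Phase n) :=
    { carrier := {v | zc v.2 = Φ *ᵥ xc v.2}
      add_mem' := fun {u v} hu hv => by
        change zc u.2 + zc v.2 = Φ *ᵥ (xc u.2 + xc v.2)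
        rw [mulVec_add, ← hu, ← hv]
      zero_mem' := (mulVec_zero Φ).symm
      smul_mem' := fun c u hu => by
        change c • zc u.2 = Φ *ᵥ (c • xc u.2)
        rw [mulVec_smul, ← hu] }
  have h0 : ∀ u v : Phase 0, omega u v = 0 := fun u v => by simp [omega]
  refine Or.inr ⟨L, 0, Sum.elim s t, isLagrangian_iff.2 fun v => ⟨fun hv w hw => ?_, fun h => ?_⟩,
    fun v hv => ?_, ?_⟩
  · have hv : zc v.2 = Φ *ᵥ xc v.2 := hv
    have hw : zc w.2 = Φ *ᵥ xc w.2 := hw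
    rw [omega₂, h0, sub_zero, omega_eq, hv, hw, mulVec_dotProduct_eq, hΦ.1.eq, sub_self]
  · have h1 : ∀ x, (zc v.2 - Φ *ᵥ xc v.2) ⬝ᵥ x = 0 := fun x => by
      have := h (0, Sum.elim (Φ *ᵥ x) x) rfl
      rw [omega₂, h0, sub_zero, omega_eq, zc_elim, xc_elim] at this
      rw [sub_dotProduct, mulVec_dotProduct_eq, hΦ.1.eq, this]
    exact sub_eq_zero.1 (dotProduct_eq_zero _ h1)
  · have hv : zc v.2 = Φ *ᵥ xc v.2 := hv
    have h1 : herm v.1 = 0 := by rw [herm, h0]; simp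
    rw [herm_sub_eq, h1, sub_zero, herm_eq', hv]
    have := hΦ.im_nonneg (xc v.2)
    linarith
  · ext v
    rw [← stateRel_eq]
    rfl

/-- Differences lose the real translation and lie in the positive linear part. -/
theorem IsPosAffLag.herm_sub_le {R : Set (Phase n × Phase m)} (hR : IsPosAffLag R) {u u' : Phase n}
    {v v' : Phase m} (h : (u, v) ∈ R) (h' : (u', v') ∈ R) : herm (u - u') ≤ herm (v - v') := by
  rcases hR with rfl | ⟨L, a, b, hL, hp, rfl⟩
  · exact absurd h (by simp)
  have h1 := hp _ (L.sub_mem h h')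
  rw [herm_sub_eq] at h1
  simpa using h1

/-- Strictly positive affine Lagrangians are those of Gaussian vectors. -/
theorem exists_lag_eq {A : Set (Phase n)} (hA : IsPosAffLag (lagRel A)) (hne : A.Nonempty)
    (hst : ∀ u ∈ A, ∀ v ∈ A, herm (u - v) ≤ 0 → u = v) :
    ∃ Φ b, IsPhaseMatrix Φ ∧ A = lag Φ b := by
  obtain ⟨p, hp⟩ := hne
  have hne' : (0, p) ∈ lagRel A := hp
  rcases hA with h | ⟨L, a, b, hL, hpos, hA⟩
  · rw [h] at hne'; exact absurd hne' (by simp)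
  have h0 : ∀ u v : Phase 0, omega u v = 0 := fun u v => by simp [omega]
  have hmem : ∀ v : Phase n, v ∈ A ↔ (0, v - p) ∈ L := fun v => by
    have e1 : v ∈ A ↔ (0, v) ∈ lagRel A := Iff.rfl
    rw [hA] at hne' e1
    have hne' : ((0 : Phase 0), p) - (ofRealVec a, ofRealVec b) ∈ L := hne'
    have e1 : v ∈ A ↔ ((0 : Phase 0), v) - (ofRealVec a, ofRealVec b) ∈ L := e1
    rw [e1, ← L.sub_mem_iff_left hne']
    simp
  have hherm : ∀ v : Phase n, ((0 : Phase 0), v) ∈ L → herm v ≤ 0 → v = 0 := fun v hv h => by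
    have h1 : v + p ∈ A := by rw [hmem, add_sub_cancel_right]; exact hv
    have := hst _ h1 _ hp (by rwa [add_sub_cancel_right])
    simpa using this
  let π : L →ₗ[ℂ] (Fin n → ℂ) :=
    (LinearMap.funLeft ℂ ℂ (Sum.inr : Fin n → Ix n)).comp ((LinearMap.snd ℂ _ _).comp L.subtype)
  have hπ : ∀ v, π v = xc v.1.2 := fun v => rfl
  have hL0 : ∀ v : L, ((0 : Phase 0), v.1.2) ∈ L := fun v => by
    have : v.1 = (0, v.1.2) := Prod.ext (Subsingleton.elim _ _) rfl
    rw [← this]; exact v.2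
  -- A direction with zero position has Hermitian form 0, hence vanishes by strictness. By dimension
  -- the subspace is a graph over the positions; isotropy makes its matrix symmetric and strictness
  -- makes the imaginary part positive.
  have hinj : Function.Injective π := by
    rw [← LinearMap.ker_eq_bot, LinearMap.ker_eq_bot']
    intro v hv
    rw [hπ] at hv
    have h2 := hherm _ (hL0 v) (by rw [herm_eq', hv]; simp)
    exact Subtype.ext (Prod.ext (Subsingleton.elim _ _) h2)
  have hfr : Module.finrank ℂ L = Module.finrank ℂ (Fin n → ℂ) := by
    have := hL.1
    simp only [Module.finrank_prod, Module.finrank_fintype_fun_eq_card, Fintype.card_sum,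
      Fintype.card_fin] at this ⊢
    omega
  let e := LinearEquiv.ofInjectiveOfFinrankEq π hinj hfr
  have he : ∀ v, e v = xc v.1.2 := fun v => rfl
  let g : (Fin n → ℂ) →ₗ[ℂ] (Fin n → ℂ) :=
    (LinearMap.funLeft ℂ ℂ (Sum.inl : Fin n → Ix n)).comp
      ((LinearMap.snd ℂ _ _).comp (L.subtype.comp e.symm.toLinearMap))
  set Φ := LinearMap.toMatrix' g with hΦdef
  have hΦ : ∀ x, Φ *ᵥ x = zc (e.symm x).1.2 := fun x => by
    rw [hΦdef, LinearMap.toMatrix'_mulVec]; rfl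
  have hxe : ∀ x, xc (e.symm x).1.2 = x := fun x => by rw [← he, e.apply_symm_apply]
  have hLmem : ∀ v : Phase n, ((0 : Phase 0), v) ∈ L ↔ zc v = Φ *ᵥ xc v := by
    intro v
    constructor
    · intro hv
      have : e.symm (xc v) = ⟨(0, v), hv⟩ := by
        rw [LinearEquiv.symm_apply_eq, he]
      rw [hΦ, this]
    · intro hv
      have : v = (e.symm (xc v)).1.2 := zx_ext (by rw [hv, hΦ]) (by rw [hxe])
      rw [this]
      exact hL0 _
  have hsymm : Φ.IsSymm := by
    have h1 : ∀ x y, (Φ *ᵥ x) ⬝ᵥ y = x ⬝ᵥ Φ *ᵥ y := fun x y => by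
      have := hL.2 (0, Sum.elim (Φ *ᵥ x) x) ((hLmem _).2 rfl) (0, Sum.elim (Φ *ᵥ y) y)
        ((hLmem _).2 rfl)
      rw [omega₂, h0, sub_zero, omega_eq] at this
      exact sub_eq_zero.1 this
    ext i j
    have := h1 (Pi.single i 1) (Pi.single j 1)
    simpa using this
  have hph : IsPhaseMatrix Φ := by
    refine isPhaseMatrix_of_im_pos hsymm fun x hx => ?_
    by_contra hle
    have := hherm (Sum.elim (Φ *ᵥ x) x) ((hLmem _).2 rfl) (by
      rw [herm_eq', zc_elim, xc_elim]; linarith)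
    exact hx (congrArg xc this)
  refine ⟨Φ, I • (zc p - Φ *ᵥ xc p), hph, ?_⟩
  ext v
  rw [hmem, hLmem, mem_lag, sub_zc, sub_xc, smul_smul, I_mul_I, mulVec_sub]
  constructor
  · intro h; rw [sub_eq_iff_eq_add.1 h]; module
  · intro h; rw [h]; module

/-- If two image points v, v' come from u, u', then the form of u - u' is bounded by that of v - v'.
Strictness of `lag Φ b` forces u = u', so only points over a common source have to be separated. -/
theorem exists_lag_relImage {R : Set (Phase n × Phase m)} (hR : IsPosAffLag R)
    (hst : ∀ u v v', (u, v) ∈ R → (u, v') ∈ R → herm (v - v') ≤ 0 → v = v')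
    {Φ : Matrix (Fin n) (Fin n) ℂ} (hΦ : IsPhaseMatrix Φ) {b : Fin n → ℂ}
    (hne : (relImage R (lag Φ b)).Nonempty) :
    ∃ Φ' b', IsPhaseMatrix Φ' ∧ relImage R (lag Φ b) = lag Φ' b' := by
  refine exists_lag_eq (isPosAffLag_relComp hR (isPosAffLag_lagRel hΦ b)) hne ?_
  rintro v ⟨u, hu, huv⟩ v' ⟨u', hu', huv'⟩ h
  have h1 := hR.herm_sub_le huv huv'
  have h2 := eq_of_herm_sub hΦ hu hu' (h1.trans h)
  subst h2
  exact hst u v v' huv huv' h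

/-! ### Conjugate relations -/

/-- The conjugate transpose of a relation. -/
def dag (R : Set (Phase n × Phase m)) : Set (Phase m × Phase n) := {v | (star v.2, star v.1) ∈ R}

theorem mem_dag {R : Set (Phase n × Phase m)} {u : Phase m} {v : Phase n} :
    (u, v) ∈ dag R ↔ (star v, star u) ∈ R := Iff.rfl

theorem dag_dag (R : Set (Phase n × Phase m)) : dag (dag R) = R := by
  ext ⟨u, v⟩
  rw [mem_dag, mem_dag, star_star, star_star]

theorem dag_relComp (S : Set (Phase m × Phase k)) (R : Set (Phase n × Phase m)) :
    dag (relComp S R) = relComp (dag R) (dag S) := by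
  ext ⟨u, v⟩
  constructor
  · rintro ⟨b, h1, h2⟩
    exact ⟨star b, by rwa [mem_dag, star_star], by rwa [mem_dag, star_star]⟩
  · rintro ⟨b, h1, h2⟩
    exact ⟨star b, h2, h1⟩

theorem dag_relSum {n m n' m' : ℕ} (R : Set (Phase n × Phase m)) (S : Set (Phase n' × Phase m')) :
    dag (relSum R S) = relSum (dag R) (dag S) := rfl

/-- Conjugation and the exchange of source and target each reverse the sign of the Hermitian form.
-/
theorem isPosAffLag_dag {R : Set (Phase n × Phase m)} (hR : IsPosAffLag R) :
    IsPosAffLag (dag R) := by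
  rcases hR with rfl | ⟨L, a, b, hL, hp, rfl⟩
  · exact Or.inl (by ext; simp [dag])
  let K : Submodule ℂ (Phase m × Phase n) :=
    { carrier := {v | (star v.2, star v.1) ∈ L}
      add_mem' := fun {u v} hu hv => by
        have := L.add_mem hu hv
        change (star (u.2 + v.2), star (u.1 + v.1)) ∈ L
        rwa [star_add, star_add]
      zero_mem' := by
        change (star (0 : Phase n), star (0 : Phase m)) ∈ L
        rw [star_zero, star_zero]; exact L.zero_mem
      smul_mem' := fun c u hu => by
        have := L.smul_mem (star c) hu
        change (star (c • u.2), star (c • u.1)) ∈ L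
        rwa [star_smul, star_smul] }
  have hω : ∀ v w : Phase m × Phase n, omega₂ (star v.2, star v.1) (star w.2, star w.1) =
      -(starRingEnd ℂ) (omega₂ v w) := by
    intro v w
    simp only [omega₂, omega_star, map_sub]; ring
  refine Or.inr ⟨K, b, a, isLagrangian_iff.2 fun v => ⟨fun hv w hw => ?_, fun h => ?_⟩,
    fun v hv => ?_, ?_⟩
  · have := hL.2 _ hv _ hw
    rw [hω] at this
    simpa using this
  · refine hL.mem fun w hw => ?_
    have := h (star w.2, star w.1) (by
      change (star (star w.1), star (star w.2)) ∈ L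
      rwa [star_star, star_star])
    have h2 := hω v (star w.2, star w.1)
    simp only [star_star] at h2
    rw [this, map_zero, neg_zero] at h2
    exact h2
  · have := hp _ hv
    rw [herm_sub_eq] at this ⊢
    simp only [herm_star] at this
    linarith
  · ext v
    change (star v.2 - ofRealVec a, star v.1 - ofRealVec b) ∈ L ↔
      (star (v.2 - ofRealVec a), star (v.1 - ofRealVec b)) ∈ L
    rw [star_sub, star_sub, star_ofRealVec, star_ofRealVec]

theorem effectRel_eq (Φ : Matrix (Fin n) (Fin n) ℂ) (s t : Fin n → ℝ) :
    effectRel Φ s t = dag (stateRel Φ s t) := rfl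

end

section

variable {n m k : ℕ}

/-! ### The covariance matrix of a phase matrix -/

section
variable {Φ : Matrix (Fin n) (Fin n) ℂ}

theorem IsPhaseMatrix.re_isSymm (hΦ : IsPhaseMatrix Φ) :
    (Φ.map Complex.re)ᵀ = Φ.map Complex.re := by rw [← transpose_map, hΦ.1.eq]

theorem IsPhaseMatrix.im_isSymm (hΦ : IsPhaseMatrix Φ) :
    (Φ.map Complex.im)ᵀ = Φ.map Complex.im := by rw [← transpose_map, hΦ.1.eq]

theorem IsPhaseMatrix.isUnit_im (hΦ : IsPhaseMatrix Φ) : IsUnit (Φ.map Complex.im).det :=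
  hΦ.2.det_pos.ne'.isUnit

/-- This congruence with a block diagonal matrix gives both positivity and the determinant 4⁻ⁿ. -/
theorem phaseCov_eq_mul (hΦ : IsPhaseMatrix Φ) : phaseCov Φ = (1 / 2 : ℝ) •
    (fromBlocks 1 (Φ.map Complex.re) 0 1 * fromBlocks (Φ.map Complex.im) 0 0 (Φ.map Complex.im)⁻¹ *
      (fromBlocks 1 (Φ.map Complex.re) 0 1)ᵀ) := by
  rw [phaseCov, fromBlocks_transpose, hΦ.re_isSymm, fromBlocks_multiply, fromBlocks_multiply]
  simp

theorem det_phaseCov (hΦ : IsPhaseMatrix Φ) : (phaseCov Φ).det = (1 / 4) ^ n := by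
  rw [phaseCov_eq_mul hΦ, det_smul, det_mul, det_mul, det_transpose, det_fromBlocks_zero₂₁,
    det_fromBlocks_zero₂₁, ← det_mul (Φ.map Complex.im), mul_nonsing_inv _ hΦ.isUnit_im]
  simp only [det_one, mul_one, Fintype.card_sum, Fintype.card_fin, ← two_mul, pow_mul]
  norm_num

theorem inv_phaseCov (hΦ : IsPhaseMatrix Φ) : (phaseCov Φ)⁻¹ = (2 : ℝ) •
    fromBlocks (Φ.map Complex.im)⁻¹ (-((Φ.map Complex.im)⁻¹ * Φ.map Complex.re))
      (-(Φ.map Complex.re * (Φ.map Complex.im)⁻¹))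
      (Φ.map Complex.im + Φ.map Complex.re * (Φ.map Complex.im)⁻¹ * Φ.map Complex.re) := by
  apply Matrix.inv_eq_right_inv
  have h1 := mul_nonsing_inv _ hΦ.isUnit_im
  have h2 := nonsing_inv_mul _ hΦ.isUnit_im
  have h1' : ∀ X : Matrix (Fin n) (Fin n) ℝ, Φ.map Complex.im * ((Φ.map Complex.im)⁻¹ * X) = X :=
    fun X => by rw [← Matrix.mul_assoc, h1, Matrix.one_mul]
  rw [phaseCov, smul_mul_smul_comm, fromBlocks_multiply, ← fromBlocks_one]
  rw [show (1 / 2 * 2 : ℝ) = 1 by norm_num, one_smul]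
  simp only [Matrix.mul_neg]
  rw [fromBlocks_inj]
  refine ⟨?_, ?_, ?_, ?_⟩
  · simp only [Matrix.add_mul, Matrix.mul_assoc, h1]; abel
  · simp only [Matrix.add_mul, Matrix.mul_add, Matrix.mul_assoc, h1', h2, Matrix.mul_one]; abel
  · rw [Matrix.mul_assoc]; exact add_neg_cancel _
  · simp only [Matrix.mul_add, Matrix.mul_assoc, h2]; abel

theorem phaseCov_quadratic (hΦ : IsPhaseMatrix Φ) (z x : Fin n → ℝ) :
    Sum.elim z x ⬝ᵥ (phaseCov Φ)⁻¹ *ᵥ Sum.elim z x =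
      2 * ((z - Φ.map Complex.re *ᵥ x) ⬝ᵥ (Φ.map Complex.im)⁻¹ *ᵥ (z - Φ.map Complex.re *ᵥ x) +
        x ⬝ᵥ Φ.map Complex.im *ᵥ x) := by
  have hU : ∀ v w : Fin n → ℝ, (Φ.map Complex.re *ᵥ v) ⬝ᵥ w = v ⬝ᵥ (Φ.map Complex.re) *ᵥ w := by
    intro v w
    rw [dotProduct_comm, dotProduct_mulVec, ← mulVec_transpose, hΦ.re_isSymm, dotProduct_comm]
  rw [inv_phaseCov hΦ, smul_mulVec, dotProduct_smul, fromBlocks_mulVec]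
  simp only [Sum.elim_comp_inl, Sum.elim_comp_inr, smul_eq_mul]
  congr 1
  rw [sumElim_dotProduct_sumElim]
  simp only [neg_mulVec, add_mulVec, ← mulVec_mulVec, mulVec_sub, dotProduct_add, dotProduct_neg,
    dotProduct_sub, sub_dotProduct, hU]
  ring

theorem phaseCov_posDef (hΦ : IsPhaseMatrix Φ) : (phaseCov Φ).PosDef := by
  have hD : (fromBlocks (Φ.map Complex.im) 0 0 (Φ.map Complex.im)⁻¹).PosDef := by
    refine PosDef.of_dotProduct_mulVec_pos ?_ fun x hx => ?_
    · rw [Matrix.IsHermitian, conjTranspose_eq_transpose_of_trivial, fromBlocks_transpose,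
        transpose_nonsing_inv, hΦ.im_isSymm]
      simp
    · have e : star x ⬝ᵥ (fromBlocks (Φ.map Complex.im) 0 0 (Φ.map Complex.im)⁻¹) *ᵥ x =
          star (x ∘ Sum.inl) ⬝ᵥ Φ.map Complex.im *ᵥ (x ∘ Sum.inl) +
          star (x ∘ Sum.inr) ⬝ᵥ (Φ.map Complex.im)⁻¹ *ᵥ (x ∘ Sum.inr) := by
        rw [fromBlocks_mulVec, dotProduct]
        simp [dotProduct]
      rw [e]
      by_cases h : x ∘ Sum.inl = 0
      · have h' : x ∘ Sum.inr ≠ 0 := fun h' => hx (by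
          ext i; rcases i with i | i
          · exact congrFun h i
          · exact congrFun h' i)
        exact add_pos_of_nonneg_of_pos (hΦ.2.posSemidef.dotProduct_mulVec_nonneg _)
          (hΦ.2.inv.dotProduct_mulVec_pos h')
      · exact add_pos_of_pos_of_nonneg (hΦ.2.dotProduct_mulVec_pos h)
          (hΦ.2.inv.posSemidef.dotProduct_mulVec_nonneg _)
  rw [phaseCov_eq_mul hΦ]
  refine PosDef.smul ?_ (by norm_num)
  have := hD.mul_mul_conjTranspose_same (B := fromBlocks 1 (Φ.map Complex.re) 0 1) (by
    refine Matrix.vecMul_injective_of_isUnit ?_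
    rw [Matrix.isUnit_iff_isUnit_det, det_fromBlocks_zero₂₁]
    simp)
  rwa [conjTranspose_eq_transpose_of_trivial] at this

end

/-! ### The Wigner transform of a Gaussian state -/

/-- In ξ the real part of Φ contributes only to the oscillating linear term, so a real Gaussian of
matrix 2 Im Φ remains. The global phase cancels. -/
theorem wigner_integrand {Φ : Matrix (Fin n) (Fin n) ℂ} (hΦ : IsPhaseMatrix Φ) (α : ℝ)
    (s t q p ξ : Fin n → ℝ) :
    star (gaussianWave α Φ s t (q + ξ)) * gaussianWave α Φ s t (q - ξ) *
        exp (2 * I * ((ξ ⬝ᵥ p : ℝ) : ℂ)) =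
      ((Real.sqrt ((Φ.map Complex.im).det / Real.pi ^ n) *
        Real.exp (-((q - t) ⬝ᵥ Φ.map Complex.im *ᵥ (q - t))) : ℝ) : ℂ) *
      gaussFun (cmat ((2 : ℝ) • Φ.map Complex.im))
        ((2 * I) • cvec (p - s - Φ.map Complex.re *ᵥ (q - t))) ξ := by
  set U := Φ.map Complex.re with hU
  set V := Φ.map Complex.im with hV
  have hdet := hΦ.2.det_pos
  rw [← hV] at hdet
  have hbil : ∀ u w : Fin n → ℝ, cvec u ⬝ᵥ Φ *ᵥ cvec w =
      ((u ⬝ᵥ U *ᵥ w : ℝ) : ℂ) + I * ((u ⬝ᵥ V *ᵥ w : ℝ) : ℂ) := by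
    intro u w
    conv_lhs => rw [cmat_re_add_im Φ, add_mulVec, smul_mulVec, cmat_mulVec, cmat_mulVec,
      dotProduct_add, dotProduct_smul, cvec_dotProduct, cvec_dotProduct, smul_eq_mul]
  have hsU : ∀ u w : Fin n → ℝ, u ⬝ᵥ U *ᵥ w = w ⬝ᵥ U *ᵥ u := fun u w => by
    rw [dotProduct_mulVec, ← mulVec_transpose, hΦ.re_isSymm, dotProduct_comm]
  have hsV : ∀ u w : Fin n → ℝ, u ⬝ᵥ V *ᵥ w = w ⬝ᵥ V *ᵥ u := fun u w => by
    rw [dotProduct_mulVec, ← mulVec_transpose, hΦ.im_isSymm, dotProduct_comm]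
  have hy1 : (fun i => (((q + ξ) i - t i : ℝ) : ℂ)) = cvec ((q - t) + ξ) := by
    ext i; simp [cvec]; ring
  have hy2 : (fun i => (((q - ξ) i - t i : ℝ) : ℂ)) = cvec ((q - t) - ξ) := by
    ext i; simp [cvec]; ring
  set c : ℝ := (V.det / Real.pi ^ n) ^ (1 / 4 : ℝ) with hc
  have hcc : c * c = Real.sqrt (V.det / Real.pi ^ n) := by
    rw [hc, ← Real.rpow_add (by positivity), Real.sqrt_eq_rpow]; norm_num
  unfold gaussianWave
  simp only [hy1, hy2, hbil]
  rw [← hcc, ← hV, ← hc]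
  simp only [Complex.star_def, map_mul, ← Complex.exp_conj, Complex.conj_I, Complex.conj_ofReal,
    map_add, map_div₀, Complex.conj_ofNat]
  rw [show ∀ a b e a' b' e' f : ℂ, exp a * exp b * (c : ℂ) * exp e * (exp a' * exp b' * (c : ℂ) *
      exp e') * exp f = (c : ℂ) * c * exp (a + b + e + a' + b' + e' + f) from
    fun a b e a' b' e' f => by simp only [Complex.exp_add]; ring]
  rw [gaussFun, Complex.ofReal_mul, Complex.ofReal_mul, Complex.ofReal_exp, mul_assoc (_ * _)
    (exp _) (exp _), ← Complex.exp_add]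
  congr 2
  rw [cmat_mulVec, cvec_dotProduct, smul_dotProduct, cvec_dotProduct]
  generalize q - t = y
  simp only [smul_mulVec, mulVec_add, mulVec_sub, dotProduct_add, add_dotProduct, dotProduct_sub,
    sub_dotProduct, dotProduct_smul, smul_eq_mul, dotProduct_comm (U *ᵥ y) ξ, hsU ξ y, hsV ξ y,
    dotProduct_comm ξ p]
  push_cast
  linear_combination ((y ⬝ᵥ V *ᵥ y : ℝ) + (ξ ⬝ᵥ V *ᵥ ξ : ℝ) : ℂ) * I_sq

theorem hasWignerData_of_isGaussianWith {φ : L2 n} {Φ : Matrix (Fin n) (Fin n) ℂ}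
    {s t : Fin n → ℝ} (h : IsGaussianWith φ Φ s t) :
    HasWignerData φ (phaseCov Φ) (Sum.elim s t) := by
  obtain ⟨hΦ, α, hα⟩ := h
  refine ⟨phaseCov_posDef hΦ, fun q p => ?_⟩
  set V := Φ.map Complex.im with hV
  have hdet : 0 < V.det := hΦ.2.det_pos
  -- φ is known only almost everywhere; ξ ↦ q + ξ and ξ ↦ q - ξ preserve null sets.
  have h1 := (measurePreserving_add_left volume q).quasiMeasurePreserving.ae_eq_comp hα
  have h2 := (Measure.measurePreserving_sub_left volume q).quasiMeasurePreserving.ae_eq_comp hα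
  have hpos : ((2 : ℝ) • V).PosDef := hΦ.2.smul (by norm_num)
  have hre : (cmat ((2 : ℝ) • V)).map Complex.re = (2 : ℝ) • V := by ext; simp [cmat]
  have hsymm : (cmat ((2 : ℝ) • V)).IsSymm := by
    rw [Matrix.IsSymm, ← cmat_transpose, transpose_smul, hΦ.im_isSymm]
  have hexp : (∫ ξ : Fin n → ℝ, star (φ (q + ξ)) * φ (q - ξ) *
      exp (2 * I * ((ξ ⬝ᵥ p : ℝ) : ℂ))) = ((Real.sqrt (V.det / Real.pi ^ n) *
        Real.exp (-((q - t) ⬝ᵥ V *ᵥ (q - t))) : ℝ) : ℂ) *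
      (((Real.sqrt ((2 * Real.pi) ^ Fintype.card (Fin n) / ((2 : ℝ) • V).det) : ℝ) : ℂ) *
        exp (1 / 2 * (((2 * I) • cvec (p - s - Φ.map Complex.re *ᵥ (q - t))) ⬝ᵥ
          (cmat ((2 : ℝ) • V))⁻¹ *ᵥ
            ((2 * I) • cvec (p - s - Φ.map Complex.re *ᵥ (q - t)))))) := by
    rw [integral_congr_ae (g := fun ξ => ((Real.sqrt (V.det / Real.pi ^ n) *
        Real.exp (-((q - t) ⬝ᵥ V *ᵥ (q - t))) : ℝ) : ℂ) * gaussFun (cmat ((2 : ℝ) • V))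
        ((2 * I) • cvec (p - s - Φ.map Complex.re *ᵥ (q - t))) ξ) (by
      filter_upwards [h1, h2] with ξ h1 h2
      simp only [Function.comp] at h1 h2
      rw [h1, h2, wigner_integrand hΦ])]
    rw [integral_const_mul, integral_gaussFun hsymm (by rwa [hre]), gaussConst_cmat hpos]
  rw [wigner, hexp, gaussianDensity]
  have hsub : (Sum.elim p q - Sum.elim s t : Ix n → ℝ) = Sum.elim (p - s) (q - t) := by
    ext i; rcases i with i | i <;> rfl
  rw [hsub, phaseCov_quadratic hΦ, det_phaseCov hΦ, ← hV]
  set w := p - s - Φ.map Complex.re *ᵥ (q - t)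
  have hinv : (cmat ((2 : ℝ) • V))⁻¹ = cmat ((1 / 2 : ℝ) • V⁻¹) := by
    rw [← cmat_inv _ hpos.det_pos.ne'.isUnit]
    congr 1
    apply Matrix.inv_eq_right_inv
    rw [smul_mul_smul_comm, mul_nonsing_inv _ hdet.ne'.isUnit]
    norm_num
  have hexp : (1 / 2 : ℂ) * (((2 * I) • cvec w) ⬝ᵥ (cmat ((2 : ℝ) • V))⁻¹ *ᵥ ((2 * I) • cvec w)) =
      ((-(w ⬝ᵥ V⁻¹ *ᵥ w) : ℝ) : ℂ) := by
    rw [hinv, mulVec_smul, cmat_mulVec, smul_dotProduct, dotProduct_smul, cvec_dotProduct,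
      smul_mulVec, dotProduct_smul]
    simp only [smul_eq_mul]
    push_cast
    linear_combination ((w ⬝ᵥ V⁻¹ *ᵥ w : ℝ) : ℂ) * I_sq
  have hsq : Real.sqrt (V.det / Real.pi ^ n) *
      Real.sqrt ((2 * Real.pi) ^ Fintype.card (Fin n) / ((2 : ℝ) • V).det) = 1 := by
    rw [← Real.sqrt_mul (by positivity), det_smul, Fintype.card_fin, Real.sqrt_eq_one, mul_pow]
    field_simp
  have hden : Real.sqrt ((2 * Real.pi) ^ Fintype.card (Ix n) * (1 / 4) ^ n) = Real.pi ^ n := by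
    rw [Real.sqrt_eq_iff_mul_self_eq (by positivity) (by positivity), Fintype.card_sum,
      Fintype.card_fin, ← two_mul, pow_mul, ← mul_pow, ← mul_pow]
    congr 1; ring
  rw [hexp, hden, ← Complex.ofReal_exp, show -(1 / 2) * (2 * (w ⬝ᵥ V⁻¹ *ᵥ w +
    (q - t) ⬝ᵥ V *ᵥ (q - t))) = -((q - t) ⬝ᵥ V *ᵥ (q - t)) + -(w ⬝ᵥ V⁻¹ *ᵥ w) by ring, Real.exp_add]
  have hfin : ∀ a b c d P : ℝ, a * b = 1 →
      (1 / (P : ℂ)) * (((a * c : ℝ) : ℂ) * ((b : ℂ) * (d : ℂ))) = ((c * d / P : ℝ) : ℂ) := by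
    intro a b c d P h
    have h' : (a : ℂ) * b = 1 := by exact_mod_cast h
    push_cast
    linear_combination (c * d / P : ℂ) * h'
  rw [← hfin _ _ _ _ _ hsq]
  push_cast
  rfl

/-! ### Uniqueness of Wigner data -/

section
variable {ι : Type} [Fintype ι] [DecidableEq ι]

theorem eq_of_quadratic_eq {A B : Matrix ι ι ℝ} (hA : Aᵀ = A) (hB : Bᵀ = B)
    (h : ∀ x : ι → ℝ, x ⬝ᵥ A *ᵥ x = x ⬝ᵥ B *ᵥ x) : A = B := by
  have hs : ∀ {C : Matrix ι ι ℝ}, Cᵀ = C → ∀ x y : ι → ℝ, y ⬝ᵥ C *ᵥ x = x ⬝ᵥ C *ᵥ y := by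
    intro C hC x y
    rw [dotProduct_mulVec, ← mulVec_transpose, hC, dotProduct_comm]
  ext i j
  have h1 := h (Pi.single i 1 + Pi.single j 1)
  simp only [mulVec_add, dotProduct_add, add_dotProduct, h, hs hA (Pi.single i 1) (Pi.single j 1),
    hs hB (Pi.single i 1) (Pi.single j 1)] at h1
  have h2 : (Pi.single i 1 : ι → ℝ) ⬝ᵥ A *ᵥ Pi.single j 1 = Pi.single i 1 ⬝ᵥ B *ᵥ Pi.single j 1 := by
    linarith
  simpa using h2

theorem gaussianDensity_injective {C C' : Matrix ι ι ℝ} {μ μ' : ι → ℝ} (hC : C.PosDef)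
    (hC' : C'.PosDef) (h : ∀ u, gaussianDensity C μ u = gaussianDensity C' μ' u) :
    C = C' ∧ μ = μ' := by
  have key : ∀ (C : Matrix ι ι ℝ) (μ : ι → ℝ), C.PosDef → ∃ K : ℝ, 0 < K ∧ ∀ u,
      gaussianDensity C μ u = K * Real.exp (-(1 / 2) * ((u - μ) ⬝ᵥ C⁻¹ *ᵥ (u - μ))) := by
    intro C μ hC
    have := hC.det_pos
    exact ⟨(Real.sqrt ((2 * Real.pi) ^ Fintype.card ι * C.det))⁻¹, by positivity, fun u => by
      rw [gaussianDensity, div_eq_inv_mul]⟩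
  obtain ⟨K, hK, hf⟩ := key C μ hC
  obtain ⟨K', hK', hf'⟩ := key C' μ' hC'
  simp only [hf, hf'] at h
  have hnn : ∀ {D : Matrix ι ι ℝ}, D.PosDef → ∀ x : ι → ℝ, 0 ≤ x ⬝ᵥ D⁻¹ *ᵥ x := fun hD x => by
    simpa using hD.inv.posSemidef.dotProduct_mulVec_nonneg x
  -- Each density is maximal at its mean. Evaluation at both means gives K ≤ K' and K' ≤ K; then a
  -- nonzero difference of the means would make the exponent strictly negative.
  have e1 := h μ
  have e2 := h μ'
  simp only [sub_self, zero_dotProduct, mul_zero, Real.exp_zero, mul_one] at e1 e2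
  have l1 : Real.exp (-(1 / 2) * ((μ - μ') ⬝ᵥ C'⁻¹ *ᵥ (μ - μ'))) ≤ 1 := by
    rw [Real.exp_le_one_iff]; linarith [hnn hC' (μ - μ')]
  have l2 : Real.exp (-(1 / 2) * ((μ' - μ) ⬝ᵥ C⁻¹ *ᵥ (μ' - μ))) ≤ 1 := by
    rw [Real.exp_le_one_iff]; linarith [hnn hC (μ' - μ)]
  have hKK : K = K' := le_antisymm (by rw [e1]; exact mul_le_of_le_one_right hK'.le l1)
    (by rw [← e2]; exact mul_le_of_le_one_right hK.le l2)
  subst hKK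
  have hμ : μ = μ' := by
    by_contra hne
    have h3 : 0 < (μ - μ') ⬝ᵥ C'⁻¹ *ᵥ (μ - μ') := by
      simpa using hC'.inv.dotProduct_mulVec_pos (sub_ne_zero.2 hne)
    have h4 : Real.exp (-(1 / 2) * ((μ - μ') ⬝ᵥ C'⁻¹ *ᵥ (μ - μ'))) = 1 := by
      exact (mul_left_cancel₀ hK.ne' ((mul_one K).trans e1)).symm
    rw [Real.exp_eq_one_iff] at h4
    linarith
  subst hμ
  refine ⟨?_, rfl⟩
  have hi : C⁻¹ = C'⁻¹ := by
    refine eq_of_quadratic_eq ?_ ?_ fun x => ?_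
    · simpa [conjTranspose_eq_transpose_of_trivial] using hC.inv.isHermitian.eq
    · simpa [conjTranspose_eq_transpose_of_trivial] using hC'.inv.isHermitian.eq
    · have := mul_left_cancel₀ hK.ne' (h (x + μ))
      rw [add_sub_cancel_right] at this
      have := Real.exp_injective this
      linarith
  rw [← nonsing_inv_nonsing_inv C hC.det_pos.ne'.isUnit, hi,
    nonsing_inv_nonsing_inv C' hC'.det_pos.ne'.isUnit]

end

theorem HasWignerData.unique {φ : L2 n} {C C' : Matrix (Ix n) (Ix n) ℝ} {μ μ' : Ix n → ℝ}
    (h : HasWignerData φ C μ) (h' : HasWignerData φ C' μ') : C = C' ∧ μ = μ' := by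
  refine gaussianDensity_injective h.1 h'.1 fun u => ?_
  have h1 := h.2 (u ∘ Sum.inr) (u ∘ Sum.inl)
  have h2 := h'.2 (u ∘ Sum.inr) (u ∘ Sum.inl)
  rw [h1, Sum.elim_comp_inl_inr] at h2
  exact_mod_cast h2

theorem HasWignerData.eq_of_isGaussianWith {φ : L2 n} {C : Matrix (Ix n) (Ix n) ℝ} {μ : Ix n → ℝ}
    {Φ : Matrix (Fin n) (Fin n) ℂ} {s t : Fin n → ℝ} (h : HasWignerData φ C μ)
    (hφ : IsGaussianWith φ Φ s t) : C = phaseCov Φ ∧ μ = Sum.elim s t :=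
  h.unique (hasWignerData_of_isGaussianWith hφ)

/-! ### Covariance matrices and Lagrangian subspaces -/

/-- Membership in the linear Lagrangian subspace `z = Φ x`. -/
def InL (Φ : Matrix (Fin n) (Fin n) ℂ) (v : Phase n) : Prop := zc v = Φ *ᵥ xc v

/-- The symplectic matrix `(z, x) ↦ (x, -z)`. -/
def symJ (v : Phase n) : Phase n := Sum.elim (xc v) (-zc v)

theorem InL.add {Φ : Matrix (Fin n) (Fin n) ℂ} {u v : Phase n} (hu : InL Φ u) (hv : InL Φ v) :
    InL Φ (u + v) := by
  change zc u + zc v = Φ *ᵥ (xc u + xc v)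
  rw [mulVec_add, ← hu, ← hv]

theorem InL.smul {Φ : Matrix (Fin n) (Fin n) ℂ} {u : Phase n} (hu : InL Φ u) (c : ℂ) :
    InL Φ (c • u) := by
  change c • zc u = Φ *ᵥ (c • xc u)
  rw [mulVec_smul, ← hu]

theorem inL_sub {Φ : Matrix (Fin n) (Fin n) ℂ} {b : Fin n → ℂ} {u v : Phase n}
    (hu : u ∈ lag Φ b) (hv : v ∈ lag Φ b) : InL Φ (u - v) := zc_sub_of_mem_lag hu hv

theorem mem_lag_add {Φ : Matrix (Fin n) (Fin n) ℂ} {b : Fin n → ℂ} {u v : Phase n}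
    (hu : u ∈ lag Φ b) (hv : InL Φ v) : u + v ∈ lag Φ b := by
  change zc u + zc v = Φ *ᵥ (xc u + xc v) - _
  rw [mulVec_add, ← hv, mem_lag.1 hu]; abel

/-- Real vectors have Hermitian form 0. Consequently an affine Lagrangian has at most one real
point, which is how displacements are recovered. -/
theorem eq_zero_of_inL_real {Φ : Matrix (Fin n) (Fin n) ℂ} (hΦ : IsPhaseMatrix Φ) {a : Ix n → ℝ}
    (h : InL Φ (ofRealVec a)) : a = 0 := by
  have h0 : (0 : Phase n) ∈ lag Φ 0 := by
    change (0 : Fin n → ℂ) = Φ *ᵥ 0 - I • 0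
    simp
  have h1 : ofRealVec a ∈ lag Φ 0 := by
    have := mem_lag_add h0 h
    rwa [zero_add] at this
  have h2 : herm (ofRealVec a - 0) ≤ 0 := by
    rw [sub_zero, herm, star_ofRealVec]
    have : omega (ofRealVec a) (ofRealVec a) = 0 := by
      rw [omega_eq, dotProduct_comm, sub_self]
    rw [this]; simp
  have h3 := eq_of_herm_sub hΦ h1 h0 h2
  ext i
  simpa [ofRealVec] using congrFun h3 i

theorem ofRealVec_mem_lag (Φ : Matrix (Fin n) (Fin n) ℂ) (s t : Fin n → ℝ) :
    ofRealVec (Sum.elim s t) ∈ lag Φ (lin Φ s t) := by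
  rw [mem_lag_iff]; rfl

theorem eq_of_ofRealVec_mem_lag {Φ : Matrix (Fin n) (Fin n) ℂ} (hΦ : IsPhaseMatrix Φ)
    {s t : Fin n → ℝ} {a : Ix n → ℝ} (h : ofRealVec a ∈ lag Φ (lin Φ s t)) :
    a = Sum.elim s t := by
  have h1 := inL_sub h (ofRealVec_mem_lag Φ s t)
  have h2 : ofRealVec a - ofRealVec (Sum.elim s t) = ofRealVec (a - Sum.elim s t) := by
    ext i; simp [ofRealVec]
  rw [h2] at h1
  exact sub_eq_zero.1 (eq_zero_of_inL_real hΦ h1)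

/-- This criterion is linear in the covariance matrix and is compatible with symplectic maps and
contractions. It replaces computations with the blocks of `phaseCov`. -/
theorem inL_phaseCov {Φ : Matrix (Fin n) (Fin n) ℂ} (hΦ : IsPhaseMatrix Φ) (ξ : Phase n) :
    InL Φ ((2 : ℂ) • (cmat (phaseCov Φ) *ᵥ ξ) + I • symJ ξ) := by
  have hVi : cmat (Φ.map Complex.im) * cmat (Φ.map Complex.im)⁻¹ = 1 := by
    rw [← cmat_mul, mul_nonsing_inv _ hΦ.isUnit_im, cmat_one]
  have hc : (2 : ℂ) • (cmat (phaseCov Φ) *ᵥ ξ) = fromBlocks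
      (cmat (Φ.map Complex.im) + cmat (Φ.map Complex.re) * cmat (Φ.map Complex.im)⁻¹ *
        cmat (Φ.map Complex.re)) (cmat (Φ.map Complex.re) * cmat (Φ.map Complex.im)⁻¹)
      (cmat (Φ.map Complex.im)⁻¹ * cmat (Φ.map Complex.re)) (cmat (Φ.map Complex.im)⁻¹) *ᵥ ξ := by
    rw [← smul_mulVec]
    congr 1
    rw [phaseCov]
    simp only [← cmat_mul]
    ext i j
    rcases i with i | i <;> rcases j with j | j <;> simp [cmat]
  have e1 : zc ((2 : ℂ) • (cmat (phaseCov Φ) *ᵥ ξ) + I • symJ ξ) =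
      (cmat (Φ.map Complex.im) + cmat (Φ.map Complex.re) * cmat (Φ.map Complex.im)⁻¹ *
        cmat (Φ.map Complex.re)) *ᵥ zc ξ + (cmat (Φ.map Complex.re) *
        cmat (Φ.map Complex.im)⁻¹) *ᵥ xc ξ + I • xc ξ := by
    rw [hc, fromBlocks_mulVec]; rfl
  have e2 : xc ((2 : ℂ) • (cmat (phaseCov Φ) *ᵥ ξ) + I • symJ ξ) =
      (cmat (Φ.map Complex.im)⁻¹ * cmat (Φ.map Complex.re)) *ᵥ zc ξ +
        cmat (Φ.map Complex.im)⁻¹ *ᵥ xc ξ + I • -zc ξ := by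
    rw [hc, fromBlocks_mulVec]; rfl
  rw [InL, e1, e2]
  have hΦe : ∀ y, Φ *ᵥ y = cmat (Φ.map Complex.re) *ᵥ y + I • (cmat (Φ.map Complex.im) *ᵥ y) := by
    intro y
    conv_lhs => rw [cmat_re_add_im Φ, add_mulVec, smul_mulVec]
  rw [hΦe]
  simp only [mulVec_add, add_mulVec, mulVec_smul, mulVec_neg, mulVec_mulVec]
  rw [← Matrix.mul_assoc (cmat (Φ.map Complex.im)), hVi, Matrix.one_mul, one_mulVec,
    Matrix.mul_assoc]
  simp only [smul_neg, smul_smul, I_mul_I, neg_smul, one_smul, smul_add]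
  module

/-- Two candidates for the covariance differ, on a real vector, by a real vector of the Lagrangian
subspace. -/
theorem eq_phaseCov {Φ : Matrix (Fin n) (Fin n) ℂ} (hΦ : IsPhaseMatrix Φ)
    {C : Matrix (Ix n) (Ix n) ℝ}
    (h : ∀ ξ : Phase n, InL Φ ((2 : ℂ) • (cmat C *ᵥ ξ) + I • symJ ξ)) : C = phaseCov Φ := by
  have h1 : ∀ a : Ix n → ℝ, (C - phaseCov Φ) *ᵥ a = 0 := by
    intro a
    apply eq_zero_of_inL_real hΦ
    have h2 := ((h (cvec a)).add ((inL_phaseCov hΦ (cvec a)).smul (-1))).smul (1 / 2)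
    convert h2 using 1
    rw [cmat_mulVec, cmat_mulVec]
    change cvec _ = _
    rw [sub_mulVec]
    have : cvec (C *ᵥ a - phaseCov Φ *ᵥ a) = cvec (C *ᵥ a) - cvec (phaseCov Φ *ᵥ a) := by
      ext i; simp [cvec]
    rw [this]
    module
  rw [← sub_eq_zero]
  ext i j
  have := congrFun (h1 (Pi.single j 1)) i
  simpa using this

end

section

variable {n m k : ℕ}

/-! ### Partial inner products of Gaussian vectors -/

section
variable {α : Type}

/-- The first part of a vector on `m + n` modes. -/
def lft (x : Fin (m + n) → α) : Fin m → α := fun i => x (Fin.castAdd n i)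

/-- The second part of a vector on `m + n` modes. -/
def rgt (x : Fin (m + n) → α) : Fin n → α := fun i => x (Fin.natAdd m i)

theorem lft_append (a : Fin m → α) (b : Fin n → α) : lft (Fin.append a b) = a := by
  ext i; simp [lft]

theorem rgt_append (a : Fin m → α) (b : Fin n → α) : rgt (Fin.append a b) = b := by
  ext i; simp [rgt]

theorem lft_rgt_ext {x y : Fin (m + n) → α} (h₁ : lft x = lft y) (h₂ : rgt x = rgt y) : x = y := by
  ext i
  refine Fin.addCases (fun i => congrFun h₁ i) (fun i => congrFun h₂ i) i

/-- The first diagonal block of a matrix on `m + n` modes. -/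
def blk₁₁ (Φ : Matrix (Fin (m + n)) (Fin (m + n)) α) : Matrix (Fin m) (Fin m) α :=
  Φ.submatrix (Fin.castAdd n) (Fin.castAdd n)

/-- The upper off-diagonal block of a matrix on `m + n` modes. -/
def blk₁₂ (Φ : Matrix (Fin (m + n)) (Fin (m + n)) α) : Matrix (Fin m) (Fin n) α :=
  Φ.submatrix (Fin.castAdd n) (Fin.natAdd m)

/-- The lower off-diagonal block of a matrix on `m + n` modes. -/
def blk₂₁ (Φ : Matrix (Fin (m + n)) (Fin (m + n)) α) : Matrix (Fin n) (Fin m) α :=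
  Φ.submatrix (Fin.natAdd m) (Fin.castAdd n)

/-- The second diagonal block of a matrix on `m + n` modes. -/
def blk₂₂ (Φ : Matrix (Fin (m + n)) (Fin (m + n)) α) : Matrix (Fin n) (Fin n) α :=
  Φ.submatrix (Fin.natAdd m) (Fin.natAdd m)
end

theorem lft_mulVec (Φ : Matrix (Fin (m + n)) (Fin (m + n)) ℂ) (x : Fin (m + n) → ℂ) :
    lft (Φ *ᵥ x) = blk₁₁ Φ *ᵥ lft x + blk₁₂ Φ *ᵥ rgt x := by
  ext i
  simp [lft, rgt, blk₁₁, blk₁₂, mulVec, dotProduct, Fin.sum_univ_add]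

theorem rgt_mulVec (Φ : Matrix (Fin (m + n)) (Fin (m + n)) ℂ) (x : Fin (m + n) → ℂ) :
    rgt (Φ *ᵥ x) = blk₂₁ Φ *ᵥ lft x + blk₂₂ Φ *ᵥ rgt x := by
  ext i
  simp [lft, rgt, blk₂₁, blk₂₂, mulVec, dotProduct, Fin.sum_univ_add]

theorem dotProduct_lft_rgt (x y : Fin (m + n) → ℂ) :
    x ⬝ᵥ y = lft x ⬝ᵥ lft y + rgt x ⬝ᵥ rgt y := by
  simp [lft, rgt, dotProduct, Fin.sum_univ_add]

theorem isPhaseMatrix_blk₂₂ {Φ : Matrix (Fin (m + n)) (Fin (m + n)) ℂ} (hΦ : IsPhaseMatrix Φ) :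
    IsPhaseMatrix (blk₂₂ Φ) := by
  refine isPhaseMatrix_of_im_pos (hΦ.1.submatrix _) fun x hx => ?_
  have h := hΦ.im_pos (x := Fin.append 0 x) (fun h => hx (by
    rw [← rgt_append (0 : Fin m → ℂ) x, h]; rfl))
  have e1 : lft (star (Fin.append (0 : Fin m → ℂ) x)) = 0 := by
    ext i; simp [lft]
  have e2 : rgt (star (Fin.append (0 : Fin m → ℂ) x)) = star x := by
    ext i; simp [rgt]
  rw [dotProduct_lft_rgt, e1, e2, rgt_mulVec, lft_append, rgt_append] at h
  simpa using h

theorem ovMat_mulVec (Φ Ψ : Matrix (Fin n) (Fin n) ℂ) (x : Fin n → ℂ) :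
    ovMat Φ Ψ *ᵥ x = I • (Φ.map star *ᵥ x) - I • (Ψ *ᵥ x) := by
  have : (-(I • Φ)).map star = I • Φ.map star := by ext; simp
  rw [ovMat, this, add_mulVec, neg_mulVec, smul_mulVec, smul_mulVec, sub_eq_add_neg]

theorem IsPhaseMatrix.isUnit_ovMat {Φ Ψ : Matrix (Fin n) (Fin n) ℂ} (hΦ : IsPhaseMatrix Φ)
    (hΨ : IsPhaseMatrix Ψ) : IsUnit (ovMat Φ Ψ).det :=
  isUnit_det_of_re_posDef (hΦ.sum_isSymm hΨ) (hΦ.sum_posDef hΨ)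

theorem ovMat_inv_mulVec {Φ Ψ : Matrix (Fin n) (Fin n) ℂ} (hΦ : IsPhaseMatrix Φ)
    (hΨ : IsPhaseMatrix Ψ) {x y : Fin n → ℂ} (h : ovMat Φ Ψ *ᵥ y = x) :
    (ovMat Φ Ψ)⁻¹ *ᵥ x = y := by
  rw [← h, mulVec_mulVec, nonsing_inv_mul _ (hΦ.isUnit_ovMat hΨ), one_mulVec]

theorem ovMat_mulVec_inv {Φ Ψ : Matrix (Fin n) (Fin n) ℂ} (hΦ : IsPhaseMatrix Φ)
    (hΨ : IsPhaseMatrix Ψ) (x : Fin n → ℂ) : ovMat Φ Ψ *ᵥ (ovMat Φ Ψ)⁻¹ *ᵥ x = x := by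
  rw [mulVec_mulVec, mul_nonsing_inv _ (hΦ.isUnit_ovMat hΨ), one_mulVec]

theorem ovMat_inv_symm {Φ Ψ : Matrix (Fin n) (Fin n) ℂ} (hΦ : IsPhaseMatrix Φ)
    (hΨ : IsPhaseMatrix Ψ) (x y : Fin n → ℂ) :
    x ⬝ᵥ (ovMat Φ Ψ)⁻¹ *ᵥ y = y ⬝ᵥ (ovMat Φ Ψ)⁻¹ *ᵥ x := by
  have : ((ovMat Φ Ψ)⁻¹)ᵀ = (ovMat Φ Ψ)⁻¹ := by
    rw [transpose_nonsing_inv]; congr 1; exact hΦ.sum_isSymm hΨ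
  rw [dotProduct_comm, mulVec_dotProduct_eq, this]

/-- The phase matrix of a partial inner product. -/
def ctrMat (Φ : Matrix (Fin (m + n)) (Fin (m + n)) ℂ) (Ψ : Matrix (Fin n) (Fin n) ℂ) :
    Matrix (Fin m) (Fin m) ℂ :=
  blk₁₁ Φ + I • (blk₁₂ Φ * (ovMat Ψ (blk₂₂ Φ))⁻¹ * blk₂₁ Φ)

/-- The linear term of a partial inner product. -/
def ctrVec (Φ : Matrix (Fin (m + n)) (Fin (m + n)) ℂ) (b : Fin (m + n) → ℂ)
    (Ψ : Matrix (Fin n) (Fin n) ℂ) (a : Fin n → ℂ) : Fin m → ℂ :=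
  lft b + I • (blk₁₂ Φ *ᵥ (ovMat Ψ (blk₂₂ Φ))⁻¹ *ᵥ (star a + rgt b))

/-- The set of all `v` such that `(v, u) ∈ A` for some `u ∈ B̄`. -/
def ctrSet (A : Set (Phase (m + n))) (B : Set (Phase n)) : Set (Phase m) :=
  {v | ∃ u, star u ∈ B ∧ jn v u ∈ A}

theorem lft_zc_jn (v : Phase m) (u : Phase n) : lft (zc (jn v u)) = zc v :=
  congrArg zc (jn_fstIx v u)
theorem rgt_zc_jn (v : Phase m) (u : Phase n) : rgt (zc (jn v u)) = zc u :=
  congrArg zc (jn_sndIx v u)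
theorem lft_xc_jn (v : Phase m) (u : Phase n) : lft (xc (jn v u)) = xc v :=
  congrArg xc (jn_fstIx v u)
theorem rgt_xc_jn (v : Phase m) (u : Phase n) : rgt (xc (jn v u)) = xc u :=
  congrArg xc (jn_sndIx v u)

theorem jn_mem_lag {Φ : Matrix (Fin (m + n)) (Fin (m + n)) ℂ} {b : Fin (m + n) → ℂ}
    {v : Phase m} {u : Phase n} : jn v u ∈ lag Φ b ↔
      zc v = blk₁₁ Φ *ᵥ xc v + blk₁₂ Φ *ᵥ xc u - I • lft b ∧
      zc u = blk₂₁ Φ *ᵥ xc v + blk₂₂ Φ *ᵥ xc u - I • rgt b := by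
  rw [mem_lag]
  constructor
  · intro h
    have h1 := congrArg lft h
    have h2 := congrArg rgt h
    rw [lft_zc_jn] at h1
    rw [rgt_zc_jn] at h2
    refine ⟨h1.trans ?_, h2.trans ?_⟩
    · rw [← lft_xc_jn v u, ← rgt_xc_jn v u, ← lft_mulVec]; rfl
    · rw [← lft_xc_jn v u, ← rgt_xc_jn v u, ← rgt_mulVec]; rfl
  · rintro ⟨h1, h2⟩
    refine lft_rgt_ext ?_ ?_
    · rw [lft_zc_jn, h1, ← lft_xc_jn v u, ← rgt_xc_jn v u, ← lft_mulVec]; rfl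
    · rw [rgt_zc_jn, h2, ← lft_xc_jn v u, ← rgt_xc_jn v u, ← rgt_mulVec]; rfl

theorem star_mem_lag {Ψ : Matrix (Fin n) (Fin n) ℂ} {a : Fin n → ℂ} {u : Phase n} :
    star u ∈ lag Ψ a ↔ zc u = Ψ.map star *ᵥ xc u + I • star a := by
  rw [mem_lag, ← star_inj, star_sub, star_mulVec_eq, star_smul]
  have e1 : star (zc (star u)) = zc u := by ext i; simp [zc]
  have e2 : star (xc (star u)) = xc u := by ext i; simp [xc]
  rw [e1, e2]
  simp [sub_eq_add_neg]

/-- The condition that u lies in the conjugate of `lag Ψ a` fixes its momentum. Equating this with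
the momentum prescribed by Φ leaves a linear system for the position y of u, whose matrix `ovMat Ψ
(blk₂₂ Φ)` is invertible. -/
theorem ctrSet_lag {Φ : Matrix (Fin (m + n)) (Fin (m + n)) ℂ} (hΦ : IsPhaseMatrix Φ)
    (b : Fin (m + n) → ℂ) {Ψ : Matrix (Fin n) (Fin n) ℂ} (hΨ : IsPhaseMatrix Ψ) (a : Fin n → ℂ) :
    ctrSet (lag Φ b) (lag Ψ a) = lag (ctrMat Φ Ψ) (ctrVec Φ b Ψ a) := by
  have h2 := isPhaseMatrix_blk₂₂ hΦ
  have key : ∀ x y, ovMat Ψ (blk₂₂ Φ) *ᵥ y = I • (blk₂₁ Φ *ᵥ x) + (star a + rgt b) ↔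
      Ψ.map star *ᵥ y + I • star a = blk₂₁ Φ *ᵥ x + blk₂₂ Φ *ᵥ y - I • rgt b := by
    intro x y
    rw [ovMat_mulVec]
    have hinj : Function.Injective (fun v : Fin n → ℂ => I • v) := smul_right_injective _ I_ne_zero
    rw [← sub_eq_zero, ← sub_eq_zero (a := Ψ.map star *ᵥ y + I • star a), ← hinj.eq_iff]
    have : I • (I • Ψ.map star *ᵥ y - I • blk₂₂ Φ *ᵥ y -
        (I • blk₂₁ Φ *ᵥ x + (star a + rgt b))) = -(Ψ.map star *ᵥ y + I • star a -
        (blk₂₁ Φ *ᵥ x + blk₂₂ Φ *ᵥ y - I • rgt b)) := by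
      simp only [smul_add, smul_sub, smul_smul, I_mul_I]
      module
    simp only [this, smul_zero, neg_eq_zero]
  have hctr : ∀ x : Fin m → ℂ, ctrMat Φ Ψ *ᵥ x - I • ctrVec Φ b Ψ a = blk₁₁ Φ *ᵥ x +
      blk₁₂ Φ *ᵥ (ovMat Ψ (blk₂₂ Φ))⁻¹ *ᵥ (I • (blk₂₁ Φ *ᵥ x) + (star a + rgt b)) -
        I • lft b := by
    intro x
    rw [ctrMat, ctrVec, add_mulVec, smul_mulVec, ← mulVec_mulVec, ← mulVec_mulVec,
      mulVec_add _ (I • _), mulVec_add _ (_ *ᵥ (I • _)), mulVec_smul, mulVec_smul, smul_add,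
      smul_smul, I_mul_I]
    module
  ext v
  rw [mem_lag, hctr]
  constructor
  · rintro ⟨u, hu, hvu⟩
    rw [star_mem_lag] at hu
    rw [jn_mem_lag] at hvu
    rw [ovMat_inv_mulVec hΨ h2 ((key (xc v) (xc u)).2 (hu.symm.trans hvu.2))]
    exact hvu.1
  · intro h
    set y := (ovMat Ψ (blk₂₂ Φ))⁻¹ *ᵥ (I • (blk₂₁ Φ *ᵥ xc v) + (star a + rgt b)) with hy
    have hy' := (key (xc v) y).1 (ovMat_mulVec_inv hΨ h2 _)
    refine ⟨Sum.elim (Ψ.map star *ᵥ y + I • star a) y, ?_, ?_⟩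
    · rw [star_mem_lag, zc_elim, xc_elim]
    · rw [jn_mem_lag, zc_elim, xc_elim]
      exact ⟨h, hy'⟩

/-- A direction v of the contraction extends to (v, u) on the Lagrangian of Φ, with ū on that of Ψ.
Then u has nonpositive Hermitian form, so a nonpositive form of v makes that of (v, u) nonpositive,
and strictness gives v = 0. -/
theorem isPhaseMatrix_ctrMat {Φ : Matrix (Fin (m + n)) (Fin (m + n)) ℂ} (hΦ : IsPhaseMatrix Φ)
    {Ψ : Matrix (Fin n) (Fin n) ℂ} (hΨ : IsPhaseMatrix Ψ) : IsPhaseMatrix (ctrMat Φ Ψ) := by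
  have h2 := isPhaseMatrix_blk₂₂ hΦ
  have hs : (ctrMat Φ Ψ).IsSymm := by
    have e : ((ovMat Ψ (blk₂₂ Φ))⁻¹)ᵀ = (ovMat Ψ (blk₂₂ Φ))⁻¹ := by
      rw [transpose_nonsing_inv]; congr 1; exact hΨ.sum_isSymm h2
    have e1 : (blk₁₁ Φ)ᵀ = blk₁₁ Φ := hΦ.1.submatrix _
    have e2 : (blk₁₂ Φ)ᵀ = blk₂₁ Φ := by rw [blk₁₂, transpose_submatrix, hΦ.1.eq]; rfl
    have e3 : (blk₂₁ Φ)ᵀ = blk₁₂ Φ := by rw [← e2, transpose_transpose]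
    rw [Matrix.IsSymm, ctrMat, transpose_add, transpose_smul, transpose_mul, transpose_mul, e, e1,
      e2, e3, Matrix.mul_assoc]
  refine isPhaseMatrix_of_im_pos hs fun x hx => ?_
  have h0 : ∀ {k : ℕ} (X : Matrix (Fin k) (Fin k) ℂ), (0 : Phase k) ∈ lag X 0 := fun X => by
    rw [mem_lag]
    change (0 : Fin _ → ℂ) = X *ᵥ 0 - I • 0
    simp
  have hv : (Sum.elim (ctrMat Φ Ψ *ᵥ x) x : Phase m) ∈ lag (ctrMat Φ Ψ) (ctrVec Φ 0 Ψ 0) := by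
    have e0 : (star (0 : Fin n → ℂ) + rgt (0 : Fin (m + n) → ℂ)) = 0 := by
      ext i; simp [rgt]
    have e1 : (lft (0 : Fin (m + n) → ℂ)) = 0 := rfl
    rw [mem_lag, zc_elim, xc_elim, ctrVec, e0, e1]
    simp
  rw [← ctrSet_lag hΦ _ hΨ] at hv
  obtain ⟨u, hu, hvu⟩ := hv
  have h3 := herm_sub_nonneg hΨ hu (h0 Ψ)
  rw [sub_zero, herm_star] at h3
  by_contra hle
  have h4 := eq_of_herm_sub hΦ hvu (h0 Φ) (by
    rw [sub_zero, herm_sum, jn_fstIx, jn_sndIx, herm_eq' (Sum.elim _ _), zc_elim, xc_elim]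
    linarith)
  apply hx
  have h5 := lft_xc_jn (Sum.elim (ctrMat Φ Ψ *ᵥ x) x) u
  rw [h4] at h5
  exact h5.symm

/-- The operator `f ↦ f ⊗ g`. -/
theorem exists_tensorRight (g : L2 n) : ∃ K : L2 m →L[ℂ] L2 (m + n), ∀ f, K f = tensorVec f g := by
  obtain ⟨R, hR⟩ := exists_isTensorOp (ContinuousLinearMap.id ℂ (L2 m)) (ket g)
  refine ⟨R, fun f => ?_⟩
  have := hR f unitVec
  rw [tensorVec_unitVec] at this
  rw [this, ket, ContinuousLinearMap.smulRight_apply, innerSL_apply_apply, inner_unitVec, one_smul]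
  rfl

theorem dsum_blk₁₁ (Φ : Matrix (Fin m) (Fin m) ℂ) (Ψ : Matrix (Fin n) (Fin n) ℂ) :
    blk₁₁ (dsum Φ Ψ) = Φ := by ext; simp [blk₁₁]
theorem dsum_blk₁₂ (Φ : Matrix (Fin m) (Fin m) ℂ) (Ψ : Matrix (Fin n) (Fin n) ℂ) :
    blk₁₂ (dsum Φ Ψ) = 0 := by ext; simp [blk₁₂]
theorem dsum_blk₂₁ (Φ : Matrix (Fin m) (Fin m) ℂ) (Ψ : Matrix (Fin n) (Fin n) ℂ) :
    blk₂₁ (dsum Φ Ψ) = 0 := by ext; simp [blk₂₁]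
theorem dsum_blk₂₂ (Φ : Matrix (Fin m) (Fin m) ℂ) (Ψ : Matrix (Fin n) (Fin n) ℂ) :
    blk₂₂ (dsum Φ Ψ) = Ψ := by ext; simp [blk₂₂]

theorem lft_ovMat_dsum (Φ : Matrix (Fin (m + n)) (Fin (m + n)) ℂ) (X : Matrix (Fin m) (Fin m) ℂ)
    (Y : Matrix (Fin n) (Fin n) ℂ) (x : Fin (m + n) → ℂ) : lft (ovMat (dsum X Y) Φ *ᵥ x) =
      ovMat X (blk₁₁ Φ) *ᵥ lft x - I • (blk₁₂ Φ *ᵥ rgt x) := by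
  have e : (dsum X Y).map star = dsum (X.map star) (Y.map star) := by
    ext i j
    refine Fin.addCases (fun i => ?_) (fun i => ?_) i <;>
      refine Fin.addCases (fun j => ?_) (fun j => ?_) j <;> simp
  rw [ovMat_mulVec, ovMat_mulVec, e]
  have hl : ∀ p q : Fin (m + n) → ℂ, lft (I • p - I • q) = I • lft p - I • lft q :=
    fun _ _ => rfl
  rw [hl, lft_mulVec, lft_mulVec, dsum_blk₁₁, dsum_blk₁₂, zero_mulVec]
  module

theorem rgt_ovMat_dsum (Φ : Matrix (Fin (m + n)) (Fin (m + n)) ℂ) (X : Matrix (Fin m) (Fin m) ℂ)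
    (Y : Matrix (Fin n) (Fin n) ℂ) (x : Fin (m + n) → ℂ) : rgt (ovMat (dsum X Y) Φ *ᵥ x) =
      ovMat Y (blk₂₂ Φ) *ᵥ rgt x - I • (blk₂₁ Φ *ᵥ lft x) := by
  have e : (dsum X Y).map star = dsum (X.map star) (Y.map star) := by
    ext i j
    refine Fin.addCases (fun i => ?_) (fun i => ?_) i <;>
      refine Fin.addCases (fun j => ?_) (fun j => ?_) j <;> simp
  rw [ovMat_mulVec, ovMat_mulVec, e]
  have hl : ∀ p q : Fin (m + n) → ℂ, rgt (I • p - I • q) = I • rgt p - I • rgt q :=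
    fun _ _ => rfl
  rw [hl, rgt_mulVec, rgt_mulVec, dsum_blk₂₁, dsum_blk₂₂, zero_mulVec]
  module

theorem ovMat_ctrMat (Φ : Matrix (Fin (m + n)) (Fin (m + n)) ℂ) (X : Matrix (Fin m) (Fin m) ℂ)
    (Ψ : Matrix (Fin n) (Fin n) ℂ) (x : Fin m → ℂ) : ovMat X (ctrMat Φ Ψ) *ᵥ x =
      ovMat X (blk₁₁ Φ) *ᵥ x + blk₁₂ Φ *ᵥ (ovMat Ψ (blk₂₂ Φ))⁻¹ *ᵥ blk₂₁ Φ *ᵥ x := by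
  rw [ovMat_mulVec, ovMat_mulVec, ctrMat, add_mulVec, smul_mulVec, ← mulVec_mulVec,
    ← mulVec_mulVec, smul_add, smul_smul, I_mul_I]
  module

/-- Partial inner products of Gaussian vectors are Gaussian. -/
theorem exists_inner_tensorVec_gv {Φ : Matrix (Fin (m + n)) (Fin (m + n)) ℂ} (hΦ : IsPhaseMatrix Φ)
    (b : Fin (m + n) → ℂ) {Ψ : Matrix (Fin n) (Fin n) ℂ} (hΨ : IsPhaseMatrix Ψ) (a : Fin n → ℂ) :
    ∃ c : ℂ, c ≠ 0 ∧ ∀ f : L2 m, inner ℂ (tensorVec f (gv Ψ a)) (gv Φ b) =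
      c * inner ℂ f (gv (ctrMat Φ Ψ) (ctrVec Φ b Ψ a)) := by
  have h2 := isPhaseMatrix_blk₂₂ hΦ
  have hct := isPhaseMatrix_ctrMat hΦ hΨ
  have hI := isPhaseMatrix_I (n := m)
  have hd := isPhaseMatrix_dsum hI hΨ
  set β := star a + rgt b with hβ
  set Ai := (ovMat Ψ (blk₂₂ Φ))⁻¹ with hAi
  obtain ⟨K, hK⟩ := exists_tensorRight (m := m) (gv Ψ a)
  refine ⟨gaussConst (ovMat (dsum (I • 1) Ψ) Φ) * exp (1 / 2 * (β ⬝ᵥ Ai *ᵥ β)) /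
    gaussConst (ovMat (I • 1) (ctrMat Φ Ψ)), div_ne_zero (mul_ne_zero (ovConst_ne_zero hd hΦ)
      (exp_ne_zero _)) (ovConst_ne_zero hI hct), ?_⟩
  suffices h : K.adjoint (gv Φ b) = (gaussConst (ovMat (dsum (I • 1) Ψ) Φ) *
      exp (1 / 2 * (β ⬝ᵥ Ai *ᵥ β)) / gaussConst (ovMat (I • 1) (ctrMat Φ Ψ))) •
        gv (ctrMat Φ Ψ) (ctrVec Φ b Ψ a) by
    intro f
    rw [← hK, ← ContinuousLinearMap.adjoint_inner_right, h, inner_smul_right]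
  -- On coherent vectors both sides are explicit Gaussian integrals; the quotient of their constants
  -- is the scalar c.
  refine ext_inner_coh fun w => ?_
  rw [ContinuousLinearMap.adjoint_inner_right, hK, inner_smul_right, coh, tensorVec_gv hI hΨ,
    inner_gv hd hΦ, inner_gv hI hct]
  set u := (ovMat (I • 1) (ctrMat Φ Ψ))⁻¹ *ᵥ (star w + ctrVec Φ b Ψ a) with hu
  have hu' := ovMat_mulVec_inv hI hct (star w + ctrVec Φ b Ψ a)
  rw [← hu, ovMat_ctrMat, ← hAi] at hu'
  -- Block elimination: the solution u of the reduced system, with the eliminated second block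
  -- appended, solves the full system. The exponents then differ by a term independent of w.
  have hy : ovMat (dsum (I • 1) Ψ) Φ *ᵥ Fin.append u (Ai *ᵥ (β + I • (blk₂₁ Φ *ᵥ u))) =
      star (Fin.append w a) + b := by
    refine lft_rgt_ext ?_ ?_
    · rw [lft_ovMat_dsum, lft_append, rgt_append]
      have e : lft (star (Fin.append w a) + b) = star w + lft b := by
        ext i; simp [lft]
      rw [e, mulVec_add, mulVec_add, mulVec_smul, mulVec_smul, smul_add, smul_smul, I_mul_I]
      rw [ctrVec, ← hβ, ← hAi] at hu'
      rw [eq_sub_of_add_eq hu']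
      module
    · rw [rgt_ovMat_dsum, lft_append, rgt_append, hAi, ovMat_mulVec_inv hΨ h2]
      have e : rgt (star (Fin.append w a) + b) = β := by
        ext i; simp [rgt, hβ]
      rw [e]; module
  rw [ovMat_inv_mulVec hd hΦ hy, dotProduct_lft_rgt, lft_append, rgt_append]
  have e1 : lft (star (Fin.append w a) + b) = star w + lft b := by
    ext i; simp [lft]
  have e2 : rgt (star (Fin.append w a) + b) = β := by
    ext i; simp [rgt, hβ]
  have e3 : (blk₁₂ Φ)ᵀ = blk₂₁ Φ := by rw [blk₁₂, transpose_submatrix, hΦ.1.eq]; rfl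
  have e4 : (star w + lft b) ⬝ᵥ u + β ⬝ᵥ Ai *ᵥ (β + I • (blk₂₁ Φ *ᵥ u)) =
      β ⬝ᵥ Ai *ᵥ β + (star w + ctrVec Φ b Ψ a) ⬝ᵥ u := by
    rw [ctrVec, ← hβ, ← hAi, mulVec_add, dotProduct_add, mulVec_smul, dotProduct_smul,
      ← add_assoc (star w), add_dotProduct (star w + lft b), smul_dotProduct,
      mulVec_dotProduct_eq, e3, dotProduct_comm (Ai *ᵥ β), hAi, ovMat_inv_symm hΨ h2 (blk₂₁ Φ *ᵥ u) β]
    simp only [smul_eq_mul]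
    ring
  rw [e1, e2, e4, mul_add, exp_add]
  field_simp [ovConst_ne_zero hI hct]

end

section

variable {n m k : ℕ}

/-! ### Operators represented by relations -/

/-- `T` sends Gaussian vectors to Gaussian vectors, as the relation `R` prescribes. -/
def Fwd (T : L2 n →L[ℂ] L2 m) (R : Set (Phase n × Phase m)) : Prop :=
  ∀ (Φ : Matrix (Fin n) (Fin n) ℂ) (b : Fin n → ℂ), IsPhaseMatrix Φ →
    ∃ (Φ' : Matrix (Fin m) (Fin m) ℂ) (b' : Fin m → ℂ) (c : ℂ), IsPhaseMatrix Φ' ∧ c ≠ 0 ∧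
      T (gv Φ b) = c • gv Φ' b' ∧ relImage R (lag Φ b) = lag Φ' b'

/-- The positive affine Lagrangian relation `R` represents the operator `T`. -/
structure Rep (T : L2 n →L[ℂ] L2 m) (R : Set (Phase n × Phase m)) : Prop where
  posAffLag : IsPosAffLag R
  fwd : Fwd T R
  -- The scalars in the forward condition may depend on the vector. The condition on the adjoint
  -- ties them together in the proofs for tensor products and of faithfulness.
  bwd : Fwd T.adjoint (dag R)

theorem Fwd.smul {T : L2 n →L[ℂ] L2 m} {R : Set (Phase n × Phase m)} (h : Fwd T R) {c : ℂ}
    (hc : c ≠ 0) : Fwd (c • T) R := by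
  intro Φ b hΦ
  obtain ⟨Φ', b', d, h1, h2, h3, h4⟩ := h Φ b hΦ
  exact ⟨Φ', b', c * d, h1, mul_ne_zero hc h2, by
    rw [_root_.smul_apply, h3, smul_smul], h4⟩

theorem Rep.smul {T : L2 n →L[ℂ] L2 m} {R : Set (Phase n × Phase m)} (h : Rep T R) {c : ℂ}
    (hc : c ≠ 0) : Rep (c • T) R where
  posAffLag := h.posAffLag
  fwd := h.fwd.smul hc
  bwd := by
    have : (c • T).adjoint = (starRingEnd ℂ c) • T.adjoint := map_smulₛₗ _ c T
    rw [this]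
    exact h.bwd.smul (by simpa using hc)

theorem Rep.adjoint {T : L2 n →L[ℂ] L2 m} {R : Set (Phase n × Phase m)} (h : Rep T R) :
    Rep T.adjoint (dag R) where
  posAffLag := isPosAffLag_dag h.posAffLag
  fwd := h.bwd
  bwd := by rw [ContinuousLinearMap.adjoint_adjoint, dag_dag]; exact h.fwd

theorem Fwd.comp {S : L2 m →L[ℂ] L2 k} {T : L2 n →L[ℂ] L2 m} {R' : Set (Phase m × Phase k)}
    {R : Set (Phase n × Phase m)} (hS : Fwd S R') (hT : Fwd T R) :
    Fwd (S.comp T) (relComp R' R) := by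
  intro Φ b hΦ
  obtain ⟨Φ', b', c, h1, h2, h3, h4⟩ := hT Φ b hΦ
  obtain ⟨Φ'', b'', d, k1, k2, k3, k4⟩ := hS Φ' b' h1
  refine ⟨Φ'', b'', c * d, k1, mul_ne_zero h2 k2, ?_, ?_⟩
  · rw [ContinuousLinearMap.comp_apply, h3, map_smul, k3, smul_smul]
  · rw [relImage_relComp, h4, k4]

theorem Rep.comp {S : L2 m →L[ℂ] L2 k} {T : L2 n →L[ℂ] L2 m} {R' : Set (Phase m × Phase k)}
    {R : Set (Phase n × Phase m)} (hS : Rep S R') (hT : Rep T R) :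
    Rep (S.comp T) (relComp R' R) where
  posAffLag := isPosAffLag_relComp hS.posAffLag hT.posAffLag
  fwd := hS.fwd.comp hT.fwd
  bwd := by
    rw [ContinuousLinearMap.adjoint_comp, dag_relComp]
    exact hT.bwd.comp hS.bwd

theorem relImage_relId (A : Set (Phase n)) : relImage (relId n) A = A := by
  ext v
  constructor
  · rintro ⟨u, hu, h⟩
    have h : u = v := h
    exact h ▸ hu
  · exact fun h => ⟨v, h, rfl⟩

theorem fwd_id (n : ℕ) : Fwd (ContinuousLinearMap.id ℂ (L2 n)) (relId n) := fun Φ b hΦ =>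
  ⟨Φ, b, 1, hΦ, one_ne_zero, (one_smul ℂ _).symm, relImage_relId _⟩

theorem rep_id (n : ℕ) : Rep (ContinuousLinearMap.id ℂ (L2 n)) (relId n) where
  posAffLag := isPosAffLag_relId n
  fwd := fwd_id n
  bwd := by
    have h : dag (relId n) = relId n := by
      ext ⟨u, v⟩
      change star v = star u ↔ u = v
      rw [star_inj, eq_comm]
    have h' : (ContinuousLinearMap.id ℂ (L2 n)).adjoint = ContinuousLinearMap.id ℂ (L2 n) :=
      ContinuousLinearMap.adjoint_id
    rw [h, h']
    exact fwd_id n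

theorem flip_mulVec (Φ : Matrix (Fin (n + m)) (Fin (n + m)) ℂ) (x : Fin (n + m) → ℂ) :
    flipMat Φ *ᵥ (fun i => x (finAddFlip i)) = fun i => (Φ *ᵥ x) (finAddFlip i) := by
  ext i
  simp only [flipMat, mulVec, dotProduct, submatrix_apply]
  exact Equiv.sum_comp (finAddFlip (m := m) (n := n)) fun j => Φ (finAddFlip i) j * x j

/-- Exchange of the two groups of modes in phase space. -/
def swapPh (v : Phase (n + m)) : Phase (m + n) := fun i => v (Sum.map finAddFlip finAddFlip i)

theorem swapPh_fst (v : Phase (n + m)) : swapPh v ∘ fstIx m n = v ∘ sndIx n m := by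
  ext i; rcases i with i | i <;> simp [swapPh, fstIx, sndIx]

theorem swapPh_snd (v : Phase (n + m)) : swapPh v ∘ sndIx m n = v ∘ fstIx n m := by
  ext i; rcases i with i | i <;> simp [swapPh, fstIx, sndIx]

theorem mem_relSwap {u : Phase (n + m)} {v : Phase (m + n)} :
    (u, v) ∈ relSwap n m ↔ v = swapPh u := by
  constructor
  · rintro ⟨h1, h2⟩
    exact phase_ext (h1.trans (swapPh_fst u).symm) (h2.trans (swapPh_snd u).symm)
  · rintro rfl
    exact ⟨swapPh_fst u, swapPh_snd u⟩

theorem swapPh_swapPh (v : Phase (n + m)) : swapPh (swapPh v) = v :=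
  phase_ext (by rw [swapPh_fst, swapPh_snd]) (by rw [swapPh_snd, swapPh_fst])

theorem swapPh_mem_lag {Φ : Matrix (Fin (n + m)) (Fin (n + m)) ℂ} {b : Fin (n + m) → ℂ}
    {v : Phase (n + m)} :
    swapPh v ∈ lag (flipMat Φ) (fun i => b (finAddFlip i)) ↔ v ∈ lag Φ b := by
  rw [mem_lag, mem_lag]
  have e1 : zc (swapPh v) = fun i => zc v (finAddFlip i) := rfl
  have e2 : xc (swapPh v) = fun i => xc v (finAddFlip i) := rfl
  rw [e1, e2, flip_mulVec]
  constructor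
  · intro h
    ext i
    have e : finAddFlip (finAddFlip i) = i := by
      refine Fin.addCases (fun i => ?_) (fun i => ?_) i <;> simp
    have := congrFun h (finAddFlip i)
    simpa [e] using this
  · intro h
    ext i
    rw [h]
    rfl

theorem relImage_relSwap (Φ : Matrix (Fin (n + m)) (Fin (n + m)) ℂ) (b : Fin (n + m) → ℂ) :
    relImage (relSwap n m) (lag Φ b) = lag (flipMat Φ) (fun i => b (finAddFlip i)) := by
  ext v
  constructor
  · rintro ⟨u, hu, huv⟩
    rw [mem_relSwap.1 huv, swapPh_mem_lag]
    exact hu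
  · intro h
    refine ⟨swapPh v, ?_, mem_relSwap.2 (swapPh_swapPh v).symm⟩
    rwa [← swapPh_mem_lag, swapPh_swapPh]

theorem fwd_swap (n m : ℕ) : Fwd (swapOp n m) (relSwap n m) := fun Φ b hΦ =>
  ⟨_, _, 1, isPhaseMatrix_flipMat hΦ, one_ne_zero, by rw [swapOp_gv hΦ, one_smul],
    relImage_relSwap Φ b⟩

theorem rep_swap (n m : ℕ) : Rep (swapOp n m) (relSwap n m) where
  posAffLag := isPosAffLag_relSwap n m
  fwd := fwd_swap n m
  bwd := by
    have h : dag (relSwap n m) = relSwap m n := by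
      ext ⟨u, v⟩
      rw [mem_dag, mem_relSwap, mem_relSwap]
      have e : swapPh (star v) = star (swapPh v) := rfl
      rw [e, star_inj]
      constructor
      · rintro rfl; rw [swapPh_swapPh]
      · rintro rfl; rw [swapPh_swapPh]
    rw [h, adjoint_swapOp]
    exact fwd_swap m n

theorem adjoint_ket (φ : L2 n) : (ket φ).adjoint = bra φ := by
  symm
  rw [ContinuousLinearMap.eq_adjoint_iff]
  intro x y
  rw [bra, ket, ContinuousLinearMap.smulRight_apply, ContinuousLinearMap.smulRight_apply,
    innerSL_apply_apply, innerSL_apply_apply, inner_smul_left, inner_smul_right, inner_conj_symm,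
    mul_comm]

theorem ket_unitVec (φ : L2 n) : ket φ unitVec = φ := by
  rw [ket, ContinuousLinearMap.smulRight_apply, innerSL_apply_apply, inner_unitVec, one_smul]

theorem mem_lag_fin_zero (Φ : Matrix (Fin 0) (Fin 0) ℂ) (b : Fin 0 → ℂ) (v : Phase 0) :
    v ∈ lag Φ b := mem_lag.2 (Subsingleton.elim _ _)

/-- The relational form of a nonzero overlap: the position of the point solves the system with the
invertible matrix `ovMat Φ Ψ`. -/
theorem exists_mem_lag_star_mem_lag {Φ Ψ : Matrix (Fin n) (Fin n) ℂ} (hΦ : IsPhaseMatrix Φ)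
    (hΨ : IsPhaseMatrix Ψ) (b a : Fin n → ℂ) : ∃ v, v ∈ lag Ψ a ∧ star v ∈ lag Φ b := by
  set y := (ovMat Φ Ψ)⁻¹ *ᵥ (star b + a) with hy
  have h := ovMat_mulVec_inv hΦ hΨ (star b + a)
  rw [← hy, ovMat_mulVec] at h
  refine ⟨Sum.elim (Ψ *ᵥ y - I • a) y, rfl, ?_⟩
  rw [star_mem_lag, zc_elim, xc_elim]
  have h' := congrArg (I • ·) h
  simp only [smul_sub, smul_add, smul_smul, I_mul_I, neg_smul, one_smul] at h'
  linear_combination h'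

theorem rep_ket {φ : L2 n} {Φ : Matrix (Fin n) (Fin n) ℂ} {s t : Fin n → ℝ}
    (h : IsGaussianWith φ Φ s t) : Rep (ket φ) (stateRel Φ s t) where
  posAffLag := by rw [stateRel_eq]; exact isPosAffLag_lagRel h.1 _
  fwd := by
    intro Φ₀ b₀ _
    obtain ⟨c, hc, e⟩ := h.eq_smul
    refine ⟨Φ, lin Φ s t, c, h.1, hc, by rw [gv_fin_zero, ket_unitVec, e], ?_⟩
    rw [stateRel_eq]
    ext v
    constructor
    · rintro ⟨u, -, hv⟩; exact hv
    · exact fun hv => ⟨0, mem_lag_fin_zero _ _ _, hv⟩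
  bwd := by
    intro Ψ a hΨ
    obtain ⟨c, hc, e⟩ := h.eq_smul
    refine ⟨0, 0, inner ℂ φ (gv Ψ a), isPhaseMatrix_fin_zero _, ?_, ?_, ?_⟩
    · rw [e, inner_smul_left]
      exact mul_ne_zero (by simpa using hc) (inner_gv_ne_zero h.1 hΨ _ _)
    · rw [adjoint_ket, gv_fin_zero]; rfl
    · ext v
      refine ⟨fun _ => mem_lag_fin_zero _ _ _, fun _ => ?_⟩
      obtain ⟨v', h1, h2⟩ := exists_mem_lag_star_mem_lag h.1 hΨ (lin Φ s t) a
      refine ⟨v', h1, ?_⟩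
      rw [mem_dag, stateRel_eq]
      exact h2

theorem rep_bra {φ : L2 n} {Φ : Matrix (Fin n) (Fin n) ℂ} {s t : Fin n → ℝ}
    (h : IsGaussianWith φ Φ s t) : Rep (bra φ) (effectRel Φ s t) := by
  rw [effectRel_eq, ← adjoint_ket]
  exact (rep_ket h).adjoint

/-! ### Tensor products of represented operators -/

/-- Every point u lies on the Lagrangian of some coherent vector, whose image under R is again
strictly positive. -/
theorem Fwd.strict {T : L2 n →L[ℂ] L2 m} {R : Set (Phase n × Phase m)} (h : Fwd T R) {u : Phase n}
    {v v' : Phase m} (hv : (u, v) ∈ R) (hv' : (u, v') ∈ R) (hle : herm (v - v') ≤ 0) : v = v' := by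
  have hu := mem_lag_self (I • 1) u
  obtain ⟨Φ', b', -, h1, -, -, h4⟩ := h (I • 1) (I • (zc u - (I • 1) *ᵥ xc u)) isPhaseMatrix_I
  refine eq_of_herm_sub (b := b') h1 ?_ ?_ hle
  · rw [← h4]; exact ⟨u, hu, hv⟩
  · rw [← h4]; exact ⟨u, hu, hv'⟩

section
variable {n' m' : ℕ} {T : L2 n →L[ℂ] L2 m} {S : L2 n' →L[ℂ] L2 m'}
  {Q : L2 (n + n') →L[ℂ] L2 (m + m')} {R : Set (Phase n × Phase m)} {R' : Set (Phase n' × Phase m')}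

/-- The relational counterpart of ⟨f ⊗ g, (T ⊗ S)φ⟩ = ⟨f, T⟨S*g, φ⟩⟩, with the inner bracket a
partial inner product. -/
theorem ctrSet_relImage_relSum (A : Set (Phase (n + n'))) (B : Set (Phase m')) :
    ctrSet (relImage (relSum R R') A) B = relImage R (ctrSet A (relImage (dag R') B)) := by
  ext v
  constructor
  · rintro ⟨v', hv', u, hu, h1, h2⟩
    simp only [jn_fstIx, jn_sndIx] at h1 h2
    refine ⟨u ∘ fstIx n n', ⟨u ∘ sndIx n n', ⟨star v', hv', ?_⟩, ?_⟩, h1⟩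
    · rw [mem_dag, star_star, star_star]; exact h2
    · rw [jn_eta]; exact hu
  · rintro ⟨u, ⟨u', ⟨w, hw, hwu⟩, hu⟩, h1⟩
    rw [mem_dag, star_star] at hwu
    refine ⟨star w, by rwa [star_star], jn u u', hu, ?_⟩
    simp only [relSum, Set.mem_ofPred_eq, jn_fstIx, jn_sndIx]
    exact ⟨h1, hwu⟩

theorem relImage_relSum_nonempty (hT : Fwd T R) (hS : Fwd S.adjoint (dag R'))
    {Φ : Matrix (Fin (n + n')) (Fin (n + n')) ℂ} (hΦ : IsPhaseMatrix Φ) (b : Fin (n + n') → ℂ) :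
    (relImage (relSum R R') (lag Φ b)).Nonempty := by
  obtain ⟨Ψ, a, -, h1, -, -, h4⟩ := hS (I • 1) 0 isPhaseMatrix_I
  obtain ⟨Θ, d, -, k1, -, -, k4⟩ := hT _ (ctrVec Φ b Ψ a) (isPhaseMatrix_ctrMat hΦ h1)
  rw [← ctrSet_lag hΦ b h1, ← h4, ← ctrSet_relImage_relSum] at k4
  have : (Sum.elim (Θ *ᵥ 0 - I • d) 0 : Phase m) ∈ lag Θ d := rfl
  rw [← k4] at this
  obtain ⟨u, -, hu⟩ := this
  exact ⟨_, hu⟩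

/-- Moving S to the coherent vector, contracting, and applying T gives a Gaussian vector in the
first modes. The same contraction of `gv Y y` has the same Lagrangian, so the two are proportional.
The constant depends on w but not on f. -/
theorem exists_inner_coh_right (hT : Fwd T R) (hS : Fwd S.adjoint (dag R')) (hQ : IsTensorOp Q T S)
    {Φ : Matrix (Fin (n + n')) (Fin (n + n')) ℂ} (hΦ : IsPhaseMatrix Φ) {b : Fin (n + n') → ℂ}
    {Y : Matrix (Fin (m + m')) (Fin (m + m')) ℂ} (hY : IsPhaseMatrix Y) {y : Fin (m + m') → ℂ}
    (h : relImage (relSum R R') (lag Φ b) = lag Y y) (w : Fin m' → ℂ) :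
    ∃ c : ℂ, c ≠ 0 ∧ ∀ f, inner ℂ (tensorVec f (coh w)) (Q (gv Φ b)) =
      c * inner ℂ (tensorVec f (coh w)) (gv Y y) := by
  obtain ⟨Ψ, a, c₁, h1, h2, h3, h4⟩ := hS (I • 1) w isPhaseMatrix_I
  obtain ⟨c₂, g1, g2⟩ := exists_inner_tensorVec_gv hΦ b h1 a
  obtain ⟨Θ, d, c₃, k1, k2, k3, k4⟩ := hT _ (ctrVec Φ b Ψ a) (isPhaseMatrix_ctrMat hΦ h1)
  obtain ⟨c₄, l1, l2⟩ := exists_inner_tensorVec_gv hY y (isPhaseMatrix_I (n := m')) w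
  rw [← ctrSet_lag hΦ b h1, ← h4, ← ctrSet_relImage_relSum, h, ctrSet_lag hY y isPhaseMatrix_I]
    at k4
  obtain ⟨rfl, rfl⟩ := lag_injective k4
  refine ⟨(starRingEnd ℂ) c₁ * c₂ * c₃ / c₄, div_ne_zero (mul_ne_zero (mul_ne_zero
    (by simpa using h2) g1) k2) l1, fun f => ?_⟩
  have e1 : inner ℂ (tensorVec f (coh w)) (gv Y y) = _ := l2 f
  rw [← ContinuousLinearMap.adjoint_inner_left, hQ.adjoint, e1]
  change inner ℂ (tensorVec _ (S.adjoint (gv (I • 1) w))) _ = _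
  rw [h3, tensorVec_smul_right, inner_smul_left, g2, ContinuousLinearMap.adjoint_inner_left, k3,
    inner_smul_right]
  field_simp

/-- The candidate vector is read off from the image Lagrangian. Contraction with coherent vectors in
the second factor, and after exchanging the factors in the first, shows proportionality with two
families of constants, which must coincide. -/
theorem fwd_tensor (hT : Rep T R) (hS : Rep S R') (hQ : IsTensorOp Q T S) :
    Fwd Q (relSum R R') := by
  intro Φ b hΦ
  have hst : ∀ u v v', (u, v) ∈ relSum R R' → (u, v') ∈ relSum R R' → herm (v - v') ≤ 0 →
      v = v' := by
    rintro u v v' ⟨h1, h2⟩ ⟨k1, k2⟩ hle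
    have l1 := hT.posAffLag.herm_sub_le h1 k1
    have l2 := hS.posAffLag.herm_sub_le h2 k2
    rw [sub_self, herm_zero] at l1 l2
    rw [herm_sum] at hle
    have e1 : (v - v') ∘ fstIx m m' = v ∘ fstIx m m' - v' ∘ fstIx m m' := rfl
    have e2 : (v - v') ∘ sndIx m m' = v ∘ sndIx m m' - v' ∘ sndIx m m' := rfl
    rw [e1, e2] at hle
    exact phase_ext (hT.fwd.strict h1 k1 (by simp only at l1 l2; linarith))
      (hS.fwd.strict h2 k2 (by simp only at l1 l2; linarith))
  obtain ⟨Y, y, hY, hYe⟩ := exists_lag_relImage (isPosAffLag_relSum hT.posAffLag hS.posAffLag) hst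
    hΦ (relImage_relSum_nonempty hT.fwd hS.bwd hΦ b)
  have hr := exists_inner_coh_right hT.fwd hS.bwd hQ hΦ hY hYe
  have hQ' : IsTensorOp ((swapOp m m').comp (Q.comp (swapOp n' n))) S T := by
    intro f g
    simp only [ContinuousLinearMap.comp_apply]
    rw [swapOp_tensorVec, hQ, swapOp_tensorVec]
  have hYe' : relImage (relSum R' R) (lag (flipMat Φ) (fun i => b (finAddFlip i))) =
      lag (flipMat Y) (fun i => y (finAddFlip i)) := by
    rw [← relImage_relSwap, ← relImage_relSwap, ← hYe, ← relImage_relComp, ← relImage_relComp,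
      relIsProp.swap_natural (T := R) (S := R') rfl rfl]
  have hl := exists_inner_coh_right hS.fwd hT.bwd hQ' (isPhaseMatrix_flipMat hΦ)
    (isPhaseMatrix_flipMat hY) hYe'
  have hl' : ∀ w : Fin m → ℂ, ∃ c : ℂ, c ≠ 0 ∧ ∀ f, inner ℂ (tensorVec (coh w) f) (Q (gv Φ b)) =
      c * inner ℂ (tensorVec (coh w) f) (gv Y y) := by
    intro w
    obtain ⟨c, hc, h⟩ := hl w
    refine ⟨c, hc, fun f => ?_⟩
    have := h f
    have e : swapOp n' n (swapOp n n' (gv Φ b)) = gv Φ b := by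
      have := congrArg (· (gv Φ b)) (congrArg (fun A => A.comp (swapOp n n'))
        (adjoint_swapOp n n').symm)
      simp only [ContinuousLinearMap.comp_apply] at this
      rw [this]
      refine ext_inner_coh fun w => ?_
      rw [ContinuousLinearMap.adjoint_inner_right, inner_swapOp]
    rw [ContinuousLinearMap.comp_apply, ContinuousLinearMap.comp_apply, ← swapOp_gv hΦ,
      ← swapOp_gv hY, ← swapOp_tensorVec, inner_swapOp, inner_swapOp, e] at this
    exact this
  -- The constant for w' = 0 on the right equals the constant for every w on the left, as both occur
  -- in the same nonzero overlap.
  obtain ⟨c, hc, hcr⟩ := hr 0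
  refine ⟨Y, y, c, hY, hc, ?_, hYe⟩
  refine ext_inner_tensorVec fun w w' => ?_
  obtain ⟨d, hd, hdl⟩ := hl' w
  have hne : ∀ v, inner ℂ (tensorVec (coh w) (coh v)) (gv Y y) ≠ 0 := fun v => by
    rw [tensorVec_coh]; exact inner_gv_ne_zero isPhaseMatrix_I hY _ _
  have hcd : c = d := mul_right_cancel₀ (hne 0) ((hcr _).symm.trans (hdl _))
  rw [inner_smul_right, hdl, hcd]

theorem Rep.tensor (hT : Rep T R) (hS : Rep S R') (hQ : IsTensorOp Q T S) :
    Rep Q (relSum R R') where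
  posAffLag := isPosAffLag_relSum hT.posAffLag hS.posAffLag
  fwd := fwd_tensor hT hS hQ
  bwd := by
    rw [dag_relSum]
    exact fwd_tensor hT.adjoint hS.adjoint hQ.adjoint

end

/-! ### Faithfulness -/

/-- On coherent vectors the two operators differ by a scalar depending on the input, and their
adjoints by one depending on the output. A matrix element sees both, and none vanishes, so the
scalar is constant. -/
theorem Rep.exists_eq_smul {T T' : L2 n →L[ℂ] L2 m} {R : Set (Phase n × Phase m)} (h : Rep T R)
    (h' : Rep T' R) : ∃ c : ℂ, c ≠ 0 ∧ T' = c • T := by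
  have key : ∀ {n m : ℕ} {T T' : L2 n →L[ℂ] L2 m} {R : Set (Phase n × Phase m)}, Fwd T R →
      Fwd T' R → ∀ a, ∃ c : ℂ, c ≠ 0 ∧ T' (coh a) = c • T (coh a) := by
    intro n m T T' R h h' a
    obtain ⟨Φ, b, c, h1, h2, h3, h4⟩ := h (I • 1) a isPhaseMatrix_I
    obtain ⟨Φ', b', c', k1, k2, k3, k4⟩ := h' (I • 1) a isPhaseMatrix_I
    obtain ⟨rfl, rfl⟩ := lag_injective (h4.symm.trans k4)
    refine ⟨c' / c, div_ne_zero k2 h2, ?_⟩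
    change T' (gv _ _) = _ • T (gv _ _)
    rw [h3, k3, smul_smul, div_mul_cancel₀ _ h2]
  have hne : ∀ w a, inner ℂ (coh w) (T (coh a)) ≠ 0 := fun w a => by
    obtain ⟨Φ, b, c, h1, h2, h3, h4⟩ := h.fwd (I • 1) a isPhaseMatrix_I
    have h3 : T (coh a) = _ := h3
    rw [h3, inner_smul_right]
    exact mul_ne_zero h2 (inner_gv_ne_zero isPhaseMatrix_I h1 _ _)
  obtain ⟨c, hc, h0⟩ := key h.fwd h'.fwd 0
  refine ⟨c, hc, ext_coh fun a => ext_inner_coh fun w => ?_⟩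
  obtain ⟨d, -, hd⟩ := key h.bwd h'.bwd w
  have e : ∀ a, inner ℂ (coh w) (T' (coh a)) = (starRingEnd ℂ) d * inner ℂ (coh w) (T (coh a)) := by
    intro a
    rw [← ContinuousLinearMap.adjoint_inner_left, hd, inner_smul_left,
      ContinuousLinearMap.adjoint_inner_left]
  have e0 := e 0
  rw [h0, inner_smul_right] at e0
  rw [_root_.smul_apply, inner_smul_right, e, mul_right_cancel₀ (hne w 0) e0]

/-! ### Uniqueness of the relation -/

/-- The derivative at 0 of a constant function is zero. A half line suffices as hypothesis, which
allows square roots as arguments below. -/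
theorem eq_zero_of_exp_eq_one {α : ℂ} (h : ∀ s : ℝ, 0 ≤ s → exp (s * α) = 1) : α = 0 := by
  have h' : ∀ s : ℝ, exp (s * α) = 1 := fun s => by
    rcases le_total 0 s with hs | hs
    · exact h s hs
    · have := h (-s) (by linarith)
      rwa [ofReal_neg, neg_mul, exp_neg, inv_eq_one] at this
  have h1 : HasDerivAt (fun s : ℝ => exp (s * α)) (exp ((0 : ℝ) * α) * (1 * α)) 0 :=
    (Complex.ofRealCLM.hasDerivAt.mul_const α).cexp
  have h2 : HasDerivAt (fun s : ℝ => exp (s * α)) 0 0 := by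
    simp only [h']; exact hasDerivAt_const _ _
  simpa using h1.unique h2

theorem eq_of_exp_quadratic_eq {α α' β β' : ℂ}
    (h : ∀ s : ℝ, exp (s ^ 2 * α + s * β) = exp (s ^ 2 * α' + s * β')) : α = α' ∧ β = β' := by
  have h1 : ∀ s : ℝ, exp (s ^ 2 * (α - α') + s * (β - β')) = 1 := fun s => by
    rw [show (s ^ 2 * (α - α') + s * (β - β') : ℂ) = (s ^ 2 * α + s * β) - (s ^ 2 * α' + s * β') by
      ring, exp_sub, h, div_self (exp_ne_zero _)]
  -- The product of the values at √s and -√s removes the odd part of the exponent.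
  have h2 : 2 * (α - α') = 0 := eq_zero_of_exp_eq_one fun s hs => by
    have e1 := h1 (Real.sqrt s)
    have e2 := h1 (-Real.sqrt s)
    have hsq : ((Real.sqrt s : ℝ) : ℂ) ^ 2 = s := by exact_mod_cast Real.sq_sqrt hs
    rw [← mul_one (1 : ℂ)]
    nth_rewrite 1 [← e1]
    rw [← e2, ← exp_add]
    congr 1
    push_cast
    linear_combination (-2 * (α - α')) * hsq
  have h2 : α - α' = 0 := by simpa using h2
  have h3 : β - β' = 0 := eq_zero_of_exp_eq_one fun s _ => by
    have := h1 s
    rwa [h2, mul_zero, zero_add] at this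
  exact ⟨sub_eq_zero.1 h2, sub_eq_zero.1 h3⟩

theorem eq_of_gaussFun_eq {A A' : Matrix (Fin n) (Fin n) ℂ} {b b' : Fin n → ℂ} (hA : A.IsSymm)
    (hA' : A'.IsSymm) (h : ∀ x, gaussFun A b x = gaussFun A' b' x) : A = A' ∧ b = b' := by
  have h1 : ∀ x : Fin n → ℝ, cvec x ⬝ᵥ A *ᵥ cvec x = cvec x ⬝ᵥ A' *ᵥ cvec x ∧
      b ⬝ᵥ cvec x = b' ⬝ᵥ cvec x := by
    intro x
    have h2 := eq_of_exp_quadratic_eq (α := -(1 / 2) * (cvec x ⬝ᵥ A *ᵥ cvec x))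
      (α' := -(1 / 2) * (cvec x ⬝ᵥ A' *ᵥ cvec x)) (β := b ⬝ᵥ cvec x) (β' := b' ⬝ᵥ cvec x) (by
      intro s
      have := h (s • x)
      have e : cvec (s • x) = (s : ℂ) • cvec x := by ext i; simp [cvec]
      simp only [gaussFun, e, mulVec_smul, dotProduct_smul, smul_dotProduct, smul_eq_mul] at this
      convert this using 2 <;> ring)
    exact ⟨mul_left_cancel₀ (by norm_num) h2.1, h2.2⟩
  have hs : ∀ i, cvec (Pi.single i 1 : Fin n → ℝ) = Pi.single i 1 := fun i => by
    ext j; by_cases hj : j = i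
    · subst hj; simp [cvec]
    · simp [cvec, hj]
  have hadd : ∀ x y : Fin n → ℝ, cvec (x + y) = cvec x + cvec y := fun x y => by
    ext j; simp [cvec]
  constructor
  · ext i j
    have e1 := (h1 (Pi.single i 1 + Pi.single j 1)).1
    have e2 := (h1 (Pi.single i 1)).1
    have e3 := (h1 (Pi.single j 1)).1
    rw [hadd, hs, hs] at e1
    rw [hs] at e2 e3
    simp [mulVec_add, dotProduct_add, add_dotProduct] at e1 e2 e3
    have e4 := hA.apply i j
    have e5 := hA'.apply i j
    linear_combination (1 / 2) * (e1 - e2 - e3 - e4 + e5)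
  · ext i
    have e := (h1 (Pi.single i 1)).2
    rw [hs] at e
    simpa using e

/-- Wave functions are continuous, so equality holds at every point, and the value 1 at the origin
forces c = 1. -/
theorem gv_eq_smul {Φ Φ' : Matrix (Fin n) (Fin n) ℂ} (hΦ : IsPhaseMatrix Φ)
    (hΦ' : IsPhaseMatrix Φ') {b b' : Fin n → ℂ} {c : ℂ} (h : gv Φ b = c • gv Φ' b') :
    Φ = Φ' ∧ b = b' := by
  have h1 : wave Φ b =ᵐ[volume] c • wave Φ' b' := by
    have e1 := Lp.coeFn_smul c (gv Φ' b')
    filter_upwards [coe_gv hΦ b, coe_gv hΦ' b', e1] with x h1 h2 h3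
    rw [← h1, h, h3, Pi.smul_apply, Pi.smul_apply, h2]
  have h2 : wave Φ b = c • wave Φ' b' :=
    (Continuous.ae_eq_iff_eq volume (continuous_wave Φ b) ((continuous_wave Φ' b').const_smul c)).1 h1
  have h0 : ∀ (Φ : Matrix (Fin n) (Fin n) ℂ) b, wave Φ b 0 = 1 := fun Φ b => by
    have : cvec (0 : Fin n → ℝ) = 0 := by ext; simp [cvec]
    simp [wave, gaussFun, this]
  have hc : c = 1 := by
    have := congrFun h2 0
    rw [Pi.smul_apply, h0, h0] at this
    simpa using this.symm
  rw [hc, one_smul] at h2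
  have hs : ∀ {Φ : Matrix (Fin n) (Fin n) ℂ}, IsPhaseMatrix Φ → (-(I • Φ)).IsSymm := fun h => by
    rw [Matrix.IsSymm, transpose_neg, transpose_smul, h.1.eq]
  obtain ⟨h3, h4⟩ := eq_of_gaussFun_eq (hs hΦ) (hs hΦ') (congrFun h2)
  exact ⟨smul_right_injective _ I_ne_zero (neg_injective h3), h4⟩

/-- The phase matrix of a two-mode squeezed state. -/
def pairMat (n : ℕ) : Matrix (Fin (n + n)) (Fin (n + n)) ℂ :=
  Matrix.of fun i j => Fin.addCases
    (fun i => Fin.addCases (fun j => 2 * I * (1 : Matrix (Fin n) (Fin n) ℂ) i j)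
      (fun j => -I * (1 : Matrix (Fin n) (Fin n) ℂ) i j) j)
    (fun i => Fin.addCases (fun j => -I * (1 : Matrix (Fin n) (Fin n) ℂ) i j)
      (fun j => 2 * I * (1 : Matrix (Fin n) (Fin n) ℂ) i j) j) i

theorem pairMat_blk₁₁ : blk₁₁ (pairMat n) = (2 * I) • 1 := by
  ext; simp only [blk₁₁, pairMat, submatrix_apply, of_apply, Fin.addCases_left,
    Matrix.smul_apply, smul_eq_mul]
theorem pairMat_blk₁₂ : blk₁₂ (pairMat n) = (-I) • 1 := by
  ext; simp only [blk₁₂, pairMat, submatrix_apply, of_apply, Fin.addCases_left,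
    Fin.addCases_right, Matrix.smul_apply, smul_eq_mul]
theorem pairMat_blk₂₁ : blk₂₁ (pairMat n) = (-I) • 1 := by
  ext; simp only [blk₂₁, pairMat, submatrix_apply, of_apply, Fin.addCases_left,
    Fin.addCases_right, Matrix.smul_apply, smul_eq_mul]
theorem pairMat_blk₂₂ : blk₂₂ (pairMat n) = (2 * I) • 1 := by
  ext; simp only [blk₂₂, pairMat, submatrix_apply, of_apply, Fin.addCases_right,
    Matrix.smul_apply, smul_eq_mul]

theorem re_star_dotProduct_self (x : Fin n → ℂ) :
    (star x ⬝ᵥ x).re = ∑ i, Complex.normSq (x i) := by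
  simp [dotProduct, Complex.normSq_apply]

theorem isPhaseMatrix_pairMat (n : ℕ) : IsPhaseMatrix (pairMat n) := by
  refine isPhaseMatrix_of_im_pos ?_ fun x hx => ?_
  · ext i j
    refine Fin.addCases (fun i => ?_) (fun i => ?_) i <;>
      refine Fin.addCases (fun j => ?_) (fun j => ?_) j <;>
      simp only [pairMat, transpose_apply, of_apply, Fin.addCases_left, Fin.addCases_right,
        Matrix.one_apply, eq_comm]
  · have e1 : lft (star x) = star (lft x) := rfl
    have e2 : rgt (star x) = star (rgt x) := rfl
    have hpos : 0 < (star x ⬝ᵥ x).re := by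
      rw [re_star_dotProduct_self]
      obtain ⟨i, hi⟩ := Function.ne_iff.1 hx
      exact Finset.sum_pos' (fun i _ => Complex.normSq_nonneg _)
        ⟨i, Finset.mem_univ i, Complex.normSq_pos.2 hi⟩
    -- The form is 2|p|² + 2|q|² - 2 Re p̄·q = |p|² + |q|² + |p - q|² for the two halves p, q of x.
    have hd : 0 ≤ (star (lft x - rgt x) ⬝ᵥ (lft x - rgt x)).re := by
      rw [re_star_dotProduct_self]
      exact Finset.sum_nonneg fun i _ => Complex.normSq_nonneg _
    rw [dotProduct_lft_rgt, lft_mulVec, rgt_mulVec, pairMat_blk₁₁, pairMat_blk₁₂, pairMat_blk₂₁,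
      pairMat_blk₂₂, e1, e2]
    rw [dotProduct_lft_rgt, e1, e2] at hpos
    simp only [smul_mulVec, one_mulVec, dotProduct_add, dotProduct_smul, smul_eq_mul, star_sub,
      sub_dotProduct, dotProduct_sub] at hd ⊢
    simp at hd hpos ⊢
    linarith

theorem jn_mem_lag_pairMat {u u' : Phase n} : jn u u' ∈ lag (pairMat n) 0 ↔
    zc u = (2 * I) • xc u - I • xc u' ∧ zc u' = (2 * I) • xc u' - I • xc u := by
  rw [jn_mem_lag, pairMat_blk₁₁, pairMat_blk₁₂, pairMat_blk₂₁, pairMat_blk₂₂]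
  have e1 : (lft (0 : Fin (n + n) → ℂ)) = 0 := rfl
  have e2 : (rgt (0 : Fin (n + n) → ℂ)) = 0 := rfl
  simp only [e1, e2, smul_mulVec, one_mulVec, smul_zero, sub_zero, neg_smul,
    neg_mulVec]
  rw [sub_eq_add_neg, sub_eq_add_neg, add_comm (-(I • xc u))]

/-- The squeezed state pairs each point u of the first modes with a point u' of the second which
determines u. Its image under R ⊕ 1 therefore remembers all of R, while T ⊗ 1 fixes the image vector
and hence its Lagrangian. -/
theorem Rep.subset {T : L2 n →L[ℂ] L2 m} {R R' : Set (Phase n × Phase m)} (h : Rep T R)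
    (h' : Rep T R') : R ⊆ R' := by
  obtain ⟨Q, hQ⟩ := exists_isTensorOp T (ContinuousLinearMap.id ℂ (L2 n))
  obtain ⟨Φ, b, c, h1, h2, h3, h4⟩ := (h.tensor (rep_id n) hQ).fwd _ 0 (isPhaseMatrix_pairMat n)
  obtain ⟨Φ', b', c', k1, k2, k3, k4⟩ :=
    (h'.tensor (rep_id n) hQ).fwd _ 0 (isPhaseMatrix_pairMat n)
  have hsm : ∃ d : ℂ, d ≠ 0 ∧ gv Φ b = d • gv Φ' b' := by
    refine ⟨c⁻¹ * c', mul_ne_zero (inv_ne_zero h2) k2, ?_⟩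
    rw [← smul_smul, ← k3, h3, smul_smul, inv_mul_cancel₀ h2, one_smul]
  obtain ⟨d, hd, hsm⟩ := hsm
  have hlag : lag Φ b = lag Φ' b' := by
    obtain ⟨rfl, rfl⟩ := gv_eq_smul h1 k1 hsm
    rfl
  rintro ⟨u, v⟩ huv
  -- The first equation z = 2ix - ix' gives x' = 2x + iz, and the second then gives z'.
  set u' : Phase n := Sum.elim ((2 * I) • ((2 : ℂ) • xc u + I • zc u) - I • xc u)
    ((2 : ℂ) • xc u + I • zc u) with hu'
  have hm : jn u u' ∈ lag (pairMat n) 0 := by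
    rw [jn_mem_lag_pairMat, hu', zc_elim, xc_elim]
    refine ⟨?_, rfl⟩
    rw [smul_add, smul_smul, smul_smul, I_mul_I]
    module
  have hv : jn v u' ∈ relImage (relSum R (relId n)) (lag (pairMat n) 0) := by
    refine ⟨_, hm, ?_⟩
    simp only [relSum, Set.mem_ofPred_eq, jn_fstIx, jn_sndIx]
    exact ⟨huv, rfl⟩
  rw [h4, hlag, ← k4] at hv
  obtain ⟨w, hw, hw1, hw2⟩ := hv
  simp only [jn_fstIx, jn_sndIx] at hw1 hw2
  have hw2 : w ∘ sndIx n n = u' := hw2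
  rw [← jn_eta w, hw2, jn_mem_lag_pairMat] at hw
  rw [jn_mem_lag_pairMat] at hm
  have e1 : I • xc (w ∘ fstIx n n) = I • xc u := by
    have := hw.2.symm.trans hm.2
    linear_combination -this
  have e2 : xc (w ∘ fstIx n n) = xc u := smul_right_injective _ I_ne_zero e1
  have e3 : w ∘ fstIx n n = u := zx_ext (by rw [hw.1, hm.1, e2]) e2
  rwa [e3] at hw1

theorem Rep.unique {T : L2 n →L[ℂ] L2 m} {R R' : Set (Phase n × Phase m)} (h : Rep T R)
    (h' : Rep T R') : R = R' := (h.subset h').antisymm (h'.subset h)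

end

section

variable {n m k : ℕ}

/-! ### Holomorphic dependence of Gaussian vectors on the linear term -/

theorem wave_add_smul (Φ : Matrix (Fin n) (Fin n) ℂ) (a : Fin n → ℂ) (z : ℂ) (e x : Fin n → ℝ) :
    wave Φ (a + z • cvec e) x = wave Φ a x * exp (z * ((e ⬝ᵥ x : ℝ) : ℂ)) := by
  rw [wave, wave, gaussFun, gaussFun, ← exp_add, add_dotProduct, smul_dotProduct, cvec_dotProduct,
    smul_eq_mul, add_assoc]

theorem differentiable_inner_gv {Φ : Matrix (Fin n) (Fin n) ℂ} (hΦ : IsPhaseMatrix Φ) (f : L2 n)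
    (a : Fin n → ℂ) (e : Fin n → ℝ) :
    Differentiable ℂ (fun z : ℂ => inner ℂ f (gv Φ (a + z • cvec e))) := by
  have hexp : ∀ z : ℂ, inner ℂ f (gv Φ (a + z • cvec e)) =
      ∫ x, (starRingEnd ℂ) (f x) * (wave Φ a x * exp (z * ((e ⬝ᵥ x : ℝ) : ℂ))) := by
    intro z
    rw [inner_eq_integral]
    refine integral_congr_ae ?_
    filter_upwards [coe_gv hΦ (a + z • cvec e)] with x hx
    rw [hx, wave_add_smul]
  simp only [hexp]
  intro z₀
  -- On the unit disc around z₀ the derivative is at most |u| exp((‖z₀‖ + 1)|u|) ≤ exp(R|u|) ≤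
  -- exp(Ru) + exp(-Ru) with u = e·x, apart from the factors f and wave. The two exponentials shift
  -- the linear term of the Gaussian, so the bound is integrable.
  set R : ℝ := ‖z₀‖ + 2 with hR
  have hfm : AEStronglyMeasurable (fun x => (starRingEnd ℂ) (f x)) volume :=
    continuous_conj.comp_aestronglyMeasurable (Lp.memLp f).1
  have hcont : ∀ z : ℂ, Continuous fun x : Fin n → ℝ =>
      wave Φ a x * exp (z * ((e ⬝ᵥ x : ℝ) : ℂ)) := fun z => by
    simp only [← wave_add_smul]; exact continuous_wave _ _
  have hdot : Continuous fun x : Fin n → ℝ => ((e ⬝ᵥ x : ℝ) : ℂ) := by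
    unfold dotProduct; fun_prop
  have hfn : MemLp (fun x => ‖f x‖) 2 volume := (Lp.memLp f).norm
  have hmul : ∀ b, Integrable (fun x => ‖f x‖ * ‖wave Φ b x‖) := fun b =>
    hfn.integrable_mul (memLp_wave hΦ b).norm
  have key := hasDerivAt_integral_of_dominated_loc_of_deriv_le (μ := volume)
    (F := fun (z : ℂ) (x : Fin n → ℝ) => (starRingEnd ℂ) (f x) *
      (wave Φ a x * exp (z * ((e ⬝ᵥ x : ℝ) : ℂ))))
    (F' := fun (z : ℂ) (x : Fin n → ℝ) => (starRingEnd ℂ) (f x) *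
      (wave Φ a x * (exp (z * ((e ⬝ᵥ x : ℝ) : ℂ)) * (1 * ((e ⬝ᵥ x : ℝ) : ℂ)))))
    (bound := fun x => ‖f x‖ * ‖wave Φ (a + (R : ℂ) • cvec e) x‖ +
      ‖f x‖ * ‖wave Φ (a + (-R : ℂ) • cvec e) x‖)
    (x₀ := z₀) (Metric.ball_mem_nhds z₀ one_pos)
    (Filter.Eventually.of_forall fun z => hfm.mul (hcont z).aestronglyMeasurable)
    ?_ (hfm.mul ?_) ?_ ((hmul _).add (hmul _)) ?_
  · exact key.2.differentiableAt
  · have := (hmul (a + z₀ • cvec e))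
    refine this.mono' (hfm.mul (hcont z₀).aestronglyMeasurable) (ae_of_all _ fun x => ?_)
    rw [norm_mul, RCLike.norm_conj, wave_add_smul]
  · refine Continuous.aestronglyMeasurable ?_
    have := (hcont z₀).mul hdot
    refine this.congr fun x => ?_
    rw [one_mul, Pi.mul_apply, mul_assoc]
  · refine ae_of_all _ fun x z hz => ?_
    rw [norm_mul, RCLike.norm_conj, wave_add_smul, wave_add_smul, ← mul_add]
    refine mul_le_mul_of_nonneg_left ?_ (norm_nonneg _)
    rw [norm_mul, norm_mul (wave Φ a x), norm_mul (wave Φ a x), ← mul_add]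
    refine mul_le_mul_of_nonneg_left ?_ (norm_nonneg _)
    set u : ℝ := e ⬝ᵥ x
    rw [norm_mul, one_mul, Complex.norm_exp, Complex.norm_exp, Complex.norm_exp, norm_real]
    have hz' : ‖z‖ ≤ ‖z₀‖ + 1 := by
      have := norm_sub_norm_le z z₀
      rw [Metric.mem_ball, dist_eq_norm] at hz
      linarith
    have h1 : (z * (u : ℂ)).re ≤ (‖z₀‖ + 1) * |u| := by
      refine (Complex.re_le_norm _).trans ?_
      rw [norm_mul, norm_real]
      exact mul_le_mul_of_nonneg_right hz' (abs_nonneg u)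
    have h2 : ‖u‖ ≤ Real.exp |u| := by
      rw [Real.norm_eq_abs]; linarith [Real.add_one_le_exp |u|]
    have h3 : Real.exp (z * (u : ℂ)).re * ‖u‖ ≤ Real.exp (R * |u|) := by
      calc _ ≤ Real.exp ((‖z₀‖ + 1) * |u|) * Real.exp |u| :=
            mul_le_mul (Real.exp_le_exp.2 h1) h2 (norm_nonneg _) (Real.exp_nonneg _)
        _ = _ := by rw [← Real.exp_add, hR]; congr 1; ring
    refine h3.trans ?_
    have e1 : ((R : ℂ) * (u : ℂ)).re = R * u := by rw [← ofReal_mul, ofReal_re]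
    have e2 : (-(R : ℂ) * (u : ℂ)).re = -(R * u) := by
      rw [← ofReal_neg, ← ofReal_mul, ofReal_re, neg_mul]
    rw [e1, e2]
    rcases abs_cases u with ⟨h, -⟩ | ⟨h, -⟩
    · rw [h]; linarith [Real.exp_nonneg (-(R * u))]
    · rw [h, mul_neg]; linarith [Real.exp_nonneg (R * u)]
  · refine ae_of_all _ fun x z _ => ?_
    exact ((((hasDerivAt_id z).mul_const _).cexp).const_mul _).const_mul _

/-! ### Gaussian unitaries: constancy of the phase matrix -/

/-- The matrix is 1 - iΦ. If (1 - iΦ)y = w, then Re w·y = |y|² + Im y*Φy ≥ |y|², and |w - y|² ≥ 0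
gives the bound. It is uniform in Φ, which is what Liouville's theorem requires. -/
theorem re_inv_le {Φ : Matrix (Fin n) (Fin n) ℂ} (hΦ : IsPhaseMatrix Φ) (w : Fin n → ℝ) :
    (cvec w ⬝ᵥ (ovMat (I • 1) Φ)⁻¹ *ᵥ cvec w).re ≤ w ⬝ᵥ w := by
  set y := (ovMat (I • 1) Φ)⁻¹ *ᵥ cvec w with hy
  have h := ovMat_mulVec_inv isPhaseMatrix_I hΦ (cvec w)
  have hone : (I • (1 : Matrix (Fin n) (Fin n) ℂ)).map star = (-I) • 1 := by
    ext i j; by_cases h : i = j <;> simp [h]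
  rw [← hy, ovMat_mulVec, hone, smul_mulVec, one_mulVec, smul_smul, mul_neg, I_mul_I, neg_neg,
    one_smul] at h
  have h1 : (star y ⬝ᵥ cvec w).re = (star y ⬝ᵥ y).re + (star y ⬝ᵥ Φ *ᵥ y).im := by
    rw [← h, dotProduct_sub, dotProduct_smul]
    simp
  have h2 := hΦ.im_nonneg y
  have h3 : (star y ⬝ᵥ cvec w).re = (cvec w ⬝ᵥ y).re := by
    rw [← Complex.conj_re, star_dotProduct_eq, star_star, star_cvec, dotProduct_comm]
  have h4 : 0 ≤ (star (cvec w - y) ⬝ᵥ (cvec w - y)).re := by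
    rw [re_star_dotProduct_self]
    exact Finset.sum_nonneg fun i _ => Complex.normSq_nonneg _
  rw [star_sub, star_cvec, sub_dotProduct, dotProduct_sub, dotProduct_sub, cvec_dotProduct] at h4
  simp only [sub_re, ofReal_re] at h4
  linarith

/-- The quotient cancels the scalar factor and all dependence on b, leaving a quantity that depends
on the phase matrix alone. -/
theorem inner_coh_ratio {Φ : Matrix (Fin n) (Fin n) ℂ} (hΦ : IsPhaseMatrix Φ) (b : Fin n → ℂ)
    (w : Fin n → ℝ) :
    inner ℂ (coh (cvec w)) (gv Φ b) * inner ℂ (coh (cvec (-w))) (gv Φ b) /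
      inner ℂ (coh 0) (gv Φ b) ^ 2 = exp (cvec w ⬝ᵥ (ovMat (I • 1) Φ)⁻¹ *ᵥ cvec w) := by
  have hI := isPhaseMatrix_I (n := n)
  have hneg : cvec (-w) = -cvec w := by ext; simp [cvec]
  simp only [coh]
  rw [div_eq_iff (pow_ne_zero 2 (inner_gv_ne_zero hI hΦ _ _))]
  rw [inner_gv hI hΦ, inner_gv hI hΦ, inner_gv hI hΦ, hneg, star_neg, star_cvec, star_zero,
    zero_add]
  rw [mul_mul_mul_comm, ← exp_add, mul_pow, ← exp_nat_mul, mul_left_comm, ← exp_add, ← pow_two]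
  congr 2
  simp only [mulVec_add, mulVec_neg, dotProduct_add, add_dotProduct, neg_dotProduct,
    dotProduct_neg]
  push_cast
  ring

theorem eq_of_inv_quadratic_eq {Φ Φ' : Matrix (Fin n) (Fin n) ℂ} (hΦ : IsPhaseMatrix Φ)
    (hΦ' : IsPhaseMatrix Φ') (h : ∀ w : Fin n → ℝ,
      exp (cvec w ⬝ᵥ (ovMat (I • 1) Φ)⁻¹ *ᵥ cvec w) =
      exp (cvec w ⬝ᵥ (ovMat (I • 1) Φ')⁻¹ *ᵥ cvec w)) : Φ = Φ' := by
  have hI := isPhaseMatrix_I (n := n)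
  have hs : ∀ {Φ : Matrix (Fin n) (Fin n) ℂ}, IsPhaseMatrix Φ →
      ((-2 : ℂ) • (ovMat (I • 1) Φ)⁻¹).IsSymm := fun h => by
    rw [Matrix.IsSymm, transpose_smul, transpose_nonsing_inv]
    congr 2
    exact hI.sum_isSymm h
  have h1 := (eq_of_gaussFun_eq (b := 0) (b' := 0) (hs hΦ) (hs hΦ') fun x => by
    have := h x
    simp only [gaussFun, zero_dotProduct, add_zero, smul_mulVec, dotProduct_smul, smul_eq_mul]
    convert this using 2 <;> ring).1
  have h2 : (ovMat (I • 1) Φ)⁻¹ = (ovMat (I • 1) Φ')⁻¹ := smul_right_injective _ (by norm_num) h1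
  have h3 : ovMat (I • 1) Φ = ovMat (I • 1) Φ' := by
    rw [← nonsing_inv_nonsing_inv _ (hI.isUnit_ovMat hΦ), h2,
      nonsing_inv_nonsing_inv _ (hI.isUnit_ovMat hΦ')]
  exact smul_right_injective _ I_ne_zero (neg_injective (add_left_cancel h3))

theorem IsGaussianUnitary.exists_gv {U : L2 n ≃ₗᵢ[ℂ] L2 n} (hU : IsGaussianUnitary U)
    {Φ : Matrix (Fin n) (Fin n) ℂ} (hΦ : IsPhaseMatrix Φ) (a : Fin n → ℂ) :
    ∃ (Φ' : Matrix (Fin n) (Fin n) ℂ) (b : Fin n → ℂ) (c : ℂ), IsPhaseMatrix Φ' ∧ c ≠ 0 ∧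
      U (gv Φ a) = c • gv Φ' b := by
  obtain ⟨c, s, t, hc, -, h⟩ := exists_state_of_gv hΦ a
  obtain ⟨Φ', s', t', h'⟩ := hU _ ⟨Φ, s, t, h⟩
  obtain ⟨d, hd, e⟩ := h'.eq_smul
  refine ⟨Φ', lin Φ' s' t', c⁻¹ * d, h'.1, mul_ne_zero (inv_ne_zero hc) hd, ?_⟩
  rw [← smul_smul, ← e, map_smul, smul_smul, inv_mul_cancel₀ hc, one_smul]

/-- The quotients of `inner_coh_ratio` for U(`gv Φ (a + z e)`) are entire in z, with U moved to the
coherent vectors, and bounded by `re_inv_le`. By Liouville they are constant, and they determine the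
phase matrix. -/
theorem IsGaussianUnitary.phase_add_smul {U : L2 n ≃ₗᵢ[ℂ] L2 n} (hU : IsGaussianUnitary U)
    {Φ : Matrix (Fin n) (Fin n) ℂ} (hΦ : IsPhaseMatrix Φ) {a b b' : Fin n → ℂ} {z c c' : ℂ}
    {e : Fin n → ℝ} {Φ₁ Φ₂ : Matrix (Fin n) (Fin n) ℂ} (h₁ : IsPhaseMatrix Φ₁)
    (h₂ : IsPhaseMatrix Φ₂) (hc : c ≠ 0) (hc' : c' ≠ 0) (e₁ : U (gv Φ a) = c • gv Φ₁ b)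
    (e₂ : U (gv Φ (a + z • cvec e)) = c' • gv Φ₂ b') : Φ₁ = Φ₂ := by
  refine eq_of_inv_quadratic_eq h₁ h₂ fun w => ?_
  choose Θ β γ hΘ hγ hE using fun z : ℂ => hU.exists_gv hΦ (a + z • cvec e)
  have hadj : ∀ (v : L2 n) (f : L2 n), inner ℂ v (U f) = inner ℂ (U.symm v) f := fun v f => by
    rw [← U.inner_map_map (U.symm v) f, U.apply_symm_apply]
  have hratio : ∀ z, exp (cvec w ⬝ᵥ (ovMat (I • 1) (Θ z))⁻¹ *ᵥ cvec w) =
      inner ℂ (U.symm (coh (cvec w))) (gv Φ (a + z • cvec e)) *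
      inner ℂ (U.symm (coh (cvec (-w)))) (gv Φ (a + z • cvec e)) /
      inner ℂ (U.symm (coh 0)) (gv Φ (a + z • cvec e)) ^ 2 := fun z => by
    rw [← hadj, ← hadj, ← hadj, hE, inner_smul_right, inner_smul_right, inner_smul_right,
      ← inner_coh_ratio (hΘ z) (β z)]
    have := hγ z
    have := inner_gv_ne_zero isPhaseMatrix_I (hΘ z) 0 (β z)
    rw [coh, coh, coh]
    field_simp
  have hdiff : Differentiable ℂ fun z => exp (cvec w ⬝ᵥ (ovMat (I • 1) (Θ z))⁻¹ *ᵥ cvec w) := by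
    simp only [hratio]
    refine Differentiable.fun_div ((differentiable_inner_gv hΦ _ a e).mul
      (differentiable_inner_gv hΦ _ a e)) ((differentiable_inner_gv hΦ _ a e).pow 2) fun z => ?_
    refine pow_ne_zero 2 ?_
    rw [← hadj, hE, inner_smul_right]
    exact mul_ne_zero (hγ z) (inner_gv_ne_zero isPhaseMatrix_I (hΘ z) _ _)
  have hconst := hdiff.apply_eq_apply_of_bounded (by
    refine (Metric.isBounded_closedBall (x := (0 : ℂ)) (r := Real.exp (w ⬝ᵥ w))).subset ?_
    rintro _ ⟨z, rfl⟩
    rw [mem_closedBall_zero_iff, Complex.norm_exp]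
    exact Real.exp_le_exp.2 (re_inv_le (hΘ z) w)) 0 z
  have huniq : ∀ {X Y : Matrix (Fin n) (Fin n) ℂ} {x y : Fin n → ℂ} {p q : ℂ} {F : L2 n},
      IsPhaseMatrix X → IsPhaseMatrix Y → p ≠ 0 → F = p • gv X x → F = q • gv Y y → X = Y := by
    intro X Y x y p q F hX hY hp e1 e2
    refine (gv_eq_smul hX hY (b := x) (b' := y) (c := p⁻¹ * q) ?_).1
    rw [← smul_smul, ← e2, e1, smul_smul, inv_mul_cancel₀ hp, one_smul]
  have h0 := hE 0
  rw [zero_smul, add_zero] at h0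
  rw [huniq h₁ (hΘ 0) hc e₁ h0, huniq h₂ (hΘ z) hc' e₂ (hE z)]
  exact hconst

theorem IsGaussianUnitary.exists_phase {U : L2 n ≃ₗᵢ[ℂ] L2 n} (hU : IsGaussianUnitary U)
    {Φ : Matrix (Fin n) (Fin n) ℂ} (hΦ : IsPhaseMatrix Φ) :
    ∃ Φ' : Matrix (Fin n) (Fin n) ℂ, IsPhaseMatrix Φ' ∧ ∀ a, ∃ (b : Fin n → ℂ) (c : ℂ), c ≠ 0 ∧
      U (gv Φ a) = c • gv Φ' b := by
  choose Θ β γ hΘ hγ hE using fun a => hU.exists_gv hΦ a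
  refine ⟨Θ 0, hΘ 0, fun a => ⟨β a, γ a, hγ a, ?_⟩⟩
  have ha : a = 0 + (1 : ℂ) • cvec (fun i => (a i).re) + I • cvec (fun i => (a i).im) := by
    ext i
    simp [cvec, mul_comm I, re_add_im]
  have e1 : Θ 0 = Θ (0 + (1 : ℂ) • cvec (fun i => (a i).re)) :=
    hU.phase_add_smul hΦ (hΘ _) (hΘ _) (hγ _) (hγ _) (hE _) (hE _)
  have e2 : Θ (0 + (1 : ℂ) • cvec (fun i => (a i).re)) = Θ a := by
    conv_rhs => rw [ha]
    exact hU.phase_add_smul hΦ (hΘ _) (hΘ _) (hγ _) (hγ _) (hE _) (hE _)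
  rw [e1, e2, ← hE]

end

section

variable {n m k : ℕ}

/-! ### Gaussian unitaries: linearity of the action on displacements -/

/-- The cross ratio cancels normalisations and the terms in a or b alone; only the sesquilinear part
remains. -/
theorem inner_gv_cross_ratio {X Y : Matrix (Fin n) (Fin n) ℂ} (hX : IsPhaseMatrix X)
    (hY : IsPhaseMatrix Y) (a a₀ b b₀ : Fin n → ℂ) :
    inner ℂ (gv X a) (gv Y b) * inner ℂ (gv X a₀) (gv Y b₀) =
      exp (star (a - a₀) ⬝ᵥ (ovMat X Y)⁻¹ *ᵥ (b - b₀)) *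
        (inner ℂ (gv X a) (gv Y b₀) * inner ℂ (gv X a₀) (gv Y b)) := by
  rw [inner_gv hX hY, inner_gv hX hY, inner_gv hX hY, inner_gv hX hY, mul_mul_mul_comm,
    ← exp_add, mul_mul_mul_comm (gaussConst (ovMat X Y)) _ _ (exp _), ← exp_add,
    mul_left_comm, ← exp_add]
  congr 2
  have hs := ovMat_inv_symm hX hY
  simp only [star_sub, mulVec_add, mulVec_sub, dotProduct_add, add_dotProduct, dotProduct_sub,
    sub_dotProduct, hs b, hs b₀]
  ring

/-- The Hermitian form on linear terms which belongs to the phase matrix `Φ`. -/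
def hf (Φ : Matrix (Fin n) (Fin n) ℂ) (a b : Fin n → ℂ) : ℂ := star a ⬝ᵥ (ovMat Φ Φ)⁻¹ *ᵥ b

section
variable {Φ : Matrix (Fin n) (Fin n) ℂ}

theorem ovMat_self (Φ : Matrix (Fin n) (Fin n) ℂ) :
    ovMat Φ Φ = cmat ((2 : ℝ) • Φ.map Complex.im) := by
  ext i j
  apply Complex.ext <;> simp [ovMat, cmat]
  ring

theorem hf_sub_left (a b c : Fin n → ℂ) : hf Φ (a - b) c = hf Φ a c - hf Φ b c := by
  simp [hf, sub_dotProduct]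
theorem hf_sub_right (a b c : Fin n → ℂ) : hf Φ a (b - c) = hf Φ a b - hf Φ a c := by
  simp [hf, mulVec_sub]
theorem hf_add_left (a b c : Fin n → ℂ) : hf Φ (a + b) c = hf Φ a c + hf Φ b c := by
  simp [hf, add_dotProduct]
theorem hf_add_right (a b c : Fin n → ℂ) : hf Φ a (b + c) = hf Φ a b + hf Φ a c := by
  simp [hf, mulVec_add]
theorem hf_smul_left (z : ℂ) (a b : Fin n → ℂ) : hf Φ (z • a) b = (starRingEnd ℂ) z * hf Φ a b := by
  simp [hf, smul_dotProduct]
theorem hf_smul_right (z : ℂ) (a b : Fin n → ℂ) : hf Φ a (z • b) = z * hf Φ a b := by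
  simp [hf, mulVec_smul]

theorem eq_zero_of_hf (hΦ : IsPhaseMatrix Φ) {a : Fin n → ℂ} (h : (hf Φ a a).re = 0) : a = 0 := by
  by_contra ha
  have hV : ((2 : ℝ) • Φ.map Complex.im).PosDef := hΦ.2.smul (by norm_num)
  have hph : IsPhaseMatrix (I • (ovMat Φ Φ)⁻¹) := by
    rw [ovMat_self, ← cmat_inv _ hV.det_pos.ne'.isUnit]
    constructor
    · rw [Matrix.IsSymm, transpose_smul, ← cmat_transpose, transpose_nonsing_inv, transpose_smul,
        hΦ.im_isSymm]
    · have e : (I • cmat ((2 : ℝ) • Φ.map Complex.im)⁻¹).map Complex.im =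
          ((2 : ℝ) • Φ.map Complex.im)⁻¹ := by
        ext; simp [cmat]
      rw [e]
      exact hV.inv
  have := hph.im_pos ha
  rw [smul_mulVec, dotProduct_smul] at this
  simp only [smul_eq_mul, I_mul_im] at this
  exact this.ne' h

end

/-- Absolute values show that the real part of the form is preserved, which forces g(ta) = t g(a)
for real t. Scaling then removes the ambiguity of the logarithm, so the form itself is preserved,
and a map preserving a definite Hermitian form is linear. -/
theorem exists_linear_of_exp_hf {Φ Φ' : Matrix (Fin n) (Fin n) ℂ} (hΦ' : IsPhaseMatrix Φ')
    {g : (Fin n → ℂ) → (Fin n → ℂ)} (h : ∀ a b, exp (hf Φ' (g a) (g b)) = exp (hf Φ a b)) :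
    ∃ M : (Fin n → ℂ) →ₗ[ℂ] (Fin n → ℂ), (∀ a, g a = M a) ∧
      ∀ a b, hf Φ' (M a) (M b) = hf Φ a b := by
  have hre : ∀ a b, (hf Φ' (g a) (g b)).re = (hf Φ a b).re := fun a b => by
    have := congrArg norm (h a b)
    rw [norm_exp, norm_exp] at this
    exact Real.exp_injective this
  have hreal : ∀ (t : ℝ) a, g ((t : ℂ) • a) = (t : ℂ) • g a := fun t a => by
    rw [← sub_eq_zero]
    apply eq_zero_of_hf hΦ'
    simp only [hf_sub_left, hf_sub_right, hf_smul_left, hf_smul_right, conj_ofReal, sub_re,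
      re_ofReal_mul, hre]
    ring
  have hfull : ∀ a b, hf Φ' (g a) (g b) = hf Φ a b := fun a b => by
    rw [← sub_eq_zero]
    refine eq_zero_of_exp_eq_one fun t _ => ?_
    have := h a ((t : ℂ) • b)
    rw [hreal, hf_smul_right, hf_smul_right] at this
    rw [mul_sub, exp_sub, this, div_self (exp_ne_zero _)]
  refine ⟨{ toFun := g, map_add' := fun a b => ?_, map_smul' := fun z a => ?_ },
    fun _ => rfl, hfull⟩
  · rw [← sub_eq_zero]
    apply eq_zero_of_hf hΦ'
    simp only [hf_sub_left, hf_sub_right, hf_add_left, hf_add_right, hfull]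
    ring_nf
    simp
  · rw [← sub_eq_zero]
    apply eq_zero_of_hf hΦ'
    simp only [hf_sub_left, hf_sub_right, hf_smul_left, hf_smul_right, hfull, RingHom.id_apply]
    ring_nf
    simp

/-- U preserves cross ratios of overlaps, and the unknown scalars cancel in them. The map on linear
terms is normalised to fix 0 by subtracting its value there. -/
theorem IsGaussianUnitary.exists_linear {U : L2 n ≃ₗᵢ[ℂ] L2 n} (hU : IsGaussianUnitary U)
    {Φ : Matrix (Fin n) (Fin n) ℂ} (hΦ : IsPhaseMatrix Φ) :
    ∃ (Φ' : Matrix (Fin n) (Fin n) ℂ) (M : (Fin n → ℂ) →ₗ[ℂ] (Fin n → ℂ)) (b₀ : Fin n → ℂ),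
      IsPhaseMatrix Φ' ∧ (∀ a b, hf Φ' (M a) (M b) = hf Φ a b) ∧
      ∀ a, ∃ c : ℂ, c ≠ 0 ∧ U (gv Φ a) = c • gv Φ' (M a + b₀) := by
  obtain ⟨Φ', hΦ', h⟩ := hU.exists_phase hΦ
  choose f c hc hf' using h
  have hexp : ∀ a b, exp (hf Φ' (f a - f 0) (f b - f 0)) = exp (hf Φ a b) := by
    intro a b
    have h1 := inner_gv_cross_ratio hΦ' hΦ' (f a) (f 0) (f b) (f 0)
    have h2 := inner_gv_cross_ratio hΦ hΦ a 0 b 0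
    have hin : ∀ a b, inner ℂ (gv Φ a) (gv Φ b) = (starRingEnd ℂ) (c a) * (c b) *
        inner ℂ (gv Φ' (f a)) (gv Φ' (f b)) := fun a b => by
      rw [← U.inner_map_map, hf', hf', inner_smul_left, inner_smul_right, mul_assoc]
    simp only [hin, sub_zero] at h2
    have hne := inner_gv_ne_zero hΦ' hΦ' (f a) (f 0)
    have hne' := inner_gv_ne_zero hΦ' hΦ' (f 0) (f b)
    have hca : (starRingEnd ℂ) (c a) ≠ 0 := by simpa using hc a
    have hc0 : (starRingEnd ℂ) (c 0) ≠ 0 := by simpa using hc 0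
    have hcb := hc b
    have hc00 := hc 0
    refine mul_right_cancel₀ (b := ((starRingEnd ℂ) (c a) * (starRingEnd ℂ) (c 0) * c b * c 0) *
      (inner ℂ (gv Φ' (f a)) (gv Φ' (f 0)) * inner ℂ (gv Φ' (f 0)) (gv Φ' (f b)))) ?_ ?_
    · simp only [ne_eq, mul_eq_zero, not_or]
      exact ⟨⟨⟨⟨hca, hc0⟩, hcb⟩, hc00⟩, hne, hne'⟩
    · simp only [hf]
      linear_combination h2 - ((starRingEnd ℂ) (c a) * (starRingEnd ℂ) (c 0) * c b * c 0) * h1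
  obtain ⟨M, hM, hMf⟩ := exists_linear_of_exp_hf hΦ' hexp
  refine ⟨Φ', M, f 0, hΦ', hMf, fun a => ⟨c a, hc a, ?_⟩⟩
  rw [← hM, sub_add_cancel, hf']

/-! ### The symplectic matrix of a Gaussian unitary -/

/-- The linear term of the Gaussian vectors of phase matrix `Φ` whose affine Lagrangian contains
`v`. -/
def btc (Φ : Matrix (Fin n) (Fin n) ℂ) : Phase n →ₗ[ℂ] (Fin n → ℂ) where
  toFun v := I • (zc v - Φ *ᵥ xc v)
  map_add' u v := by
    change I • (zc u + zc v - Φ *ᵥ (xc u + xc v)) = _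
    rw [mulVec_add]; module
  map_smul' c v := by
    change I • (c • zc v - Φ *ᵥ (c • xc v)) = c • _
    rw [mulVec_smul]; module

theorem mem_lag_iff_btc {Φ : Matrix (Fin n) (Fin n) ℂ} {b : Fin n → ℂ} {v : Phase n} :
    v ∈ lag Φ b ↔ btc Φ v = b := mem_lag_iff

theorem btc_ofRealVec (Φ : Matrix (Fin n) (Fin n) ℂ) (v : Ix n → ℝ) :
    btc Φ (ofRealVec v) = lin Φ (v ∘ Sum.inl) (v ∘ Sum.inr) := rfl

/-- Through displacements the real symplectic form is, up to a factor, the imaginary part of the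
Hermitian form, so complex maps preserving the latter are real symplectic maps. -/
theorem im_hf_btc {Φ : Matrix (Fin n) (Fin n) ℂ} (hΦ : IsPhaseMatrix Φ) (u v : Ix n → ℝ) :
    (hf Φ (btc Φ (ofRealVec u)) (btc Φ (ofRealVec v))).im =
      -(1 / 2) * (omega (ofRealVec u) (ofRealVec v)).re := by
  set U := Φ.map Complex.re with hU
  set V := Φ.map Complex.im with hV
  set s := u ∘ Sum.inl
  set t := u ∘ Sum.inr
  set s' := v ∘ Sum.inl
  set t' := v ∘ Sum.inr
  have hmul : ∀ x : Fin n → ℝ, Φ *ᵥ cvec x = cvec (U *ᵥ x) + I • cvec (V *ᵥ x) := fun x => by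
    conv_lhs => rw [cmat_re_add_im Φ, add_mulVec, smul_mulVec, cmat_mulVec, cmat_mulVec]
  set κ := V⁻¹ *ᵥ (s' - U *ᵥ t') with hκ
  have hVκ : V *ᵥ κ = s' - U *ᵥ t' := by
    rw [hκ, mulVec_mulVec, mul_nonsing_inv _ hΦ.isUnit_im, one_mulVec]
  have hsub : ∀ x y : Fin n → ℝ, cvec (x - y) = cvec x - cvec y := fun x y => by
    ext i; simp [cvec]
  have hsm : ∀ x : Fin n → ℝ, cmat ((2 : ℝ) • V) *ᵥ cvec x = (2 : ℂ) • cvec (V *ᵥ x) := fun x => by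
    rw [cmat_mulVec, smul_mulVec]; ext i; simp [cvec]
  have h1 : (ovMat Φ Φ)⁻¹ *ᵥ btc Φ (ofRealVec v) = (1 / 2 : ℂ) • (cvec t' + I • cvec κ) := by
    apply ovMat_inv_mulVec hΦ hΦ
    rw [ovMat_self, mulVec_smul, mulVec_add, mulVec_smul, hsm, hsm, hVκ, hsub]
    change _ = I • (cvec s' - Φ *ᵥ cvec t')
    rw [hmul, smul_sub I, smul_add I (cvec (U *ᵥ t')), smul_smul I I, I_mul_I]
    module
  have h2 : star (btc Φ (ofRealVec u)) = (-I) • (cvec (s - U *ᵥ t) + I • cvec (V *ᵥ t)) := by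
    change star (I • (cvec s - Φ *ᵥ cvec t)) = _
    rw [hmul, hsub, star_smul, star_sub, star_add, star_smul, star_cvec, star_cvec, star_cvec]
    simp only [Complex.star_def, conj_I]
    module
  have hsU : ∀ x y : Fin n → ℝ, (U *ᵥ x) ⬝ᵥ y = x ⬝ᵥ U *ᵥ y := fun x y => by
    rw [dotProduct_comm, dotProduct_mulVec, ← mulVec_transpose, hΦ.re_isSymm, dotProduct_comm]
  have hsV : ∀ x y : Fin n → ℝ, (V *ᵥ x) ⬝ᵥ y = x ⬝ᵥ V *ᵥ y := fun x y => by
    rw [dotProduct_comm, dotProduct_mulVec, ← mulVec_transpose, hΦ.im_isSymm, dotProduct_comm]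
  have h3 : (omega (ofRealVec u) (ofRealVec v)).re = s ⬝ᵥ t' - t ⬝ᵥ s' := by
    rw [omega_eq]
    change (cvec s ⬝ᵥ cvec t' - cvec t ⬝ᵥ cvec s').re = _
    rw [cvec_dotProduct, cvec_dotProduct, ← ofReal_sub, ofReal_re]
  rw [hf, h1, h2, h3, smul_dotProduct, dotProduct_smul, add_dotProduct, dotProduct_add,
    dotProduct_add, smul_dotProduct, smul_dotProduct, dotProduct_smul, dotProduct_smul,
    cvec_dotProduct, cvec_dotProduct, cvec_dotProduct, cvec_dotProduct, hsV t κ, hVκ]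
  rw [sub_dotProduct, hsU, dotProduct_sub]
  simp

/-- Linear terms as a real linear equivalence from the real phase space. -/
theorem exists_btcEquiv {Φ : Matrix (Fin n) (Fin n) ℂ} (hΦ : IsPhaseMatrix Φ) :
    ∃ e : (Ix n → ℝ) ≃ₗ[ℝ] (Fin n → ℂ), ∀ v, e v = btc Φ (ofRealVec v) := by
  let f : (Ix n → ℝ) →ₗ[ℝ] (Fin n → ℂ) :=
    { toFun := fun v => btc Φ (ofRealVec v)
      map_add' := fun u v => by
        rw [← map_add]; congr 1; ext i; simp [ofRealVec]
      map_smul' := fun c v => by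
        have : ofRealVec (c • v) = (c : ℂ) • ofRealVec v := by ext i; simp [ofRealVec]
        rw [this, map_smul]; rfl }
  refine ⟨LinearEquiv.ofBijective f ⟨fun u v h => ?_, fun b => ?_⟩, fun v => rfl⟩
  · obtain ⟨h1, h2⟩ := lin_injective hΦ (show lin Φ _ _ = lin Φ _ _ from h)
    ext i
    rcases i with i | i
    · exact congrFun h1 i
    · exact congrFun h2 i
  · obtain ⟨s, t, h⟩ := exists_lin_eq hΦ b
    exact ⟨Sum.elim s t, h⟩

theorem dotProduct_J (u v : Ix n → ℝ) :
    u ⬝ᵥ J (Fin n) ℝ *ᵥ v = -(omega (ofRealVec u) (ofRealVec v)).re := by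
  have h3 : (omega (ofRealVec u) (ofRealVec v)).re =
      (u ∘ Sum.inl) ⬝ᵥ (v ∘ Sum.inr) - (u ∘ Sum.inr) ⬝ᵥ (v ∘ Sum.inl) := by
    rw [omega_eq]
    change (cvec (u ∘ Sum.inl) ⬝ᵥ cvec (v ∘ Sum.inr) - cvec (u ∘ Sum.inr) ⬝ᵥ cvec (v ∘ Sum.inl)).re
      = _
    rw [cvec_dotProduct, cvec_dotProduct, ← ofReal_sub, ofReal_re]
  rw [h3, J, fromBlocks_mulVec]
  nth_rewrite 1 [← Sum.elim_comp_inl_inr u]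
  rw [sumElim_dotProduct_sumElim]
  simp [neg_mulVec]
  ring

theorem mem_symplecticGroup_of_omega {S : Matrix (Ix n) (Ix n) ℝ}
    (h : ∀ u v, (omega (ofRealVec (S *ᵥ u)) (ofRealVec (S *ᵥ v))).re =
      (omega (ofRealVec u) (ofRealVec v)).re) : S ∈ symplecticGroup (Fin n) ℝ := by
  rw [SymplecticGroup.mem_iff']
  have key : ∀ u v : Ix n → ℝ, u ⬝ᵥ (Sᵀ * J (Fin n) ℝ * S) *ᵥ v = u ⬝ᵥ J (Fin n) ℝ *ᵥ v := by
    intro u v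
    rw [← mulVec_mulVec, ← mulVec_mulVec, dotProduct_mulVec, vecMul_transpose, dotProduct_J,
      dotProduct_J, h]
  ext i j
  have := key (Pi.single i 1) (Pi.single j 1)
  simpa using this

theorem IsGaussianUnitary.exists_symplectic {U : L2 n ≃ₗᵢ[ℂ] L2 n} (hU : IsGaussianUnitary U)
    {Φ : Matrix (Fin n) (Fin n) ℂ} (hΦ : IsPhaseMatrix Φ) :
    ∃ (Φ' : Matrix (Fin n) (Fin n) ℂ) (S : Matrix (Ix n) (Ix n) ℝ) (d : Ix n → ℝ),
      IsPhaseMatrix Φ' ∧ S ∈ symplecticGroup (Fin n) ℝ ∧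
      ∀ v, ∃ c : ℂ, c ≠ 0 ∧
        U (gv Φ (btc Φ v)) = c • gv Φ' (btc Φ' (cmat S *ᵥ v + ofRealVec d)) := by
  obtain ⟨Φ', M, b₀, hΦ', hM, h⟩ := hU.exists_linear hΦ
  obtain ⟨e, he⟩ := exists_btcEquiv hΦ
  obtain ⟨e', he'⟩ := exists_btcEquiv hΦ'
  set S := LinearMap.toMatrix' (e'.symm.toLinearMap.comp
    ((M.restrictScalars ℝ).comp e.toLinearMap)) with hS
  have hSv : ∀ v, S *ᵥ v = e'.symm (M (e v)) := fun v => by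
    rw [hS, LinearMap.toMatrix'_mulVec]; rfl
  have hb : ∀ v : Ix n → ℝ, btc Φ' (ofRealVec (S *ᵥ v)) = M (btc Φ (ofRealVec v)) := fun v => by
    rw [← he', hSv, LinearEquiv.apply_symm_apply, he]
  -- S is defined on real displacements; both sides are complex linear, so the identity extends to
  -- all of phase space.
  have hbc : ∀ v : Phase n, btc Φ' (cmat S *ᵥ v) = M (btc Φ v) := fun v => by
    have hv : v = cvec (fun i => (v i).re) + I • cvec (fun i => (v i).im) := by
      ext i; simp [cvec, mul_comm I, re_add_im]
    rw [hv, mulVec_add, mulVec_smul, cmat_mulVec, cmat_mulVec, map_add, map_smul]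
    change btc Φ' (ofRealVec _) + I • btc Φ' (ofRealVec _) = _
    rw [hb, hb, map_add, map_smul, map_add, map_smul]
    rfl
  refine ⟨Φ', S, e'.symm b₀, hΦ', mem_symplecticGroup_of_omega fun u v => ?_, fun v => ?_⟩
  · have h1 := im_hf_btc hΦ' (S *ᵥ u) (S *ᵥ v)
    rw [hb, hb, hM, im_hf_btc hΦ] at h1
    linarith
  · obtain ⟨c, hc, hcU⟩ := h (btc Φ v)
    refine ⟨c, hc, ?_⟩
    rw [hcU, map_add, hbc, ← he', LinearEquiv.apply_symm_apply]

end

section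

variable {n m k : ℕ}

/-! ### Transition amplitudes between Gaussian states -/

theorem IsGaussianWith.exists_norm_eq {φ : L2 n} {Φ : Matrix (Fin n) (Fin n) ℂ} {s t : Fin n → ℝ}
    (h : IsGaussianWith φ Φ s t) : ∃ c : ℂ, φ = c • gv Φ (lin Φ s t) ∧
      ‖c‖ = ((Φ.map Complex.im).det / Real.pi ^ n) ^ (1 / 4 : ℝ) *
        Real.exp (-(1 / 2) * (t ⬝ᵥ Φ.map Complex.im *ᵥ t)) := by
  obtain ⟨hΦ, α, hα⟩ := h
  refine ⟨exp (I * α) * ((((Φ.map Complex.im).det / Real.pi ^ n) ^ (1 / 4 : ℝ) : ℝ) : ℂ) *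
    exp (I / 2 * (cvec t ⬝ᵥ Φ *ᵥ cvec t)), ?_, ?_⟩
  · apply Lp.ext
    filter_upwards [hα, coe_gv hΦ (lin Φ s t), Lp.coeFn_smul (exp (I * α) *
      ((((Φ.map Complex.im).det / Real.pi ^ n) ^ (1 / 4 : ℝ) : ℝ) : ℂ) *
        exp (I / 2 * (cvec t ⬝ᵥ Φ *ᵥ cvec t))) (gv Φ (lin Φ s t))] with x h1 h2 h3
    rw [h1, h3, Pi.smul_apply, h2, smul_eq_mul, gaussianWave_eq hΦ]
  · have h1 : cvec t ⬝ᵥ Φ *ᵥ cvec t = ((t ⬝ᵥ Φ.map Complex.re *ᵥ t : ℝ) : ℂ) +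
        I * ((t ⬝ᵥ Φ.map Complex.im *ᵥ t : ℝ) : ℂ) := by
      conv_lhs => rw [cmat_re_add_im Φ, add_mulVec, smul_mulVec, cmat_mulVec, cmat_mulVec,
        dotProduct_add, dotProduct_smul, cvec_dotProduct, cvec_dotProduct, smul_eq_mul]
    have hdet := hΦ.2.det_pos
    rw [norm_mul, norm_mul, norm_exp, norm_exp, norm_real, Real.norm_of_nonneg (by positivity), h1]
    simp only [mul_re, I_re, ofReal_re, zero_mul, I_im, ofReal_im, mul_zero, sub_self,
      Real.exp_zero, one_mul]
    congr 2
    simp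

section
variable (Φ Ψ : Matrix (Fin n) (Fin n) ℂ)

/-- The point of the Lagrangian subspace of `Ψ` which differs from `δ` by a point of the conjugate
of the Lagrangian subspace of `Φ`. -/
def midPt (δ : Ix n → ℝ) : Phase n :=
  Sum.elim (Ψ *ᵥ (ovMat Φ Ψ)⁻¹ *ᵥ star (btc Φ (ofRealVec δ)))
    ((ovMat Φ Ψ)⁻¹ *ᵥ star (btc Φ (ofRealVec δ)))

theorem ofRealVec_add (u v : Ix n → ℝ) : ofRealVec (u + v) = ofRealVec u + ofRealVec v := by
  ext i; simp [ofRealVec]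

theorem ofRealVec_smul (c : ℝ) (u : Ix n → ℝ) : ofRealVec (c • u) = (c : ℂ) • ofRealVec u := by
  ext i; simp [ofRealVec]

theorem ofRealVec_sub (u v : Ix n → ℝ) : ofRealVec (u - v) = ofRealVec u - ofRealVec v := by
  ext i; simp [ofRealVec]

theorem ofRealVec_injective {u v : Ix n → ℝ} (h : ofRealVec u = ofRealVec v) : u = v := by
  ext i
  have := congrFun h i
  simpa [ofRealVec] using this

theorem midPt_add (u v : Ix n → ℝ) : midPt Φ Ψ (u + v) = midPt Φ Ψ u + midPt Φ Ψ v := by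
  apply zx_ext
  · change Ψ *ᵥ _ = Ψ *ᵥ _ + Ψ *ᵥ _
    rw [ofRealVec_add, map_add, star_add, mulVec_add, mulVec_add]
  · change (ovMat Φ Ψ)⁻¹ *ᵥ _ = (ovMat Φ Ψ)⁻¹ *ᵥ _ + (ovMat Φ Ψ)⁻¹ *ᵥ _
    rw [ofRealVec_add, map_add, star_add, mulVec_add]

theorem midPt_smul (c : ℝ) (u : Ix n → ℝ) : midPt Φ Ψ (c • u) = (c : ℂ) • midPt Φ Ψ u := by
  apply zx_ext
  · change Ψ *ᵥ _ = (c : ℂ) • Ψ *ᵥ _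
    rw [ofRealVec_smul, map_smul, star_smul, mulVec_smul, mulVec_smul, Complex.star_def,
      conj_ofReal]
  · change (ovMat Φ Ψ)⁻¹ *ᵥ _ = (c : ℂ) • (ovMat Φ Ψ)⁻¹ *ᵥ _
    rw [ofRealVec_smul, map_smul, star_smul, mulVec_smul, Complex.star_def, conj_ofReal]

/-- The quadratic form which governs transition amplitudes. -/
def ampForm : (Ix n → ℝ) →ₗ[ℝ] (Ix n → ℝ) →ₗ[ℝ] ℝ :=
  LinearMap.mk₂ ℝ (fun u v => 1 / 2 * (omega (midPt Φ Ψ u) (ofRealVec v)).im)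
    (fun u u' v => by simp only [midPt_add, omega_add_left, add_im]; ring)
    (fun c u v => by
      simp only [midPt_smul, omega_smul_left, im_ofReal_mul, smul_eq_mul]; ring)
    (fun u v v' => by simp only [ofRealVec_add, omega_add_right, add_im]; ring)
    (fun c u v => by
      simp only [ofRealVec_smul, omega_smul_right, im_ofReal_mul, smul_eq_mul]; ring)

variable {Φ Ψ}

theorem midPt_eq (hΦ : IsPhaseMatrix Φ) (hΨ : IsPhaseMatrix Ψ) (δ : Ix n → ℝ) :
    Φ.map star *ᵥ xc (midPt Φ Ψ δ) - Ψ *ᵥ xc (midPt Φ Ψ δ) =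
      -cvec (δ ∘ Sum.inl) + Φ.map star *ᵥ cvec (δ ∘ Sum.inr) := by
  have h := ovMat_mulVec_inv hΦ hΨ (star (btc Φ (ofRealVec δ)))
  change ovMat Φ Ψ *ᵥ xc (midPt Φ Ψ δ) = star (I • (cvec (δ ∘ Sum.inl) - Φ *ᵥ cvec (δ ∘ Sum.inr)))
    at h
  rw [ovMat_mulVec, star_smul, star_sub, star_mulVec_eq, star_cvec, star_cvec,
    show star I = -I from conj_I, ← smul_sub] at h
  have h' := smul_right_injective (Fin n → ℂ) I_ne_zero
    (h.trans (show _ = I • (-cvec (δ ∘ Sum.inl) + Φ.map star *ᵥ cvec (δ ∘ Sum.inr)) by module))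
  exact h'

theorem midPt_mem (δ : Ix n → ℝ) : midPt Φ Ψ δ ∈ lag Ψ 0 := by
  rw [mem_lag, smul_zero, sub_zero]; rfl

theorem star_midPt_sub_mem (hΦ : IsPhaseMatrix Φ) (hΨ : IsPhaseMatrix Ψ) (δ : Ix n → ℝ) :
    star (midPt Φ Ψ δ - ofRealVec δ) ∈ lag Φ 0 := by
  rw [star_mem_lag, star_zero, smul_zero, add_zero, sub_zc, sub_xc, mulVec_sub]
  have h := midPt_eq hΦ hΨ δ
  change Ψ *ᵥ xc (midPt Φ Ψ δ) - cvec (δ ∘ Sum.inl) = _ - _ *ᵥ cvec (δ ∘ Sum.inr)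
  linear_combination -h

theorem zero_mem_lag_zero (X : Matrix (Fin n) (Fin n) ℂ) : (0 : Phase n) ∈ lag X 0 := by
  rw [mem_lag]
  change (0 : Fin _ → ℂ) = X *ᵥ 0 - I • 0
  simp

theorem herm_sub_ofRealVec (p : Phase n) (δ : Ix n → ℝ) :
    herm (p - ofRealVec δ) = herm p - 2 * (omega p (ofRealVec δ)).im := by
  have h0 : omega (ofRealVec δ) (ofRealVec δ) = 0 := by
    rw [omega_eq, dotProduct_comm, sub_self]
  have h1 : omega (star p) (ofRealVec δ) = (starRingEnd ℂ) (omega p (ofRealVec δ)) := by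
    rw [← omega_star, star_ofRealVec]
  rw [herm, herm, star_sub, star_ofRealVec, omega_sub_left, omega_sub_right, omega_sub_right, h0,
    h1, omega_swap (ofRealVec δ) p]
  simp
  ring

/-- Let p be the midpoint. Then 2 Im ω(p, δ) is the Hermitian form of p minus that of p - δ. Since p
lies on the subspace of Ψ and p - δ on the conjugate of that of Φ, both contributions are
nonnegative, and both vanish only for δ = 0. -/
theorem ampForm_pos (hΦ : IsPhaseMatrix Φ) (hΨ : IsPhaseMatrix Ψ) {δ : Ix n → ℝ} (hδ : δ ≠ 0) :
    0 < ampForm Φ Ψ δ δ := by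
  by_contra hle
  have hle : 1 / 2 * (omega (midPt Φ Ψ δ) (ofRealVec δ)).im ≤ 0 := not_lt.1 hle
  have h1 := herm_sub_ofRealVec (midPt Φ Ψ δ) δ
  have h2 := herm_sub_nonneg hΨ (midPt_mem (Φ := Φ) δ) (zero_mem_lag_zero Ψ)
  have h3 := herm_sub_nonneg hΦ (star_midPt_sub_mem hΦ hΨ δ) (zero_mem_lag_zero Φ)
  rw [sub_zero] at h2 h3
  rw [herm_star] at h3
  have h4 := eq_of_herm_sub hΨ (midPt_mem (Φ := Φ) δ) (zero_mem_lag_zero Ψ) (by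
    rw [sub_zero]; linarith)
  have h5 := eq_of_herm_sub hΦ (star_midPt_sub_mem hΦ hΨ δ) (zero_mem_lag_zero Φ) (by
    rw [sub_zero, herm_star]; linarith)
  rw [h4, star_eq_zero, zero_sub, neg_eq_zero] at h5
  apply hδ
  apply ofRealVec_injective
  rw [h5]
  ext; simp [ofRealVec]

theorem ampForm_nonneg (hΦ : IsPhaseMatrix Φ) (hΨ : IsPhaseMatrix Ψ) (δ : Ix n → ℝ) :
    0 ≤ ampForm Φ Ψ δ δ := by
  by_cases h : δ = 0
  · simp [h]
  · exact (ampForm_pos hΦ hΨ h).le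

/-- The normalising factors exp(-tᵀVt/2) cancel against part of the overlap exponent, and the rest
depends only on the difference of the displacements. -/
theorem norm_inner_of_isGaussianWith (hΦ : IsPhaseMatrix Φ) (hΨ : IsPhaseMatrix Ψ) :
    ∃ C : ℝ, 0 < C ∧ ∀ {φ ψ : L2 n} {s t s' t' : Fin n → ℝ}, IsGaussianWith φ Φ s t →
      IsGaussianWith ψ Ψ s' t' → ‖(inner ℂ φ ψ : ℂ)‖ =
        C * Real.exp (-ampForm Φ Ψ (Sum.elim s t - Sum.elim s' t')
          (Sum.elim s t - Sum.elim s' t')) := by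
  have hd1 := hΦ.2.det_pos
  have hd2 := hΨ.2.det_pos
  refine ⟨((Φ.map Complex.im).det / Real.pi ^ n) ^ (1 / 4 : ℝ) *
    ((Ψ.map Complex.im).det / Real.pi ^ n) ^ (1 / 4 : ℝ) * ‖gaussConst (ovMat Φ Ψ)‖,
    mul_pos (by positivity) (norm_pos_iff.2 (ovConst_ne_zero hΦ hΨ)), ?_⟩
  intro φ ψ s t s' t' hφ hψ
  obtain ⟨c, rfl, hc⟩ := hφ.exists_norm_eq
  obtain ⟨c', rfl, hc'⟩ := hψ.exists_norm_eq
  rw [inner_smul_left, inner_smul_right, norm_mul, norm_mul, RCLike.norm_conj, hc, hc',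
    inner_gv hΦ hΨ, norm_mul, norm_exp]
  set δ : Ix n → ℝ := Sum.elim s t - Sum.elim s' t' with hδ
  set y := xc (midPt Φ Ψ δ) with hy
  have hδ1 : cvec (δ ∘ Sum.inl) = cvec s - cvec s' := by ext i; simp [cvec, hδ]
  have hδ2 : cvec (δ ∘ Sum.inr) = cvec t - cvec t' := by ext i; simp [cvec, hδ]
  have hmid := midPt_eq hΦ hΨ δ
  rw [← hy, hδ1, hδ2, mulVec_sub] at hmid
  have ha : star (lin Φ s t) + lin Ψ s' t' =
      I • (-(cvec s - cvec s') + Φ.map star *ᵥ cvec t - Ψ *ᵥ cvec t') := by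
    rw [lin, lin, star_smul, star_sub, star_mulVec_eq, star_cvec, star_cvec,
      show star I = -I from conj_I]
    module
  -- The stationary point of the overlap integrand is the position of the midpoint moved by t'.
  have hW : (ovMat Φ Ψ)⁻¹ *ᵥ (star (lin Φ s t) + lin Ψ s' t') = y + cvec t' := by
    apply ovMat_inv_mulVec hΦ hΨ
    rw [ovMat_mulVec, ha, ← smul_sub, mulVec_add, mulVec_add]
    congr 1
    linear_combination hmid
  rw [hW, ha]
  have hsymm : ∀ {X : Matrix (Fin n) (Fin n) ℂ}, X.IsSymm → ∀ u v, (X *ᵥ u) ⬝ᵥ v = u ⬝ᵥ X *ᵥ v :=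
    fun hX u v => by rw [mulVec_dotProduct_eq, hX.eq]
  have hΦs : (Φ.map star).IsSymm := by rw [Matrix.IsSymm, ← transpose_map, hΦ.1.eq]
  have hom : omega (midPt Φ Ψ δ) (ofRealVec δ) =
      (Ψ *ᵥ y) ⬝ᵥ (cvec t - cvec t') - y ⬝ᵥ (cvec s - cvec s') := by
    rw [omega_eq, ← hδ1, ← hδ2]; rfl
  have hquad : (I • (-(cvec s - cvec s') + Φ.map star *ᵥ cvec t - Ψ *ᵥ cvec t')) ⬝ᵥ (y + cvec t') =
      I * omega (midPt Φ Ψ δ) (ofRealVec δ) + I * (cvec t ⬝ᵥ Φ.map star *ᵥ cvec t) -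
        I * (cvec t' ⬝ᵥ Ψ *ᵥ cvec t') - I * ((cvec t + cvec t') ⬝ᵥ (cvec s - cvec s')) := by
    have hmid' := congrArg (cvec t ⬝ᵥ ·) hmid
    simp only [dotProduct_add, dotProduct_sub, dotProduct_neg] at hmid'
    rw [hom]
    simp only [smul_dotProduct, add_dotProduct, sub_dotProduct, neg_dotProduct, dotProduct_add,
      dotProduct_sub, hsymm hΦs, hsymm hΨ.1, smul_eq_mul, dotProduct_comm y (Ψ *ᵥ _)]
    rw [dotProduct_comm (cvec s) y, dotProduct_comm (cvec s') y, dotProduct_comm (cvec s) (cvec t'),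
      dotProduct_comm (cvec s') (cvec t')]
    linear_combination I * hmid'
  have hreal : ∀ (X : Matrix (Fin n) (Fin n) ℂ) (u : Fin n → ℝ), (cvec u ⬝ᵥ X *ᵥ cvec u).im =
      u ⬝ᵥ X.map Complex.im *ᵥ u := by
    intro X u
    conv_lhs => rw [cmat_re_add_im X, add_mulVec, smul_mulVec, cmat_mulVec, cmat_mulVec,
      dotProduct_add, dotProduct_smul, cvec_dotProduct, cvec_dotProduct, smul_eq_mul]
    simp
  have him : (Φ.map star).map Complex.im = -Φ.map Complex.im := by ext; simp
  have hss : ((cvec t + cvec t') ⬝ᵥ (cvec s - cvec s')).im = 0 := by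
    simp only [add_dotProduct, dotProduct_sub, cvec_dotProduct, add_im, sub_im, ofReal_im]
    norm_num
  have hre : (1 / 2 * ((I • (-(cvec s - cvec s') + Φ.map star *ᵥ cvec t - Ψ *ᵥ cvec t')) ⬝ᵥ
      (y + cvec t'))).re = 1 / 2 * (t ⬝ᵥ Φ.map Complex.im *ᵥ t) +
        1 / 2 * (t' ⬝ᵥ Ψ.map Complex.im *ᵥ t') + -ampForm Φ Ψ δ δ := by
    have e : ampForm Φ Ψ δ δ = 1 / 2 * (omega (midPt Φ Ψ δ) (ofRealVec δ)).im := rfl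
    rw [hquad, e, show (1 / 2 : ℂ) = ((1 / 2 : ℝ) : ℂ) by push_cast; rfl, re_ofReal_mul]
    simp only [sub_re, add_re, I_mul_re, hreal, him, hss, neg_mulVec, dotProduct_neg]
    ring
  rw [hre, Real.exp_add, Real.exp_add]
  have hcancel : ∀ r : ℝ, Real.exp (-(1 / 2) * r) * Real.exp (1 / 2 * r) = 1 := fun r => by
    rw [← Real.exp_add]; ring_nf; exact Real.exp_zero
  have c1 := hcancel (t ⬝ᵥ Φ.map Complex.im *ᵥ t)
  have c2 := hcancel (t' ⬝ᵥ Ψ.map Complex.im *ᵥ t')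
  generalize Real.exp (-(1 / 2) * (t ⬝ᵥ Φ.map Complex.im *ᵥ t)) = p1 at *
  generalize Real.exp (1 / 2 * (t ⬝ᵥ Φ.map Complex.im *ᵥ t)) = p2 at *
  generalize Real.exp (-(1 / 2) * (t' ⬝ᵥ Ψ.map Complex.im *ᵥ t')) = q1 at *
  generalize Real.exp (1 / 2 * (t' ⬝ᵥ Ψ.map Complex.im *ᵥ t')) = q2 at *
  generalize ((Φ.map Complex.im).det / Real.pi ^ n) ^ (1 / 4 : ℝ) = K1
  generalize ((Ψ.map Complex.im).det / Real.pi ^ n) ^ (1 / 4 : ℝ) = K2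
  generalize ‖gaussConst (ovMat Φ Ψ)‖ = K3
  generalize Real.exp (-ampForm Φ Ψ δ δ) = K4
  linear_combination K1 * K2 * K3 * K4 * (q1 * q2 * c1 + c2)

end

/-! ### The affine symplectomorphism of a Gaussian unitary -/

theorem smul_gv_unique {X Y : Matrix (Fin n) (Fin n) ℂ} {x y : Fin n → ℂ} {p q : ℂ}
    (hX : IsPhaseMatrix X) (hY : IsPhaseMatrix Y) (hp : p ≠ 0) (h : p • gv X x = q • gv Y y) :
    X = Y ∧ x = y := by
  refine gv_eq_smul hX hY (c := p⁻¹ * q) ?_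
  rw [← smul_smul, ← h, smul_smul, inv_mul_cancel₀ hp, one_smul]

/-- `U` acts on the Gaussian vectors of phase matrix `Φ` by the affine map `v ↦ S v + d`. -/
def ActsOn (U : L2 n ≃ₗᵢ[ℂ] L2 n) (Φ Φ' : Matrix (Fin n) (Fin n) ℂ) (S : Matrix (Ix n) (Ix n) ℝ)
    (d : Ix n → ℝ) : Prop :=
  ∀ v, ∃ c : ℂ, c ≠ 0 ∧ U (gv Φ (btc Φ v)) = c • gv Φ' (btc Φ' (cmat S *ᵥ v + ofRealVec d))

theorem ofRealVec_affine (S : Matrix (Ix n) (Ix n) ℝ) (d v : Ix n → ℝ) :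
    cmat S *ᵥ ofRealVec v + ofRealVec d = ofRealVec (S *ᵥ v + d) := by
  change cmat S *ᵥ cvec v + _ = _
  rw [cmat_mulVec, ofRealVec_add]; rfl

theorem ActsOn.isGaussianWith {U : L2 n ≃ₗᵢ[ℂ] L2 n} (hU : IsGaussianUnitary U)
    {Φ Φ' : Matrix (Fin n) (Fin n) ℂ} {S : Matrix (Ix n) (Ix n) ℝ} {d : Ix n → ℝ}
    (hΦ' : IsPhaseMatrix Φ') (h : ActsOn U Φ Φ' S d) {φ : L2 n} {s t : Fin n → ℝ}
    (hφ : IsGaussianWith φ Φ s t) :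
    IsGaussianWith (U φ) Φ' ((S *ᵥ Sum.elim s t + d) ∘ Sum.inl)
      ((S *ᵥ Sum.elim s t + d) ∘ Sum.inr) := by
  obtain ⟨c, hc, e⟩ := hφ.eq_smul
  obtain ⟨c', hc', e'⟩ := h (ofRealVec (Sum.elim s t))
  rw [ofRealVec_affine, btc_ofRealVec, btc_ofRealVec, Sum.elim_comp_inl, Sum.elim_comp_inr] at e'
  obtain ⟨Φ₂, s₂, t₂, h₂⟩ := hU φ ⟨Φ, s, t, hφ⟩
  obtain ⟨c₂, hc₂, e₂⟩ := h₂.eq_smul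
  have e₃ : c₂ • gv Φ₂ (lin Φ₂ s₂ t₂) = (c * c') • gv Φ' (lin Φ'
      ((S *ᵥ Sum.elim s t + d) ∘ Sum.inl) ((S *ᵥ Sum.elim s t + d) ∘ Sum.inr)) := by
    rw [← e₂, e, map_smul, e', smul_smul]
  obtain ⟨rfl, hl⟩ := smul_gv_unique h₂.1 hΦ' hc₂ e₃
  obtain ⟨rfl, rfl⟩ := lin_injective h₂.1 hl
  exact h₂

theorem mulVec_surjective_of_symplectic {S : Matrix (Ix n) (Ix n) ℝ}
    (hS : S ∈ symplecticGroup (Fin n) ℝ) : Function.Surjective (S *ᵥ ·) := fun v =>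
  ⟨S⁻¹ *ᵥ v, by
    simp only [mulVec_mulVec, mul_nonsing_inv _ (SymplecticGroup.symplectic_det hS), one_mulVec]⟩

/-- Transition amplitudes C exp(-q(δ)) with q positive definite are preserved by U. As the maximum
occurs only at equal displacements, U must send equal displacements to equal displacements for every
pair of phase matrices. -/
theorem ActsOn.unique {U : L2 n ≃ₗᵢ[ℂ] L2 n} (hU : IsGaussianUnitary U)
    {Φ Φ' Ψ Ψ' : Matrix (Fin n) (Fin n) ℂ} {S T : Matrix (Ix n) (Ix n) ℝ} {d e : Ix n → ℝ}
    (hΦ : IsPhaseMatrix Φ) (hΨ : IsPhaseMatrix Ψ) (hΦ' : IsPhaseMatrix Φ') (hΨ' : IsPhaseMatrix Ψ')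
    (hS : S ∈ symplecticGroup (Fin n) ℝ) (h : ActsOn U Φ Φ' S d) (h' : ActsOn U Ψ Ψ' T e) :
    S = T ∧ d = e := by
  obtain ⟨C, hC, hin⟩ := norm_inner_of_isGaussianWith hΦ hΨ
  obtain ⟨C', hC', hin'⟩ := norm_inner_of_isGaussianWith hΦ' hΨ'
  have key : ∀ u v : Ix n → ℝ, C' * Real.exp (-ampForm Φ' Ψ' ((S *ᵥ u + d) - (T *ᵥ v + e))
      ((S *ᵥ u + d) - (T *ᵥ v + e))) = C * Real.exp (-ampForm Φ Ψ (u - v) (u - v)) := by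
    intro u v
    obtain ⟨c, -, h1⟩ := exists_isGaussianWith hΦ (u ∘ Sum.inl) (u ∘ Sum.inr)
    obtain ⟨c', -, h2⟩ := exists_isGaussianWith hΨ (v ∘ Sum.inl) (v ∘ Sum.inr)
    have k1 := hin h1 h2
    have k2 := hin' (h.isGaussianWith hU hΦ' h1) (h'.isGaussianWith hU hΨ' h2)
    rw [U.inner_map_map, k1] at k2
    simp only [Sum.elim_comp_inl_inr] at k2
    exact k2.symm
  have hde : d = e := by
    by_contra hne
    have h0 := key 0 0
    -- If d ≠ e, equal displacements have images that differ, so C < C'. The displacements u and 0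
    -- with Su = e - d have equal images, so C' ≤ C.
    obtain ⟨u, hu⟩ := mulVec_surjective_of_symplectic hS (e - d)
    have hu : S *ᵥ u = e - d := hu
    have h1 := key u 0
    rw [hu] at h1
    simp only [mulVec_zero, zero_add, sub_add_cancel, sub_self, map_zero, neg_zero, Real.exp_zero,
      mul_one, sub_zero] at h0 h1
    have h2 : Real.exp (-ampForm Φ' Ψ' (d - e) (d - e)) < 1 := by
      rw [Real.exp_lt_one_iff]
      have := ampForm_pos hΦ' hΨ' (sub_ne_zero.2 hne)
      linarith
    have h3 : Real.exp (-ampForm Φ Ψ u u) ≤ 1 := by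
      rw [Real.exp_le_one_iff]
      have := ampForm_nonneg hΦ hΨ u
      linarith
    have h4 : C < C' := by rw [← h0]; exact mul_lt_of_lt_one_right hC' h2
    have h5 : C' ≤ C := by rw [h1]; exact mul_le_of_le_one_right hC.le h3
    linarith
  refine ⟨?_, hde⟩
  subst hde
  have hCC : C' = C := by
    have h0 := key 0 0
    simpa using h0
  have hST : ∀ u, (S - T) *ᵥ u = 0 := fun u => by
    by_contra hne
    have h1 := key u u
    rw [sub_self, map_zero, neg_zero, Real.exp_zero, mul_one, hCC,
      add_sub_add_right_eq_sub, ← sub_mulVec] at h1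
    have h2 := ampForm_pos hΦ' hΨ' hne
    have h3 : Real.exp (-ampForm Φ' Ψ' ((S - T) *ᵥ u) ((S - T) *ᵥ u)) = 1 :=
      mul_left_cancel₀ hC.ne' (h1.trans (mul_one C).symm)
    rw [Real.exp_eq_one_iff] at h3
    linarith
  rw [← sub_eq_zero]
  ext i j
  have := congrFun (hST (Pi.single j 1)) i
  simpa using this

theorem IsGaussianUnitary.exists_actsOn {U : L2 n ≃ₗᵢ[ℂ] L2 n} (hU : IsGaussianUnitary U) :
    ∃ (S : Matrix (Ix n) (Ix n) ℝ) (d : Ix n → ℝ), S ∈ symplecticGroup (Fin n) ℝ ∧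
      ∀ Φ, IsPhaseMatrix Φ → ∃ Φ', IsPhaseMatrix Φ' ∧ ActsOn U Φ Φ' S d := by
  obtain ⟨Φ₀, S, d, h0, hS, h⟩ := hU.exists_symplectic (isPhaseMatrix_I (n := n))
  refine ⟨S, d, hS, fun Φ hΦ => ?_⟩
  obtain ⟨Φ', T, e, hΦ', hT, h'⟩ := hU.exists_symplectic hΦ
  obtain ⟨rfl, rfl⟩ := ActsOn.unique hU isPhaseMatrix_I hΦ h0 hΦ' hS h h'
  exact ⟨Φ', hΦ', h'⟩

end

/-! ### Gaussian unitaries: covariance matrices and graph relations -/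

section

variable {n m k : ℕ}

section
variable {U : L2 n ≃ₗᵢ[ℂ] L2 n} {S : Matrix (Ix n) (Ix n) ℝ} {d : Ix n → ℝ}
  {Φ Φ' : Matrix (Fin n) (Fin n) ℂ}

/-- Points differing by a vector of the linear Lagrangian give the same Gaussian vector, so their
images give proportional ones. -/
theorem ActsOn.inL (hΦ' : IsPhaseMatrix Φ') (h : ActsOn U Φ Φ' S d) {v : Phase n} (hv : InL Φ v) :
    InL Φ' (cmat S *ᵥ v) := by
  have h0 : btc Φ v = btc Φ 0 := by
    rw [map_zero]
    change I • (zc v - Φ *ᵥ xc v) = 0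
    rw [show zc v = Φ *ᵥ xc v from hv, sub_self, smul_zero]
  obtain ⟨c, hc, e⟩ := h v
  obtain ⟨c', hc', e'⟩ := h 0
  rw [h0, e'] at e
  have h1 := (smul_gv_unique hΦ' hΦ' hc' e).2
  rw [mulVec_zero, zero_add, map_add, right_eq_add] at h1
  have h2 := smul_right_injective _ I_ne_zero (show I • (zc (cmat S *ᵥ v) - Φ' *ᵥ xc (cmat S *ᵥ v)) =
    I • 0 by rw [smul_zero]; exact h1)
  exact sub_eq_zero.1 h2

theorem symJ_eq (v : Phase n) : symJ v = -(cmat (J (Fin n) ℝ) *ᵥ v) := by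
  have e : cmat (J (Fin n) ℝ) = fromBlocks 0 (-1) 1 0 := by
    ext i j
    rcases i with i | i <;> rcases j with j | j <;> simp [cmat, J, Matrix.one_apply]
    all_goals split_ifs <;> simp
  rw [e, fromBlocks_mulVec]
  ext i
  rcases i with i | i <;> simp [symJ, neg_mulVec, zc, xc]

/-- S carries the subspace of Φ to that of Φ'. Applied to the covariance criterion at Sᵀξ, together
with SJSᵀ = J, this is the criterion for Φ' with matrix SΣSᵀ. -/
theorem ActsOn.phaseCov_eq (hΦ : IsPhaseMatrix Φ) (hΦ' : IsPhaseMatrix Φ')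
    (hS : S ∈ symplecticGroup (Fin n) ℝ) (h : ActsOn U Φ Φ' S d) :
    S * phaseCov Φ * Sᵀ = phaseCov Φ' := by
  refine eq_phaseCov hΦ' fun ξ => ?_
  have h1 := h.inL hΦ' (inL_phaseCov hΦ (cmat Sᵀ *ᵥ ξ))
  have h2 : cmat S *ᵥ symJ (cmat Sᵀ *ᵥ ξ) = symJ ξ := by
    rw [symJ_eq, symJ_eq, mulVec_neg, mulVec_mulVec, mulVec_mulVec, ← cmat_mul, ← cmat_mul,
      SymplecticGroup.mem_iff.1 hS]
  rw [mulVec_add, mulVec_smul, mulVec_smul, h2, mulVec_mulVec, mulVec_mulVec, ← cmat_mul,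
    ← cmat_mul] at h1
  exact h1

theorem representsUnitary_of_actsOn (hU : IsGaussianUnitary U)
    (hS : S ∈ symplecticGroup (Fin n) ℝ)
    (h : ∀ Φ, IsPhaseMatrix Φ → ∃ Φ', IsPhaseMatrix Φ' ∧ ActsOn U Φ Φ' S d) :
    RepresentsUnitary S d U := by
  refine ⟨hS, ?_⟩
  rintro φ C μ ⟨Φ, s, t, hφ⟩ hW
  obtain ⟨rfl, rfl⟩ := hW.eq_of_isGaussianWith hφ
  obtain ⟨Φ', hΦ', hA⟩ := h Φ hφ.1
  rw [hA.phaseCov_eq hφ.1 hΦ' hS]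
  have := hasWignerData_of_isGaussianWith (hA.isGaussianWith hU hΦ' hφ)
  rwa [Sum.elim_comp_inl_inr] at this

theorem RepresentsUnitary.unique {S' : Matrix (Ix n) (Ix n) ℝ} {d' : Ix n → ℝ}
    (h : RepresentsUnitary S d U) (h' : RepresentsUnitary S' d' U) : S = S' ∧ d = d' := by
  have key : ∀ μ : Ix n → ℝ, S *ᵥ μ + d = S' *ᵥ μ + d' := by
    intro μ
    obtain ⟨c, -, hφ⟩ := exists_isGaussianWith (isPhaseMatrix_I (n := n)) (μ ∘ Sum.inl) (μ ∘ Sum.inr)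
    have hW := hasWignerData_of_isGaussianWith hφ
    rw [Sum.elim_comp_inl_inr] at hW
    exact ((h.2 _ _ _ ⟨_, _, _, hφ⟩ hW).unique (h'.2 _ _ _ ⟨_, _, _, hφ⟩ hW)).2
  have hd : d = d' := by simpa using key 0
  refine ⟨?_, hd⟩
  ext i j
  have := congrFun (key (Pi.single j 1)) i
  rw [hd] at this
  simpa using this

theorem existsUnique_representsUnitary (hU : IsGaussianUnitary U) :
    ∃! p : Matrix (Ix n) (Ix n) ℝ × (Ix n → ℝ), RepresentsUnitary p.1 p.2 U := by
  obtain ⟨S, d, hS, h⟩ := hU.exists_actsOn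
  refine ⟨(S, d), representsUnitary_of_actsOn hU hS h, fun p hp => ?_⟩
  obtain ⟨h1, h2⟩ := hp.unique (representsUnitary_of_actsOn hU hS h)
  exact Prod.ext h1 h2

theorem mem_graphRel {u v : Phase n} : (u, v) ∈ graphRel S d ↔ v = cmat S *ᵥ u + ofRealVec d :=
  Iff.rfl

theorem cmat_mulVec_inv (hS : S ∈ symplecticGroup (Fin n) ℝ) (v : Phase n) :
    cmat S *ᵥ cmat S⁻¹ *ᵥ v = v := by
  rw [mulVec_mulVec, ← cmat_mul, mul_nonsing_inv _ (SymplecticGroup.symplectic_det hS), cmat_one,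
    one_mulVec]

theorem cmat_inv_mulVec (hS : S ∈ symplecticGroup (Fin n) ℝ) (v : Phase n) :
    cmat S⁻¹ *ᵥ cmat S *ᵥ v = v := by
  rw [mulVec_mulVec, ← cmat_mul, nonsing_inv_mul _ (SymplecticGroup.symplectic_det hS), cmat_one,
    one_mulVec]

theorem omega_eq_dotProduct (u v : Phase n) : omega u v = -(u ⬝ᵥ cmat (J (Fin n) ℝ) *ᵥ v) := by
  rw [← dotProduct_neg, ← symJ_eq, omega_eq, symJ]
  simp [dotProduct, zc, xc, Finset.sum_neg_distrib, sub_eq_add_neg]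

theorem isPosAffLag_graphRel (hS : S ∈ symplecticGroup (Fin n) ℝ) (d : Ix n → ℝ) :
    IsPosAffLag (graphRel S d) := by
  refine isPosAffLag_graph (Matrix.toLin' (cmat S)) (fun v => ⟨cmat S⁻¹ *ᵥ v, ?_⟩)
    (fun u v => ?_) (fun u => ?_) d
  · rw [toLin'_apply, cmat_mulVec_inv hS]
  · rw [toLin'_apply, toLin'_apply, omega_eq_dotProduct, omega_eq_dotProduct, mulVec_dotProduct_eq,
      mulVec_mulVec, mulVec_mulVec, ← cmat_transpose, ← cmat_mul, ← cmat_mul,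
      SymplecticGroup.mem_iff'.1 hS]
  · rw [toLin'_apply, toLin'_apply, star_mulVec_eq]
    congr 1
    ext i j; simp [cmat]

theorem fwd_unitary (hS : S ∈ symplecticGroup (Fin n) ℝ)
    (h : ∀ Φ, IsPhaseMatrix Φ → ∃ Φ', IsPhaseMatrix Φ' ∧ ActsOn U Φ Φ' S d) :
    Fwd (unitaryOp U) (graphRel S d) := by
  intro Φ b hΦ
  obtain ⟨Φ', hΦ', hA⟩ := h Φ hΦ
  have hb : ∀ v, btc Φ v = b → ∃ c : ℂ, c ≠ 0 ∧
      U (gv Φ b) = c • gv Φ' (btc Φ' (cmat S *ᵥ v + ofRealVec d)) := by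
    rintro v rfl; exact hA v
  obtain ⟨s, t, hst⟩ := exists_lin_eq hΦ b
  obtain ⟨c, hc, e⟩ := hb (ofRealVec (Sum.elim s t)) hst
  refine ⟨Φ', _, c, hΦ', hc, e, ?_⟩
  ext w
  rw [mem_lag_iff_btc]
  constructor
  · rintro ⟨u, hu, huw⟩
    rw [mem_lag_iff_btc] at hu
    obtain ⟨c', hc', e'⟩ := hb u hu
    rw [mem_graphRel.1 huw]
    exact (smul_gv_unique hΦ' hΦ' hc' (e'.symm.trans e)).2
  · intro hw
    have hwu : w = cmat S *ᵥ (cmat S⁻¹ *ᵥ (w - ofRealVec d)) + ofRealVec d := by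
      rw [cmat_mulVec_inv hS, sub_add_cancel]
    refine ⟨cmat S⁻¹ *ᵥ (w - ofRealVec d), ?_, mem_graphRel.2 hwu⟩
    rw [mem_lag_iff_btc]
    obtain ⟨c', hc', e'⟩ := hA (cmat S⁻¹ *ᵥ (w - ofRealVec d))
    rw [← hwu, hw] at e'
    have : gv Φ (btc Φ (cmat S⁻¹ *ᵥ (w - ofRealVec d))) = (c' * c⁻¹) • gv Φ b := by
      apply U.injective
      rw [e', map_smul, e, smul_smul, inv_mul_cancel_right₀ hc]
    exact (gv_eq_smul hΦ hΦ this).2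

theorem adjoint_unitaryOp (U : L2 n ≃ₗᵢ[ℂ] L2 n) : (unitaryOp U).adjoint = unitaryOp U.symm := by
  symm
  rw [ContinuousLinearMap.eq_adjoint_iff]
  intro x y
  change inner ℂ (U.symm x) y = inner ℂ x (U y)
  rw [← U.inner_map_map (U.symm x) y, U.apply_symm_apply]

/-- The inverse of U is not assumed Gaussian. For the backward condition the inverse image of `lag Ψ
a` is again some `lag Φ b`; the forward condition sends it back to `lag Ψ a`, so U maps `gv Φ b` to
a multiple of `gv Ψ a`. -/
theorem rep_unitary_of_actsOn (hS : S ∈ symplecticGroup (Fin n) ℝ)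
    (h : ∀ Φ, IsPhaseMatrix Φ → ∃ Φ', IsPhaseMatrix Φ' ∧ ActsOn U Φ Φ' S d) :
    Rep (unitaryOp U) (graphRel S d) := by
  have hP := isPosAffLag_graphRel hS d
  have hF := fwd_unitary hS h
  have hdag : ∀ {u v : Phase n}, (u, v) ∈ dag (graphRel S d) ↔ (v, u) ∈ graphRel S d := by
    intro u v
    rw [mem_dag, mem_graphRel, mem_graphRel, ← star_inj, star_star, star_add, star_ofRealVec,
      star_mulVec_eq, star_star]
    have : (cmat S).map star = cmat S := by ext; simp [cmat]
    rw [this]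
  refine ⟨hP, hF, fun Ψ a hΨ => ?_⟩
  obtain ⟨Φ, b, hΦ, hlag⟩ := exists_lag_relImage (isPosAffLag_dag hP) (b := a) (fun u v v' h1 h2 _ => by
      rw [hdag, mem_graphRel] at h1 h2
      have h3 := add_right_cancel (h1.symm.trans h2)
      rw [← cmat_inv_mulVec hS v, h3, cmat_inv_mulVec hS]) hΨ (by
      refine ⟨cmat S⁻¹ *ᵥ (Sum.elim (Ψ *ᵥ 0 - I • a) 0 - ofRealVec d),
        Sum.elim (Ψ *ᵥ 0 - I • a) 0, rfl, ?_⟩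
      rw [hdag, mem_graphRel, cmat_mulVec_inv hS, sub_add_cancel])
  obtain ⟨Φ', b', c, h1, h2, h3, h4⟩ := hF Φ b hΦ
  have h5 : relImage (graphRel S d) (lag Φ b) = lag Ψ a := by
    rw [← hlag]
    ext w
    constructor
    · rintro ⟨u, ⟨w', hw', hu⟩, huw⟩
      rw [hdag, mem_graphRel] at hu
      rw [mem_graphRel.1 huw, ← hu]; exact hw'
    · intro hw
      have : w = cmat S *ᵥ (cmat S⁻¹ *ᵥ (w - ofRealVec d)) + ofRealVec d := by
        rw [cmat_mulVec_inv hS, sub_add_cancel]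
      exact ⟨cmat S⁻¹ *ᵥ (w - ofRealVec d), ⟨w, hw, hdag.2 this⟩, this⟩
  obtain ⟨rfl, rfl⟩ := lag_injective (h4.symm.trans h5)
  refine ⟨Φ, b, c⁻¹, hΦ, inv_ne_zero h2, ?_, hlag⟩
  rw [adjoint_unitaryOp]
  change U.symm _ = _
  have h3 : U (gv Φ b) = _ := h3
  rw [LinearIsometryEquiv.symm_apply_eq, map_smul, h3, smul_smul, inv_mul_cancel₀ h2, one_smul]

theorem rep_unitary (hU : IsGaussianUnitary U) (h : RepresentsUnitary S d U) :
    Rep (unitaryOp U) (graphRel S d) := by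
  obtain ⟨S', d', hS', hA⟩ := hU.exists_actsOn
  obtain ⟨rfl, rfl⟩ := h.unique (representsUnitary_of_actsOn hU hS' hA)
  exact rep_unitary_of_actsOn hS' hA

end

/-! ### The embedding -/

theorem IsQGauss.exists_rep {T : L2 n →L[ℂ] L2 m} (h : IsQGauss T) : ∃ R, Rep T R := by
  induction h with
  | state φ h => obtain ⟨Φ, s, t, h⟩ := h; exact ⟨_, rep_ket h⟩
  | unitary U h =>
    obtain ⟨p, hp, -⟩ := existsUnique_representsUnitary h
    exact ⟨_, rep_unitary h hp⟩
  | effect ψ h => obtain ⟨Φ, s, t, h⟩ := h; exact ⟨_, rep_bra h⟩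
  | id n => exact ⟨_, rep_id n⟩
  | swap n m => exact ⟨_, rep_swap n m⟩
  | comp S T _ _ hS hT =>
    obtain ⟨R, hR⟩ := hS
    obtain ⟨R', hR'⟩ := hT
    exact ⟨_, hR.comp hR'⟩
  | tensor Q T S _ _ hQ hT hS =>
    obtain ⟨R, hR⟩ := hT
    obtain ⟨R', hR'⟩ := hS
    exact ⟨_, hR.tensor hR' hQ⟩

/-- One relation represents all operators of the class, since scalars do not affect it. -/
theorem QGauss.exists_rep (q : QGauss n m) :
    ∃ R : ALRPlus n m, ∀ T hT, q = QGauss.mk T hT → Rep T R.1 := by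
  obtain ⟨T, hT, rfl⟩ := QGauss.mk_surj q
  obtain ⟨R, hR⟩ := hT.exists_rep
  refine ⟨⟨R, hR.posAffLag⟩, fun T' hT' e => ?_⟩
  obtain ⟨c, hc, rfl⟩ := QGauss.exists_smul_of_mk_eq e
  exact hR.smul hc

/-- The relation of a morphism of `QGauss`. -/
def toRel (q : QGauss n m) : ALRPlus n m := (QGauss.exists_rep q).choose

theorem rep_toRel {T : L2 n →L[ℂ] L2 m} (hT : IsQGauss T) : Rep T (toRel (QGauss.mk T hT)).1 :=
  (QGauss.exists_rep (QGauss.mk T hT)).choose_spec T hT rfl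

theorem toRel_eq {T : L2 n →L[ℂ] L2 m} (hT : IsQGauss T) {R : Set (Phase n × Phase m)}
    (h : Rep T R) : (toRel (QGauss.mk T hT)).1 = R := (rep_toRel hT).unique h

/-- The embedding of quantum Gaussian transformations into positive affine Lagrangian relations. -/
def embedding : PropEmbedding where
  map := toRel
  map_id n := toRel_eq _ (rep_id n)
  map_comp S T := by
    obtain ⟨S, hS, rfl⟩ := QGauss.mk_surj S
    obtain ⟨T, hT, rfl⟩ := QGauss.mk_surj T
    rw [QGauss.mk_comp_mk]
    exact toRel_eq _ ((rep_toRel hS).comp (rep_toRel hT))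
  map_tensor := by
    rintro n m n' m' _ _ _ ⟨r, t, s, hr, ht, hs, rfl, rfl, rfl, h⟩
    exact toRel_eq _ ((rep_toRel ht).tensor (rep_toRel hs) h)
  map_swap n m := toRel_eq _ (rep_swap n m)
  faithful := by
    intro n m q q' h
    obtain ⟨T, hT, rfl⟩ := QGauss.mk_surj q
    obtain ⟨T', hT', rfl⟩ := QGauss.mk_surj q'
    have h1 := rep_toRel hT
    rw [h] at h1
    obtain ⟨c, hc, e⟩ := h1.exists_eq_smul (rep_toRel hT')
    exact QGauss.mk_eq_mk hc e

end

section

variable {n m k : ℕ}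

/-! ### Projections and Schur complements -/

theorem mulVec_comp_fstIx (M : Matrix (Ix (m + n)) (Ix (m + n)) ℂ) (v : Phase (m + n)) :
    (M *ᵥ v) ∘ fstIx m n = M.submatrix (fstIx m n) (fstIx m n) *ᵥ (v ∘ fstIx m n) +
      M.submatrix (fstIx m n) (sndIx m n) *ᵥ (v ∘ sndIx m n) := by
  ext i
  simp [mulVec, dotProduct, Fin.sum_univ_add, fstIx, sndIx]
  ring

theorem mulVec_comp_sndIx (M : Matrix (Ix (m + n)) (Ix (m + n)) ℂ) (v : Phase (m + n)) :
    (M *ᵥ v) ∘ sndIx m n = M.submatrix (sndIx m n) (fstIx m n) *ᵥ (v ∘ fstIx m n) +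
      M.submatrix (sndIx m n) (sndIx m n) *ᵥ (v ∘ sndIx m n) := by
  ext i
  simp [mulVec, dotProduct, Fin.sum_univ_add, fstIx, sndIx]
  ring

theorem symJ_comp_fstIx (v : Phase (m + n)) : symJ v ∘ fstIx m n = symJ (v ∘ fstIx m n) := by
  ext i; rcases i with i | i <;> rfl

theorem symJ_comp_sndIx (v : Phase (m + n)) : symJ v ∘ sndIx m n = symJ (v ∘ sndIx m n) := by
  ext i; rcases i with i | i <;> rfl

theorem inL_iff_mem_lag {Φ : Matrix (Fin n) (Fin n) ℂ} {v : Phase n} :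
    InL Φ v ↔ v ∈ lag Φ 0 := by
  rw [mem_lag, smul_zero, sub_zero, InL]

section
variable {Φ : Matrix (Fin (m + n)) (Fin (m + n)) ℂ} {Ψ : Matrix (Fin n) (Fin n) ℂ}

theorem isUnit_det_add (hΦ : IsPhaseMatrix Φ) (hΨ : IsPhaseMatrix Ψ) :
    IsUnit ((phaseCov Φ).submatrix (sndIx m n) (sndIx m n) + phaseCov Ψ).det := by
  have hinj : Function.Injective (sndIx m n) :=
    Sum.map_injective.2 ⟨Fin.natAdd_injective _ _, Fin.natAdd_injective _ _⟩
  exact (((phaseCov_posDef hΦ).submatrix hinj).add (phaseCov_posDef hΨ)).det_pos.ne'.isUnit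

/-- The vector `2 C ζ + i J ζ` with `ζ = (ξ, η)`, split into its two groups of modes. -/
theorem jn_mem_lag_of_phaseCov (hΦ : IsPhaseMatrix Φ) (ξ : Phase m) (η : Phase n) :
    InL Φ (jn ((2 : ℂ) • (cmat ((phaseCov Φ).submatrix (fstIx m n) (fstIx m n)) *ᵥ ξ +
        cmat ((phaseCov Φ).submatrix (fstIx m n) (sndIx m n)) *ᵥ η) + I • symJ ξ)
      ((2 : ℂ) • (cmat ((phaseCov Φ).submatrix (sndIx m n) (fstIx m n)) *ᵥ ξ +
        cmat ((phaseCov Φ).submatrix (sndIx m n) (sndIx m n)) *ᵥ η) + I • symJ η)) := by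
  convert inL_phaseCov hΦ (jn ξ η) using 1
  refine phase_ext ?_ ?_
  · rw [jn_fstIx]
    change _ = (2 : ℂ) • ((cmat (phaseCov Φ) *ᵥ jn ξ η) ∘ fstIx m n) + I • (symJ (jn ξ η) ∘ fstIx m n)
    rw [mulVec_comp_fstIx, symJ_comp_fstIx, jn_fstIx, jn_sndIx]
    rfl
  · rw [jn_sndIx]
    change _ = (2 : ℂ) • ((cmat (phaseCov Φ) *ᵥ jn ξ η) ∘ sndIx m n) + I • (symJ (jn ξ η) ∘ sndIx m n)
    rw [mulVec_comp_sndIx, symJ_comp_sndIx, jn_fstIx, jn_sndIx]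
    rfl

theorem cmat_sub {ι κ : Type} (A B : Matrix ι κ ℝ) : cmat (A - B) = cmat A - cmat B := by
  ext; simp [cmat]

theorem cmat_add {ι κ : Type} (A B : Matrix ι κ ℝ) : cmat (A + B) = cmat A + cmat B := by
  ext; simp [cmat]

theorem symJ_star (v : Phase n) : symJ (star v) = star (symJ v) := by
  ext i; rcases i with i | i <;> simp [symJ, zc, xc]

theorem star_cmat_mulVec {ι κ : Type} [Fintype ι] (A : Matrix κ ι ℝ) (v : ι → ℂ) :
    star (cmat A *ᵥ v) = cmat A *ᵥ star v := by
  ext i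
  simp [mulVec, dotProduct, cmat]

/-- In the covariance criterion for Φ at (ξ, η), choose η so that the second component lies in the
conjugate of the subspace of Ψ, that is Σ_{nm}ξ + Σ_{nn}η = -Δη. The first component is then the
criterion for the contraction, with the Schur complement as matrix. -/
theorem schurCov_eq_phaseCov (hΦ : IsPhaseMatrix Φ) (hΨ : IsPhaseMatrix Ψ) :
    schurCov (phaseCov Φ) (phaseCov Ψ) = phaseCov (ctrMat Φ Ψ) := by
  refine eq_phaseCov (isPhaseMatrix_ctrMat hΦ hΨ) fun ξ => ?_
  set C₁₁ := (phaseCov Φ).submatrix (fstIx m n) (fstIx m n)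
  set C₁₂ := (phaseCov Φ).submatrix (fstIx m n) (sndIx m n)
  set C₂₁ := (phaseCov Φ).submatrix (sndIx m n) (fstIx m n)
  set C₂₂ := (phaseCov Φ).submatrix (sndIx m n) (sndIx m n)
  set D := phaseCov Ψ
  set η : Phase n := -(cmat (C₂₂ + D)⁻¹ *ᵥ cmat C₂₁ *ᵥ ξ) with hη
  have hη' : cmat C₂₁ *ᵥ ξ + cmat C₂₂ *ᵥ η = -(cmat D *ᵥ η) := by
    have : cmat (C₂₂ + D) *ᵥ η = -(cmat C₂₁ *ᵥ ξ) := by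
      rw [hη, mulVec_neg, mulVec_mulVec, ← cmat_mul, mul_nonsing_inv _ (isUnit_det_add hΦ hΨ),
        cmat_one, one_mulVec]
    rw [cmat_add, add_mulVec] at this
    linear_combination this
  have h1 := jn_mem_lag_of_phaseCov hΦ ξ η
  rw [hη'] at h1
  have h2 : star ((2 : ℂ) • -(cmat D *ᵥ η) + I • symJ η) ∈ lag Ψ 0 := by
    rw [← inL_iff_mem_lag]
    convert (inL_phaseCov hΨ (star η)).smul (-1) using 1
    rw [star_add, star_smul, star_smul, star_neg, star_cmat_mulVec, symJ_star,
      show star I = -I from conj_I, show star (2 : ℂ) = 2 by simp]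
    module
  have h3 : schurCov (phaseCov Φ) D = C₁₁ - C₁₂ * (C₂₂ + D)⁻¹ * C₂₁ := rfl
  have h4 : (2 : ℂ) • (cmat C₁₁ *ᵥ ξ + cmat C₁₂ *ᵥ η) + I • symJ ξ =
      (2 : ℂ) • cmat (schurCov (phaseCov Φ) D) *ᵥ ξ + I • symJ ξ := by
    rw [h3, cmat_sub, sub_mulVec, cmat_mul, cmat_mul, ← mulVec_mulVec, ← mulVec_mulVec, hη,
      mulVec_neg, sub_eq_add_neg]
  rw [h4] at h1
  have h5 : (2 : ℂ) • cmat (schurCov (phaseCov Φ) D) *ᵥ ξ + I • symJ ξ ∈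
      ctrSet (lag Φ 0) (lag Ψ 0) := ⟨_, h2, inL_iff_mem_lag.1 h1⟩
  rw [ctrSet_lag hΦ 0 hΨ] at h5
  have h6 : ctrVec Φ 0 Ψ 0 = 0 := by
    have e0 : (star (0 : Fin n → ℂ) + rgt (0 : Fin (m + n) → ℂ)) = 0 := by
      ext i; simp [rgt]
    have e1 : (lft (0 : Fin (m + n) → ℂ)) = 0 := rfl
    rw [ctrVec, e0, e1]
    simp
  rw [h6] at h5
  exact inL_iff_mem_lag.2 h5

/-- It suffices to exhibit the mean as a real point of the contraction. The displacement of φ is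
moved along its Lagrangian by half the criterion vector of (0, κ); the value of κ makes the second
component conjugate to a point on the Lagrangian of ψ and the first component real. -/
theorem ofRealVec_schurMean_mem (hΦ : IsPhaseMatrix Φ) (hΨ : IsPhaseMatrix Ψ)
    (s t : Fin (m + n) → ℝ) (s' t' : Fin n → ℝ) :
    ofRealVec (schurMean (phaseCov Φ) (Sum.elim s t) (phaseCov Ψ) (Sum.elim s' t')) ∈
      lag (ctrMat Φ Ψ) (ctrVec Φ (lin Φ s t) Ψ (lin Ψ s' t')) := by
  rw [← ctrSet_lag hΦ _ hΨ]
  set μ : Ix (m + n) → ℝ := Sum.elim s t with hμ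
  set ν : Ix n → ℝ := Sum.elim s' t' with hν
  set C₁₁ := (phaseCov Φ).submatrix (fstIx m n) (fstIx m n)
  set C₁₂ := (phaseCov Φ).submatrix (fstIx m n) (sndIx m n) with hC₁₂
  set C₂₁ := (phaseCov Φ).submatrix (sndIx m n) (fstIx m n)
  set C₂₂ := (phaseCov Φ).submatrix (sndIx m n) (sndIx m n) with hC₂₂
  set D := phaseCov Ψ with hD
  set κ : Ix n → ℝ := -((C₂₂ + D)⁻¹ *ᵥ (μ ∘ sndIx m n - ν)) with hκ
  have hκ' : C₂₂ *ᵥ κ + D *ᵥ κ = -(μ ∘ sndIx m n - ν) := by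
    rw [← add_mulVec, hκ, mulVec_neg, mulVec_mulVec, mul_nonsing_inv _ (isUnit_det_add hΦ hΨ),
      one_mulVec]
  have hs0 : symJ (0 : Phase m) = 0 := by
    ext i; rcases i with i | i <;> simp [symJ, zc, xc]
  have h1 := (jn_mem_lag_of_phaseCov hΦ (0 : Phase m) (ofRealVec κ)).smul (1 / 2)
  have h2 := mem_lag_add (ofRealVec_mem_lag Φ s t) h1
  refine ⟨ofRealVec (μ ∘ sndIx m n) + (cmat C₂₂ *ᵥ ofRealVec κ + (I / 2) • symJ (ofRealVec κ)),
    ?_, ?_⟩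
  · have h3 := (inL_phaseCov hΨ (ofRealVec κ)).smul (-(1 / 2))
    have h4 := mem_lag_add (ofRealVec_mem_lag Ψ s' t') h3
    convert h4 using 1
    have e1 : cmat C₂₂ *ᵥ ofRealVec κ = ofRealVec ν - ofRealVec (μ ∘ sndIx m n) -
        cmat D *ᵥ ofRealVec κ := by
      change cmat C₂₂ *ᵥ cvec κ = _ - cmat D *ᵥ cvec κ
      rw [cmat_mulVec, cmat_mulVec, eq_sub_of_add_eq hκ', ← ofRealVec_sub]
      ext i
      simp [cvec, ofRealVec]
    rw [e1, star_add, star_add, star_sub, star_sub, star_cmat_mulVec, star_smul, ← symJ_star,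
      star_ofRealVec, star_ofRealVec, star_ofRealVec, show star (I / 2) = -(I / 2) by simp; ring]
    module
  · convert h2 using 1
    refine phase_ext ?_ ?_
    · rw [jn_fstIx]
      change _ = ofRealVec (μ ∘ fstIx m n) + (1 / 2 : ℂ) • (jn _ _ ∘ fstIx m n)
      rw [jn_fstIx, hs0, mulVec_zero, zero_add, smul_zero, add_zero, smul_smul]
      change ofRealVec (μ ∘ fstIx m n - (C₁₂ * (C₂₂ + D)⁻¹) *ᵥ (μ ∘ sndIx m n - ν)) =
        _ + _ • cmat C₁₂ *ᵥ cvec κ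
      rw [cmat_mulVec, hκ, mulVec_neg, mulVec_mulVec]
      ext i
      simp [cvec, ofRealVec, sub_eq_add_neg]
    · rw [jn_sndIx]
      change _ = ofRealVec (μ ∘ sndIx m n) + (1 / 2 : ℂ) • (jn _ _ ∘ sndIx m n)
      rw [jn_sndIx, mulVec_zero, zero_add]
      module

theorem tensor_bra_apply {ψ : L2 n} {r : L2 (m + n) →L[ℂ] L2 (m + 0)}
    (h : IsTensorOp r (ContinuousLinearMap.id ℂ (L2 m)) (bra ψ)) (f : L2 m) (φ : L2 (m + n)) :
    inner ℂ f (r φ) = inner ℂ (tensorVec f ψ) φ := by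
  have h1 := h.adjoint f unitVec
  rw [tensorVec_unitVec, ← adjoint_ket, ContinuousLinearMap.adjoint_adjoint, ket_unitVec] at h1
  have h2 : (ContinuousLinearMap.id ℂ (L2 m)).adjoint f = f := by
    rw [show (ContinuousLinearMap.id ℂ (L2 m)).adjoint = ContinuousLinearMap.id ℂ (L2 m) from
      ContinuousLinearMap.adjoint_id]
    rfl
  rw [h2] at h1
  rw [← h1]
  exact (ContinuousLinearMap.adjoint_inner_left r φ f).symm

/-- The projected vector is a partial inner product, hence a multiple of a Gaussian vector. The
state χ is its normalisation, and its displacement is the only real point of its Lagrangian. -/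
theorem exists_projection (φ : L2 (m + n)) (hφ : IsGaussianState φ) (ψ : L2 n)
    (hψ : IsGaussianState ψ) (P : QGauss (m + n) (m + 0))
    (hP : QGauss.IsTensor P (QGauss.id m) (QGauss.effect ψ hψ)) :
    ∃ (χ : L2 (m + 0)) (hχ : IsGaussianState χ),
      P.comp (QGauss.state φ hφ) = QGauss.state χ hχ ∧
      ∀ C μ D ν, HasWignerData φ C μ → HasWignerData ψ D ν →
        HasWignerData χ (schurCov C D) (schurMean C μ D ν) := by
  obtain ⟨r, hr, rfl, hT⟩ := hP.exists_op
  obtain ⟨Φ, s, t, hφ'⟩ := id hφ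
  obtain ⟨Ψ, s', t', hψ'⟩ := id hψ
  obtain ⟨c₁, hc₁, e₁⟩ := hφ'.eq_smul
  obtain ⟨c₂, hc₂, e₂⟩ := hψ'.eq_smul
  obtain ⟨c₃, hc₃, h₃⟩ := exists_inner_tensorVec_gv hφ'.1 (lin Φ s t) hψ'.1 (lin Ψ s' t')
  have hct := isPhaseMatrix_ctrMat hφ'.1 hψ'.1
  obtain ⟨c₄, s'', t'', hc₄, hl, hχ⟩ :=
    exists_state_of_gv hct (ctrVec Φ (lin Φ s t) Ψ (lin Ψ s' t'))
  have hrφ : r φ = (c₁ * (starRingEnd ℂ) c₂ * c₃) •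
      gv (ctrMat Φ Ψ) (ctrVec Φ (lin Φ s t) Ψ (lin Ψ s' t')) := by
    refine ext_inner_coh fun w => ?_
    have := tensor_bra_apply hT (coh w) φ
    rw [e₁, e₂, tensorVec_smul_right, inner_smul_left, inner_smul_right, h₃] at this
    rw [inner_smul_right, e₁]
    refine this.trans ?_
    ring
  have hc : (c₁ * (starRingEnd ℂ) c₂ * c₃) ≠ 0 :=
    mul_ne_zero (mul_ne_zero hc₁ (by simpa using hc₂)) hc₃
  refine ⟨c₄ • gv (ctrMat Φ Ψ) (ctrVec Φ (lin Φ s t) Ψ (lin Ψ s' t')), ⟨_, _, _, hχ⟩, ?_, ?_⟩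
  · refine QGauss.mk_eq_mk (c := c₄ * (c₁ * (starRingEnd ℂ) c₂ * c₃)⁻¹)
      (mul_ne_zero hc₄ (inv_ne_zero hc)) ?_
    ext1 f
    have : r (ket φ f) = inner ℂ unitVec f • r φ := by
      rw [ket, ContinuousLinearMap.smulRight_apply, innerSL_apply_apply, map_smul]
    change (inner ℂ unitVec f : ℂ) •
        (c₄ • gv (ctrMat Φ Ψ) (ctrVec Φ (lin Φ s t) Ψ (lin Ψ s' t'))) =
      (c₄ * (c₁ * (starRingEnd ℂ) c₂ * c₃)⁻¹) • r (ket φ f)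
    rw [this, hrφ, smul_smul, smul_smul, smul_smul]
    congr 1
    have hc₂' : (starRingEnd ℂ) c₂ ≠ 0 := by simpa using hc₂
    field_simp
  · intro C μ D ν hC hD
    obtain ⟨rfl, rfl⟩ := hC.eq_of_isGaussianWith hφ'
    obtain ⟨rfl, rfl⟩ := hD.eq_of_isGaussianWith hψ'
    have h1 := ofRealVec_schurMean_mem hφ'.1 hψ'.1 s t s' t'
    rw [← hl] at h1
    have h2 := hasWignerData_of_isGaussianWith hχ
    rw [← schurCov_eq_phaseCov hφ'.1 hψ'.1, ← eq_of_ofRealVec_mem_lag hct h1] at h2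
    exact h2

end

end

end GaussianProp

end

theorem mainTheorem10 :
    -- `QGauss` is a prop, and positive affine Lagrangian relations form a sub-prop of relations
    QGaussIsProp ∧ RelIsProp ∧ ALRPlusIsSubprop ∧
    -- Wigner data of Gaussian states
    (∀ {n : ℕ} (φ : L2 n) (Φ : Matrix (Fin n) (Fin n) ℂ) (s t : Fin n → ℝ),
      IsGaussianWith φ Φ s t → HasWignerData φ (phaseCov Φ) (Sum.elim s t)) ∧
    -- Gaussian unitaries act on Wigner data by a unique affine symplectomorphism
    (∀ {n : ℕ} (U : L2 n ≃ₗᵢ[ℂ] L2 n), IsGaussianUnitary U →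
      ∃! p : Matrix (Ix n) (Ix n) ℝ × (Ix n → ℝ), RepresentsUnitary p.1 p.2 U) ∧
    -- projections act on Wigner data by Schur complements
    (∀ {m n : ℕ} (φ : L2 (m + n)) (hφ : IsGaussianState φ) (ψ : L2 n) (hψ : IsGaussianState ψ)
      (P : QGauss (m + n) (m + 0)), QGauss.IsTensor P (QGauss.id m) (QGauss.effect ψ hψ) →
      ∃ (χ : L2 (m + 0)) (hχ : IsGaussianState χ),
        P.comp (QGauss.state φ hφ) = QGauss.state χ hχ ∧
        ∀ C μ D ν, HasWignerData φ C μ → HasWignerData ψ D ν →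
          HasWignerData χ (schurCov C D) (schurMean C μ D ν)) ∧
    -- the embedding and its values on generators
    ∃ F : PropEmbedding,
      (∀ {n : ℕ} (φ : L2 n) (hφ : IsGaussianState φ) (Φ : Matrix (Fin n) (Fin n) ℂ)
        (s t : Fin n → ℝ), IsGaussianWith φ Φ s t →
        (F.map (QGauss.state φ hφ)).1 = stateRel Φ s t ∧
        (F.map (QGauss.effect φ hφ)).1 = effectRel Φ s t) ∧
      (∀ {n : ℕ} (U : L2 n ≃ₗᵢ[ℂ] L2 n) (hU : IsGaussianUnitary U)
        (S : Matrix (Ix n) (Ix n) ℝ) (d : Ix n → ℝ), RepresentsUnitary S d U →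
        (F.map (QGauss.unitary U hU)).1 = graphRel S d) :=
  ⟨qGaussIsProp, relIsProp, alrPlusIsSubprop,
    fun _ _ _ _ h => hasWignerData_of_isGaussianWith h,
    fun _ hU => existsUnique_representsUnitary hU,
    exists_projection, embedding,
    fun _ _ _ _ _ h => ⟨toRel_eq _ (rep_ket h), toRel_eq _ (rep_bra h)⟩,
    fun _ hU _ _ h => toRel_eq _ (rep_unitary hU h)⟩
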